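/- **Setup.** Let $\epsilon\in\{\pm1\}$ and $\nu\in\mathbb{C}$. Let $\widetilde{\mathrm{SL}}_2(\mathbb{R})=\mathrm{SL}_2(\mathbb{R})\times\{\pm1\}$ be the metaplectic group with multiplication $(g,\kappa)(g',\kappa')=(gg',\alpha(g,g')\kappa\kappa')$, where $\alpha(g,g')=\big(\tfrac{X(gg')}{X(g)},\tfrac{X(gg')}{X(g')}\big)_H$, $X\begin{pmatrix}a&b\\c&d\end{pmatrix}=c$ if $c\ne0$ and $=d$ if $c=0$, and $(x,y)_H=-1$ if $x,y<0$, $=1$ otherwise. Write $\tilde m_{e_1,e_2}=(e_1I,e_2)$, $\tilde a_u=(\mathrm{diag}(u,u^{-1}),1)$ for $u>0$, $\tilde n_x=\big(\begin{pmatrix}1&x\\0&1\end{pmatrix},1\big)$, $\tilde n_{-,y}=\big(\begin{pmatrix}1&0\\y&1\end{pmatrix},1\big)$, $\tilde s=\big(\begin{pmatrix}0&-1\\1&0\end{pmatrix},1\big)$. Let $V^\infty_{\epsilon,\nu}$ be the space of smooth $f$ on $\widetilde{\mathrm{SL}}_2(\mathbb{R})$ with $f(\tilde g\,\tilde m_{e_1,e_2}\tilde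 a_u\tilde n_{-,y})=\sigma_\epsilon(e_1,e_2)^{-1}u^{1-\nu}f(\tilde g)$, where $\sigma_\epsilon(1,e_2)=e_2$ and $\sigma_\epsilon(-1,e_2)=-e_2\epsilon i$; let $V^{-\infty}_{\epsilon,\nu}$ be the continuous dual of $V^\infty_{-\epsilon,-\nu}$, and let $\pi$ denote the action $(\pi(\tilde g)f)(\tilde h)=f(\tilde g^{-1}\tilde h)$ and its dual. The restriction $T_0$ of $T\in V^{-\infty}_{\epsilon,\nu}$ to $\{\tilde n_x\}\cong\mathbb{R}$ is the distribution $\varphi\mapsto T(h_\varphi)$, where $h_\varphi\in V^\infty_{-\epsilon,-\nu}$ and $h_\varphi(\tilde n_x)=\varphi(x)$. Let $\delta_{\epsilon,\nu,0}$ be evaluation at the identity and $\delta_{\epsilon,\nu,\infty}=\pi(\tilde s)\delta_{\epsilon,\nu,0}$. Let $\tilde\Gamma_1(4)=\big\{\big(\begin{pmatrix}a&b\\c&d\end{pmatrix},\big(\tfrac cd\big)\big): a,b,c,d\in\mathbb{Z},\ ad-bc=1,\ a\equiv d\equiv1,\ c\equiv0\ (\mathrm{mod}\ 4)\big\}$ (Kronecker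 symbol), $\tilde\Gamma_\infty=\{\tilde n_k:k\in\mathbb{Z}\}$ and $\zeta_2(s)=(1-2^{-s})\zeta(s)$. For $\mathrm{Re}(\nu)>1$ the series $$\tilde E^{(\infty)}_{\epsilon,\nu}=\zeta_2(2\nu+1)\sum_{\tilde\gamma\in\tilde\Gamma_1(4)/\tilde\Gamma_\infty}\pi(\tilde\gamma)\delta_{\epsilon,\nu,\infty}$$ converges to an element of $V^{-\infty}_{\epsilon,\nu}$, and its restriction $(\tilde E^{(\infty)}_{\epsilon,\nu})_0$ is $1$-periodic; let $a_{\epsilon,\nu}(n)=\int_0^1(\tilde E^{(\infty)}_{\epsilon,\nu})_0(x)\,e^{-2\pi inx}\,dx$ be its Fourier coefficients. For a nonzero integer $m$ write $m=st$ with $s=\prod_{p^e\|m,\ e>0\text{ even}}p^e$ and $t=\mathrm{sgn}(m)\prod_{p^e\|m,\ e\text{ odd}}p^e$. For $\mathrm{Re}(w)>1$ let $L(w,(\tfrac t\cdot))=\sum_{d\ge1}(\tfrac td)d^{-w}$, let $\mathfrak p_m=1-(\tfrac t2)2^{-\nu-1/2}$ if $2\mid s$ and $\mathfrak p_m=1$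 otherwise, and let $\mathcal L(m;\nu)=P_m(\nu)\,L(\nu+\tfrac12,(\tfrac t\cdot))$ with the Dirichlet polynomial $$P_m(\nu)=\mathfrak p_m\Big(1-\big(\tfrac m2\big)2^{-\nu-\frac12}\Big)\prod_{\substack{p\text{ odd}\\p^e\|t,\,e>0}}\ \sum_{\substack{0\le j\le e-1\\j\text{ even}}}p^{-j\nu}\prod_{\substack{p\text{ odd}\\p^e\|s,\,e>0}}\Big(\big(1-\big(\tfrac tp\big)p^{-\nu-\frac12}\big)\sum_{\substack{0\le j\le e-2\\j\text{ even}}}p^{-j\nu}+p^{-e\nu}\Big).$$ Let $\chi_4$ be the nontrivial character modulo $4$, and let $\chi_8$ be the character modulo $8$ with $\chi_8(1)=\chi_8(3)=1$, $\chi_8(5)=\chi_8(7)=-1$. **Theorem.** Let $n\neq0$ be an integer. The Fourier coefficient $a_{\epsilon,\nu}(n)$ continues holomorphically in $\nu$ to $\mathbb{C}$, except for a simple pole at $\nu=\tfrac12$ when $\epsilon n$ is a square. Moreover $a_{\epsilon,\nu}(n)=c_{\epsilon,\nu}(n)\,\mathcal L(\epsilon n;\nu)$ for $\mathrm{Re}(\nu)>1$.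 The function $L(w,(\tfrac t\cdot))$, with $t$ taken from $\epsilon n=st$, continues meromorphically to $\mathbb{C}$, and the identity $a_{\epsilon,\nu}(n)=c_{\epsilon,\nu}(n)P_{\epsilon n}(\nu)L(\nu+\tfrac12,(\tfrac t\cdot))$ persists for the continuations at every $\nu$ where $L(\cdot,(\tfrac t\cdot))$ is holomorphic at $\nu+\tfrac12$. Here $n=2^\ell n'$ with $n'$ odd, and: * if $\epsilon n\equiv3\ (\mathrm{mod}\ 4)$ or $\ell=1$, then $c_{\epsilon,\nu}(n)=-(1+\epsilon i)4^{-\nu-1}$; * if $\epsilon n\equiv1\ (\mathrm{mod}\ 4)$, then $c_{\epsilon,\nu}(n)=(1+\epsilon i)\big(4^{-\nu-1}+\chi_8(\epsilon n)8^{-\nu-\frac12}\big)$; * if $\ell>1$, then $$c_{\epsilon,\nu}(n)=(1+\epsilon i)\Big(\sum_{\substack{0\le k\le\ell-2\\k\text{ even}}}2^k(2^{k+2})^{-\nu-1}-\delta_{2\nmid\ell}\,2^{\ell-1}(2^{\ell+1})^{-\nu-1}+\delta_{2\mid\ell}\,\chi_4(\epsilon n')2^\ell(2^{\ell+2})^{-\nu-1}+\delta_{2\mid\ell}\,\delta_{\epsilon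 n'\equiv1(4)}\,\chi_8(\epsilon n')2^{\ell+\frac32}(2^{\ell+3})^{-\nu-1}\Big).$$ -/

import Mathlib

open scoped ContDiff Distributions
open TopologicalSpace

noncomputable section

namespace MetaEis

/-! ### The metaplectic group -/

/-- The group `SL₂(ℝ)`. -/
abbrev SL2R : Type := Matrix.SpecialLinearGroup (Fin 2) ℝ

/-- The Hilbert symbol of `ℝ`. -/
def hilbert (x y : ℝ) : ℤˣ := if x < 0 ∧ y < 0 then -1 else 1

/-- Kubota's function `X`: the lower left entry if it is nonzero, else the lower right entry. -/
def kubotaX (g : SL2R) : ℝ := if g 1 0 ≠ 0 then g 1 0 else g 1 1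

/-- Kubota's two-cocycle. -/
def cocycle (g h : SL2R) : ℤˣ :=
  hilbert (kubotaX (g * h) / kubotaX g) (kubotaX (g * h) / kubotaX h)

/-- The underlying set `SL₂(ℝ) × {±1}` of the metaplectic group. -/
@[ext] structure Mp where
  mat : SL2R
  sgn : ℤˣ

theorem kubotaX_ne_zero (g : SL2R) : kubotaX g ≠ 0 := by
  have h := g.det_coe
  rw [Matrix.det_fin_two] at h
  unfold kubotaX
  split_ifs with h0
  · exact h0
  · intro h1
    have h0' : g 1 0 = 0 := not_not.mp h0
    simp [h0', h1] at h

theorem div_neg_iff_xor {x y : ℝ} (hx : x ≠ 0) (hy : y ≠ 0) :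
    x / y < 0 ↔ ((x < 0 ∧ ¬ y < 0) ∨ (¬ x < 0 ∧ y < 0)) := by
  rcases lt_or_gt_of_ne hx with h1 | h1 <;> rcases lt_or_gt_of_ne hy with h2 | h2
  · simp [h1, h2, not_lt.2 (div_pos_of_neg_of_neg h1 h2).le]
  · simp [h1, not_lt.2 h2.le, div_neg_of_neg_of_pos h1 h2]
  · simp [h2, not_lt.2 h1.le, div_neg_of_pos_of_neg h1 h2]
  · simp [not_lt.2 h1.le, not_lt.2 h2.le, (div_pos h1 h2).le]

theorem mul_pos_iff_iff {x y : ℝ} (hx : x ≠ 0) (hy : y ≠ 0) :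
    0 < x * y ↔ (x < 0 ↔ y < 0) := by
  rcases lt_or_gt_of_ne hx with h1 | h1 <;> rcases lt_or_gt_of_ne hy with h2 | h2
  · simp [h1, h2, mul_pos_of_neg_of_neg h1 h2]
  · simp [h1, not_lt.2 h2.le, (mul_neg_of_neg_of_pos h1 h2).le]
  · simp [h2, not_lt.2 h1.le, (mul_neg_of_pos_of_neg h1 h2).le]
  · simp [not_lt.2 h1.le, not_lt.2 h2.le, mul_pos h1 h2]

/-- The sign condition under which the cocycle identity holds. -/
theorem hilbert_cocycle {x y z p q r : ℝ} (hx : x ≠ 0) (hy : y ≠ 0) (hz : z ≠ 0) (hp : p ≠ 0)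
    (hq : q ≠ 0) (hr : r ≠ 0) (h : 0 < (p * q) * (y * r) ∨ 0 < (p * q) * (x * z)) :
    hilbert (p / x) (p / y) * hilbert (r / p) (r / z) =
      hilbert (r / x) (r / q) * hilbert (q / y) (q / z) := by
  have e1 : 0 < (p * q) * (y * r) ↔ ((p < 0 ↔ q < 0) ↔ (y < 0 ↔ r < 0)) := by
    rw [mul_pos_iff_iff (mul_ne_zero hp hq) (mul_ne_zero hy hr), ← not_iff_not, ← not_iff_not,
      ← mul_pos_iff_iff hp hq, ← mul_pos_iff_iff hy hr]
    have := mul_ne_zero hp hq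
    have := mul_ne_zero hy hr
    grind
  have e2 : 0 < (p * q) * (x * z) ↔ ((p < 0 ↔ q < 0) ↔ (x < 0 ↔ z < 0)) := by
    rw [mul_pos_iff_iff (mul_ne_zero hp hq) (mul_ne_zero hx hz), ← not_iff_not, ← not_iff_not,
      ← mul_pos_iff_iff hp hq, ← mul_pos_iff_iff hx hz]
    have := mul_ne_zero hp hq
    have := mul_ne_zero hx hz
    grind
  rw [e1, e2] at h
  unfold hilbert
  simp only [div_neg_iff_xor hp hx, div_neg_iff_xor hp hy, div_neg_iff_xor hr hp,
    div_neg_iff_xor hr hz, div_neg_iff_xor hr hx, div_neg_iff_xor hr hq, div_neg_iff_xor hq hy,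
    div_neg_iff_xor hq hz]
  clear e1 e2
  by_cases a1 : x < 0 <;> by_cases a2 : y < 0 <;> by_cases a3 : z < 0 <;>
    by_cases a4 : p < 0 <;> by_cases a5 : q < 0 <;> by_cases a6 : r < 0 <;>
    simp [a1, a2, a3, a4, a5, a6] at h ⊢

theorem mul_entry (g h : SL2R) (i j : Fin 2) :
    (g * h) i j = g i 0 * h 0 j + g i 1 * h 1 j := by
  have e := congrFun (congrFun (Matrix.SpecialLinearGroup.coe_mul g h) i) j
  rw [Matrix.mul_apply, Fin.sum_univ_two] at e
  exact e

theorem kubotaX_of_ne {g : SL2R} (h : g 1 0 ≠ 0) : kubotaX g = g 1 0 :=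
  if_pos h

theorem kubotaX_of_eq {g : SL2R} (h : g 1 0 = 0) : kubotaX g = g 1 1 :=
  if_neg (not_not.2 h)

theorem det_entry (g : SL2R) : g 0 0 * g 1 1 - g 0 1 * g 1 0 = 1 := by
  have h := g.det_coe
  rwa [Matrix.det_fin_two] at h

theorem kubotaX_mul_pos (g h : SL2R) (H : g 1 0 = 0 ∨ h 1 0 = 0) :
    0 < kubotaX (g * h) * (kubotaX g * kubotaX h) := by
  have hg := det_entry g
  have hh := det_entry h
  by_cases h1 : g 1 0 = 0
  · have e1 : kubotaX (g * h) = kubotaX g * kubotaX h := by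
      have hd : g 1 1 ≠ 0 := by intro h0; simp [h0, h1] at hg
      unfold kubotaX
      by_cases h2 : h 1 0 = 0 <;> simp [mul_entry, h1, h2, hd]
    rw [e1]
    exact mul_self_pos.2 (mul_ne_zero (kubotaX_ne_zero g) (kubotaX_ne_zero h))
  · have h2 : h 1 0 = 0 := H.resolve_left h1
    have ha : h 0 0 ≠ 0 := by intro h0; simp [h0, h2] at hh
    have e2 : kubotaX (g * h) * (kubotaX g * kubotaX h) = (g 1 0) ^ 2 := by
      unfold kubotaX
      simp only [mul_entry, h1, h2, ha, ne_eq, not_false_eq_true, not_true_eq_false, if_true,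
        if_false, mul_zero, add_zero, mul_eq_zero, or_self]
      rw [h2] at hh
      linear_combination (g 1 0) ^ 2 * hh
    rw [e2]
    positivity

theorem cocycle_sign (g₁ g₂ g₃ : SL2R) :
    0 < (kubotaX (g₁ * g₂) * kubotaX (g₂ * g₃)) * (kubotaX g₂ * kubotaX (g₁ * g₂ * g₃)) ∨
      0 < (kubotaX (g₁ * g₂) * kubotaX (g₂ * g₃)) * (kubotaX g₁ * kubotaX g₃) := by
  have n1 := kubotaX_ne_zero g₁
  have n2 := kubotaX_ne_zero g₂
  have n3 := kubotaX_ne_zero g₃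
  have np := kubotaX_ne_zero (g₁ * g₂)
  have nq := kubotaX_ne_zero (g₂ * g₃)
  by_cases h2 : g₂ 1 0 = 0
  · right
    have A := kubotaX_mul_pos g₁ g₂ (Or.inr h2)
    have B := kubotaX_mul_pos g₂ g₃ (Or.inl h2)
    have C := mul_pos A B
    have D : 0 < kubotaX g₂ ^ 2 := by positivity
    refine pos_of_mul_pos_left (b := kubotaX g₂ ^ 2) ?_ D.le
    nlinarith [C]
  by_cases h1 : g₁ 1 0 = 0
  · left
    have A := kubotaX_mul_pos g₁ g₂ (Or.inl h1)
    have B := kubotaX_mul_pos g₁ (g₂ * g₃) (Or.inl h1)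
    rw [← mul_assoc g₁ g₂ g₃] at B
    have C := mul_pos A B
    have D : 0 < kubotaX g₁ ^ 2 := by positivity
    refine pos_of_mul_pos_left (b := kubotaX g₁ ^ 2) ?_ D.le
    nlinarith [C]
  by_cases h3 : g₃ 1 0 = 0
  · left
    have A := kubotaX_mul_pos g₂ g₃ (Or.inr h3)
    have B := kubotaX_mul_pos (g₁ * g₂) g₃ (Or.inr h3)
    have C := mul_pos A B
    have D : 0 < kubotaX g₃ ^ 2 := by positivity
    refine pos_of_mul_pos_left (b := kubotaX g₃ ^ 2) ?_ D.le
    nlinarith [C]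
  have P : (g₁ * g₂) 1 0 * (g₂ * g₃) 1 0 =
      g₂ 1 0 * (g₁ * g₂ * g₃) 1 0 + g₁ 1 0 * g₃ 1 0 := by
    simp only [mul_entry]
    linear_combination (g₁ 1 0 * g₃ 1 0) * det_entry g₂
  have e1 : kubotaX g₁ = g₁ 1 0 := kubotaX_of_ne h1
  have e2 : kubotaX g₂ = g₂ 1 0 := kubotaX_of_ne h2
  have e3 : kubotaX g₃ = g₃ 1 0 := kubotaX_of_ne h3
  by_cases h4 : (g₁ * g₂ * g₃) 1 0 = 0
  · right
    rw [h4, mul_zero, zero_add] at P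
    have hne : (g₁ * g₂) 1 0 * (g₂ * g₃) 1 0 ≠ 0 := by rw [P]; exact mul_ne_zero h1 h3
    have ep : kubotaX (g₁ * g₂) = (g₁ * g₂) 1 0 :=
      kubotaX_of_ne (left_ne_zero_of_mul hne)
    have eq : kubotaX (g₂ * g₃) = (g₂ * g₃) 1 0 :=
      kubotaX_of_ne (right_ne_zero_of_mul hne)
    rw [ep, eq, e1, e3, P]
    exact mul_self_pos.2 (mul_ne_zero h1 h3)
  have e4 : kubotaX (g₁ * g₂ * g₃) = (g₁ * g₂ * g₃) 1 0 := kubotaX_of_ne h4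
  by_cases h5 : (g₁ * g₂) 1 0 * (g₂ * g₃) 1 0 = 0
  · rw [h5] at P
    have hyr : g₂ 1 0 * (g₁ * g₂ * g₃) 1 0 = -(g₁ 1 0 * g₃ 1 0) := by linarith
    rw [e1, e2, e3, e4, hyr]
    have hne : kubotaX (g₁ * g₂) * kubotaX (g₂ * g₃) * (g₁ 1 0 * g₃ 1 0) ≠ 0 :=
      mul_ne_zero (mul_ne_zero np nq) (mul_ne_zero h1 h3)
    rcases lt_or_gt_of_ne hne with h | h
    · left; linarith
    · right; exact h
  · have ep : kubotaX (g₁ * g₂) = (g₁ * g₂) 1 0 :=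
      kubotaX_of_ne (left_ne_zero_of_mul h5)
    have eq : kubotaX (g₂ * g₃) = (g₂ * g₃) 1 0 :=
      kubotaX_of_ne (right_ne_zero_of_mul h5)
    rw [e1, e2, e3, e4, ep, eq]
    have : 0 < ((g₁ * g₂) 1 0 * (g₂ * g₃) 1 0) ^ 2 := by positivity
    have Q : ((g₁ * g₂) 1 0 * (g₂ * g₃) 1 0) ^ 2 =
        (g₁ * g₂) 1 0 * (g₂ * g₃) 1 0 * (g₂ 1 0 * (g₁ * g₂ * g₃) 1 0) +
          (g₁ * g₂) 1 0 * (g₂ * g₃) 1 0 * (g₁ 1 0 * g₃ 1 0) := by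
      linear_combination ((g₁ * g₂) 1 0 * (g₂ * g₃) 1 0) * P
    by_contra! hcon
    linarith [hcon.1, hcon.2]

theorem cocycle_assoc (g₁ g₂ g₃ : SL2R) :
    cocycle g₁ g₂ * cocycle (g₁ * g₂) g₃ = cocycle g₁ (g₂ * g₃) * cocycle g₂ g₃ := by
  unfold cocycle
  rw [← mul_assoc g₁ g₂ g₃]
  exact hilbert_cocycle (kubotaX_ne_zero _) (kubotaX_ne_zero _) (kubotaX_ne_zero _)
    (kubotaX_ne_zero _) (kubotaX_ne_zero _) (kubotaX_ne_zero _) (cocycle_sign g₁ g₂ g₃)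

instance : Mul Mp := ⟨fun g h => ⟨g.mat * h.mat, cocycle g.mat h.mat * g.sgn * h.sgn⟩⟩
instance : One Mp := ⟨⟨1, 1⟩⟩
instance : Inv Mp := ⟨fun g => ⟨g.mat⁻¹, cocycle g.mat⁻¹ g.mat * g.sgn⟩⟩

@[simp] theorem mul_mat (g h : Mp) : (g * h).mat = g.mat * h.mat := rfl
@[simp] theorem mul_sgn (g h : Mp) : (g * h).sgn = cocycle g.mat h.mat * g.sgn * h.sgn := rfl
@[simp] theorem one_mat : (1 : Mp).mat = 1 := rfl
@[simp] theorem one_sgn : (1 : Mp).sgn = 1 := rfl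
@[simp] theorem inv_mat (g : Mp) : (g⁻¹).mat = g.mat⁻¹ := rfl
@[simp] theorem inv_sgn (g : Mp) : (g⁻¹).sgn = cocycle g.mat⁻¹ g.mat * g.sgn := rfl

theorem cocycle_one_left (g : SL2R) : cocycle 1 g = 1 := by
  simp [cocycle, hilbert, div_self (kubotaX_ne_zero g), not_lt.2 zero_le_one]

/-- The metaplectic group, the double cover of `SL₂(ℝ)` given by Kubota's cocycle. -/
instance : Group Mp :=
  Group.ofLeftAxioms
    (fun g h k => by
      ext1
      · simp [mul_assoc]
      · have := cocycle_assoc g.mat h.mat k.mat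
        simp only [mul_sgn, mul_mat]
        calc _ = (cocycle g.mat h.mat * cocycle (g.mat * h.mat) k.mat) * g.sgn * h.sgn * k.sgn := by
              ac_rfl
          _ = _ := by rw [this]; ac_rfl)
    (fun g => by ext1 <;> simp [cocycle_one_left])
    (fun g => by
      ext1
      · simp
      · simp only [mul_sgn, inv_mat, inv_sgn, one_sgn]
        calc _ = (cocycle g.mat⁻¹ g.mat * cocycle g.mat⁻¹ g.mat) * (g.sgn * g.sgn) := by ac_rfl
          _ = 1 := by simp [Int.units_mul_self])

/-- `m̃_{e₁,e₂}` -/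
def mEl (e₁ e₂ : ℤˣ) : Mp :=
  ⟨⟨!![((e₁ : ℤ) : ℝ), 0; 0, ((e₁ : ℤ) : ℝ)], by
    rcases Int.units_eq_one_or e₁ with h | h <;> simp [h, Matrix.det_fin_two]⟩, e₂⟩

/-- `ã_u` -/
def aEl (u : ℝ) (hu : 0 < u) : Mp :=
  ⟨⟨!![u, 0; 0, u⁻¹], by simp [Matrix.det_fin_two, hu.ne']⟩, 1⟩

/-- `ñ_x` -/
def nEl (x : ℝ) : Mp := ⟨⟨!![1, x; 0, 1], by simp [Matrix.det_fin_two]⟩, 1⟩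

/-- `ñ_{-,x}` -/
def nmEl (x : ℝ) : Mp := ⟨⟨!![1, 0; x, 1], by simp [Matrix.det_fin_two]⟩, 1⟩

/-- `s̃`, the lift of the Weyl element -/
def sEl : Mp := ⟨⟨!![0, -1; 1, 0], by simp [Matrix.det_fin_two]⟩, 1⟩

/-! ### Principal series -/

/-- Smoothness on the Lie group `Mp`: the translates of `(x, t, y) ↦ ñ_x ã_{exp t} ñ_{-,y}`
are diffeomorphisms of `ℝ³` onto open subsets that cover the group. -/
def IsSmooth (f : Mp → ℂ) : Prop :=
  ∀ g : Mp, ContDiff ℝ ∞ fun p : ℝ × ℝ × ℝ =>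
    f (g * (nEl p.1 * aEl (Real.exp p.2.1) (Real.exp_pos _) * nmEl p.2.2))

/-- The character `σ_ε` of the group of all `m̃_{e₁,e₂}`. -/
def sigmaChar (ε e₁ e₂ : ℤˣ) : ℂ :=
  if e₁ = 1 then ((e₂ : ℤ) : ℂ) else -((e₂ : ℤ) : ℂ) * ((ε : ℤ) : ℂ) * Complex.I

/-- The value of the quasi-character `ω_{ε,ν}` at `m̃_{e₁,e₂} ã_u ñ_-`. -/
def omegaChar (ε : ℤˣ) (ν : ℂ) (e₁ e₂ : ℤˣ) (u : ℝ) : ℂ :=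
  sigmaChar ε e₁ e₂ * (u : ℂ) ^ (ν - 1)

/-- The smooth principal series space `V^∞_{ε,ν}`. -/
def Smooth (ε : ℤˣ) (ν : ℂ) : Submodule ℂ (Mp → ℂ) where
  carrier := {f | IsSmooth f ∧ ∀ (g : Mp) (e₁ e₂ : ℤˣ) (u : ℝ) (hu : 0 < u) (y : ℝ),
    f (g * (mEl e₁ e₂ * aEl u hu * nmEl y)) = (omegaChar ε ν e₁ e₂ u)⁻¹ * f g}
  add_mem' := fun {f h} hf hh =>
    ⟨fun g => (hf.1 g).add (hh.1 g), fun g e₁ e₂ u hu y => by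
      simp only [Pi.add_apply, hf.2 g e₁ e₂ u hu y, hh.2 g e₁ e₂ u hu y, mul_add]⟩
  zero_mem' := ⟨fun _ => contDiff_const, fun g e₁ e₂ u hu y => by simp⟩
  smul_mem' := fun c f hf =>
    ⟨fun g => contDiff_const.mul (hf.1 g), fun g e₁ e₂ u hu y => by
      simp only [Pi.smul_apply, hf.2 g e₁ e₂ u hu y, smul_eq_mul, mul_left_comm]⟩

/-- The action `(π(γ) f)(g) = f(γ⁻¹ g)` on `V^∞_{ε,ν}`. -/
def smoothAct (ε : ℤˣ) (ν : ℂ) (γ : Mp) : Smooth ε ν →ₗ[ℂ] Smooth ε ν where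
  toFun f := ⟨fun g => f.1 (γ⁻¹ * g),
    fun g => by simpa only [mul_assoc] using f.2.1 (γ⁻¹ * g),
    fun g e₁ e₂ u hu y => by
      simpa only [mul_assoc] using f.2.2 (γ⁻¹ * g) e₁ e₂ u hu y⟩
  map_add' _ _ := rfl
  map_smul' _ _ := rfl

/-- Linear functionals on `V^∞_{-ε,-ν}`. The distributional principal series space `V^{-∞}_{ε,ν}`
consists of the continuous ones, see `Dist`. -/
abbrev Functional (ε : ℤˣ) (ν : ℂ) : Type := Module.Dual ℂ (Smooth (-ε) (-ν))

/-- `V^{-∞}_{ε,ν}`, the continuous dual of `V^∞_{-ε,-ν}`: the functionals that are bounded by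
finitely many derivatives of the restrictions `f₀(x) = f(ñ_x)` and `f_∞(x) = f(s̃⁻¹ ñ_x)`
on a bounded interval. -/
def Dist (ε : ℤˣ) (ν : ℂ) : Submodule ℂ (Functional ε ν) where
  carrier := {T | ∃ (m : ℕ) (R C : ℝ), 0 ≤ C ∧ ∀ (f : Smooth (-ε) (-ν)) (B : ℝ), 
    (∀ j ≤ m, ∀ x : ℝ, |x| ≤ R → ‖iteratedDeriv j (fun t => f.1 (nEl t)) x‖ ≤ B ∧
      ‖iteratedDeriv j (fun t => f.1 (sEl⁻¹ * nEl t)) x‖ ≤ B) → ‖T f‖ ≤ C * B}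
  add_mem' := by
    rintro T U ⟨m, R, C, hC, h⟩ ⟨m', R', C', hC', h'⟩
    refine ⟨max m m', max R R', C + C', by positivity, fun f B hB => ?_⟩
    have h1 := h f B fun j hj x hx => hB j (hj.trans (le_max_left _ _)) x
      (hx.trans (le_max_left _ _))
    have h2 := h' f B fun j hj x hx => hB j (hj.trans (le_max_right _ _)) x
      (hx.trans (le_max_right _ _))
    calc ‖T f + U f‖ ≤ ‖T f‖ + ‖U f‖ := norm_add_le _ _
      _ ≤ (C + C') * B := by linarith
  zero_mem' := ⟨0, 0, 0, le_rfl, fun f B _ => by simp⟩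
  smul_mem' := by
    rintro c T ⟨m, R, C, hC, h⟩
    refine ⟨m, R, ‖c‖ * C, by positivity, fun f B hB => ?_⟩
    have h1 := h f B hB
    calc ‖c • T f‖ = ‖c‖ * ‖T f‖ := norm_smul _ _
      _ ≤ ‖c‖ * (C * B) := by gcongr
      _ = ‖c‖ * C * B := by ring

/-- The action on functionals that is dual to `smoothAct`: `⟨π(γ) T, f⟩ = ⟨T, π(γ⁻¹) f⟩`. -/
def act (ε : ℤˣ) (ν : ℂ) (γ : Mp) (T : Functional ε ν) : Functional ε ν :=
  T ∘ₗ smoothAct (-ε) (-ν) γ⁻¹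

/-- `δ_{ε,ν,0}`, with restrictions `(δ₀, 0)`: evaluation at the identity. -/
def delta0 (ε : ℤˣ) (ν : ℂ) : Functional ε ν where
  toFun f := f.1 1
  map_add' _ _ := rfl
  map_smul' _ _ := rfl

/-- `δ_{ε,ν,∞} = π(s̃) δ_{ε,ν,0}` -/
def deltaInf (ε : ℤˣ) (ν : ℂ) : Functional ε ν := act ε ν sEl (delta0 ε ν)

/-! ### Restriction to `Ñ` -/

/-- The sign of a nonzero real number, as a unit. -/
def sgnU (d : ℝ) : ℤˣ := if d < 0 then -1 else 1

/-- The function on `Mp` supported in `Ñ B̃` that restricts to `φ` on `Ñ ≅ ℝ` and transforms under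
`B̃` by `ω_{ε,ν}`; note that for `d ≠ 0`,
`((a, b; c, d), κ) = ñ_{b/d} m̃_{sgn d, κ (-c, d)} ã_{1/|d|} ñ_{-,c/d}`. -/
def extFun (ε : ℤˣ) (ν : ℂ) (φ : ℝ → ℂ) (g : Mp) : ℂ :=
  if g.mat 1 1 = 0 then 0
  else (omegaChar ε ν (sgnU (g.mat 1 1)) (g.sgn * hilbert (-g.mat 1 0) (g.mat 1 1))
    |g.mat 1 1|⁻¹)⁻¹ * φ (g.mat 0 1 / g.mat 1 1)

theorem extFun_nEl (ε : ℤˣ) (ν : ℂ) (φ : ℝ → ℂ) (x : ℝ) : extFun ε ν φ (nEl x) = φ x := by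
  simp [extFun, nEl, omegaChar, sgnU, sigmaChar, hilbert, not_lt.2 (zero_le_one' ℝ)]

theorem sign_cases (c : ℝ) : (c < 0 ∧ ¬ 0 < c ∧ ¬ c = 0) ∨ (¬ c < 0 ∧ ¬ 0 < c ∧ c = 0) ∨
    (¬ c < 0 ∧ 0 < c ∧ ¬ c = 0) := by
  rcases lt_trichotomy c 0 with h | h | h
  · exact Or.inl ⟨h, h.not_gt, h.ne⟩
  · exact Or.inr (Or.inl ⟨h.not_lt, h.not_gt, h⟩)
  · exact Or.inr (Or.inr ⟨h.not_gt, h, h.ne'⟩)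

theorem hilbert_nmEl {c d y : ℝ} (hd : d ≠ 0) (hy : y ≠ 0) :
    hilbert ((if c + d * y ≠ 0 then c + d * y else d) / (if c ≠ 0 then c else d))
      ((if c + d * y ≠ 0 then c + d * y else d) / y) * hilbert (-(c + d * y)) d =
      hilbert (-c) d := by
  have hdy : 0 < d * y ↔ (d < 0 ↔ y < 0) := mul_pos_iff_iff hd hy
  have hne : d * y ≠ 0 := mul_ne_zero hd hy
  obtain ⟨c', hc'⟩ : ∃ c', c' = c + d * y := ⟨_, rfl⟩
  rw [← hc']
  have hX : (if c' ≠ 0 then c' else d) ≠ 0 := by split_ifs with h <;> assumption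
  have hX' : (if c ≠ 0 then c else d) ≠ 0 := by split_ifs with h <;> assumption
  unfold hilbert
  simp only [div_neg_iff_xor hX hX', div_neg_iff_xor hX hy]
  generalize d * y = p at *
  clear hX hX'
  rcases sign_cases c with ⟨h1, h1', h1''⟩ | ⟨h1, h1', h1''⟩ | ⟨h1, h1', h1''⟩ <;>
    rcases sign_cases c' with ⟨h2, h2', h2''⟩ | ⟨h2, h2', h2''⟩ | ⟨h2, h2', h2''⟩ <;>
    by_cases h3 : d < 0 <;> by_cases h4 : y < 0 <;>
    simp only [h1, h1', h1'', h2, h2', h2'', h3, h4, ne_eq, not_true_eq_false, not_false_eq_true,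
      if_true, if_false, neg_lt_zero, and_true, and_false, or_false,
      or_true, mul_one, one_mul, neg_zero, lt_self_iff_false, iff_true, iff_false,
      Int.units_mul_self] at hdy ⊢ <;>
    (exfalso; grind)

theorem extFun_nmEl (ε : ℤˣ) (ν : ℂ) (φ : ℝ → ℂ) (g : Mp) (y : ℝ) :
    extFun ε ν φ (g * nmEl y) = extFun ε ν φ g := by
  have e01 : (g * nmEl y).mat 0 1 = g.mat 0 1 := by rw [mul_mat, mul_entry]; simp [nmEl]
  have e11 : (g * nmEl y).mat 1 1 = g.mat 1 1 := by rw [mul_mat, mul_entry]; simp [nmEl]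
  have e10 : (g * nmEl y).mat 1 0 = g.mat 1 0 + g.mat 1 1 * y := by
    rw [mul_mat, mul_entry]; simp [nmEl]
  have ey : kubotaX (nmEl y).mat = if y ≠ 0 then y else 1 := by simp [kubotaX, nmEl]
  unfold extFun
  rw [e01, e11]
  by_cases hd : g.mat 1 1 = 0
  · simp [hd]
  have key : (g * nmEl y).sgn * hilbert (-(g * nmEl y).mat 1 0) (g.mat 1 1) =
      g.sgn * hilbert (-g.mat 1 0) (g.mat 1 1) := by
    have es : (nmEl y).sgn = 1 := rfl
    rw [mul_sgn, es, mul_one, e10, mul_comm (cocycle _ _), mul_assoc]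
    congr 1
    unfold cocycle
    rw [ey]
    by_cases hy : y = 0
    · subst hy
      have e : g.mat * (nmEl 0).mat = g.mat := by
        have : (nmEl 0).mat = 1 := by ext i j; fin_cases i <;> fin_cases j <;> simp [nmEl]
        rw [this, mul_one]
      rw [e, div_self (kubotaX_ne_zero _)]
      simp [hilbert, not_lt.2 (zero_le_one' ℝ)]
    · rw [if_pos hy]
      have e : kubotaX (g.mat * (nmEl y).mat) =
          if g.mat 1 0 + g.mat 1 1 * y ≠ 0 then g.mat 1 0 + g.mat 1 1 * y else g.mat 1 1 := by
        rw [← e10, ← e11]; rfl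
      rw [e]
      exact hilbert_nmEl hd hy
  rw [key]

theorem extFun_aEl (ε : ℤˣ) (ν : ℂ) (φ : ℝ → ℂ) (g : Mp) (u : ℝ) (hu : 0 < u) :
    extFun ε ν φ (g * aEl u hu) = ((u : ℂ) ^ (ν - 1))⁻¹ * extFun ε ν φ g := by
  have e01 : (g * aEl u hu).mat 0 1 = g.mat 0 1 * u⁻¹ := by rw [mul_mat, mul_entry]; simp [aEl]
  have e11 : (g * aEl u hu).mat 1 1 = g.mat 1 1 * u⁻¹ := by rw [mul_mat, mul_entry]; simp [aEl]
  have e10 : (g * aEl u hu).mat 1 0 = g.mat 1 0 * u := by rw [mul_mat, mul_entry]; simp [aEl]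
  have ey : kubotaX (aEl u hu).mat = u⁻¹ := by simp [kubotaX, aEl]
  have hui : 0 < u⁻¹ := inv_pos.2 hu
  unfold extFun
  rw [e01, e11, e10]
  by_cases hd : g.mat 1 1 = 0
  · simp [hd]
  have hd' : g.mat 1 1 * u⁻¹ ≠ 0 := mul_ne_zero hd hui.ne'
  have s1 : g.mat 1 1 * u⁻¹ < 0 ↔ g.mat 1 1 < 0 := by
    constructor
    · intro h; by_contra! h'; exact absurd h (not_lt.2 (mul_nonneg h' hui.le))
    · intro h; exact mul_neg_of_neg_of_pos h hui
  have hc : cocycle g.mat (aEl u hu).mat = 1 := by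
    unfold cocycle
    rw [ey, hilbert, if_neg]
    rintro ⟨h1, -⟩
    refine h1.not_ge (le_of_lt ?_)
    by_cases h : g.mat 1 0 = 0
    · have h' : (g.mat * (aEl u hu).mat) 1 0 = 0 := by rw [← mul_mat, e10, h, zero_mul]
      rw [kubotaX_of_eq h, kubotaX_of_eq h', ← mul_mat, e11, mul_div_cancel_left₀ _ hd]
      exact hui
    · have h' : (g.mat * (aEl u hu).mat) 1 0 ≠ 0 := by
        rw [← mul_mat, e10]; exact mul_ne_zero h hu.ne'
      rw [kubotaX_of_ne h, kubotaX_of_ne h', ← mul_mat, e10, mul_div_cancel_left₀ _ h]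
      exact hu
  have key : (g * aEl u hu).sgn * hilbert (-(g.mat 1 0 * u)) (g.mat 1 1 * u⁻¹) =
      g.sgn * hilbert (-g.mat 1 0) (g.mat 1 1) := by
    have es : (aEl u hu).sgn = 1 := rfl
    rw [mul_sgn, es, mul_one, hc, one_mul]
    have s2 : -(g.mat 1 0 * u) < 0 ↔ -g.mat 1 0 < 0 := by
      rw [neg_lt_zero, neg_lt_zero]; exact mul_pos_iff_of_pos_right hu
    simp only [hilbert, s1, s2]
  have hs : sgnU (g.mat 1 1 * u⁻¹) = sgnU (g.mat 1 1) := by simp only [sgnU, s1]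
  have hq : g.mat 0 1 * u⁻¹ / (g.mat 1 1 * u⁻¹) = g.mat 0 1 / g.mat 1 1 :=
    mul_div_mul_right _ _ hui.ne'
  rw [if_neg hd', if_neg hd, key, hs, hq]
  have ha : |g.mat 1 1 * u⁻¹|⁻¹ = |g.mat 1 1|⁻¹ * u := by
    rw [abs_mul, abs_of_pos hui, mul_inv, inv_inv]
  unfold omegaChar
  rw [ha, Complex.ofReal_mul, Complex.mul_cpow_ofReal_nonneg (by positivity) hu.le]
  simp only [mul_inv]
  ring

theorem sigma_mEl (ε e₁ e₂ κ : ℤˣ) {c d : ℝ} (hd : d ≠ 0) :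
    sigmaChar ε (sgnU (d * ((e₁ : ℤ) : ℝ)))
      (hilbert ((if c * ((e₁ : ℤ) : ℝ) ≠ 0 then c * ((e₁ : ℤ) : ℝ) else d * ((e₁ : ℤ) : ℝ)) /
          (if c ≠ 0 then c else d))
        ((if c * ((e₁ : ℤ) : ℝ) ≠ 0 then c * ((e₁ : ℤ) : ℝ) else d * ((e₁ : ℤ) : ℝ)) /
          ((e₁ : ℤ) : ℝ)) * κ * e₂ *
        hilbert (-(c * ((e₁ : ℤ) : ℝ))) (d * ((e₁ : ℤ) : ℝ))) =
      sigmaChar ε e₁ e₂ * sigmaChar ε (sgnU d) (κ * hilbert (-c) d) := by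
  have hI := Complex.I_mul_I
  have hX' : (if c ≠ 0 then c else d) ≠ 0 := by split_ifs with h <;> assumption
  have n1 : ¬ ((-1 : ℤˣ) = 1) := by decide
  rcases Int.units_eq_one_or e₁ with rfl | rfl <;> rcases Int.units_eq_one_or e₂ with rfl | rfl <;>
    rcases Int.units_eq_one_or κ with rfl | rfl <;> rcases Int.units_eq_one_or ε with rfl | rfl <;>
    rcases sign_cases c with ⟨h1, h1', h1''⟩ | ⟨h1, h1', h1''⟩ | ⟨h1, h1', h1''⟩ <;>
    rcases sign_cases d with ⟨h3, h3', h3''⟩ | ⟨h3, h3', h3''⟩ | ⟨h3, h3', h3''⟩ <;>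
    first
    | exact absurd h3'' hd
    | simp [sigmaChar, sgnU, hilbert, h1, h3, h1', h3', h1'', h3'', div_neg, n1, hI]

theorem extFun_mEl (ε : ℤˣ) (ν : ℂ) (φ : ℝ → ℂ) (g : Mp) (e₁ e₂ : ℤˣ) :
    extFun ε ν φ (g * mEl e₁ e₂) = (sigmaChar ε e₁ e₂)⁻¹ * extFun ε ν φ g := by
  have e01 : (g * mEl e₁ e₂).mat 0 1 = g.mat 0 1 * ((e₁ : ℤ) : ℝ) := by
    rw [mul_mat, mul_entry]; simp [mEl]
  have e11 : (g * mEl e₁ e₂).mat 1 1 = g.mat 1 1 * ((e₁ : ℤ) : ℝ) := by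
    rw [mul_mat, mul_entry]; simp [mEl]
  have e10 : (g * mEl e₁ e₂).mat 1 0 = g.mat 1 0 * ((e₁ : ℤ) : ℝ) := by
    rw [mul_mat, mul_entry]; simp [mEl]
  have ey : kubotaX (mEl e₁ e₂).mat = ((e₁ : ℤ) : ℝ) := by simp [kubotaX, mEl]
  have he : ((e₁ : ℤ) : ℝ) ≠ 0 := by rw [← ey]; exact kubotaX_ne_zero _
  have hab : |((e₁ : ℤ) : ℝ)| = 1 := by
    rcases Int.units_eq_one_or e₁ with h | h <;> simp [h]
  unfold extFun
  rw [e01, e11, e10]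
  by_cases hd : g.mat 1 1 = 0
  · simp [hd]
  have hX : kubotaX (g.mat * (mEl e₁ e₂).mat) =
      if g.mat 1 0 * ((e₁ : ℤ) : ℝ) ≠ 0 then g.mat 1 0 * ((e₁ : ℤ) : ℝ)
      else g.mat 1 1 * ((e₁ : ℤ) : ℝ) := by
    rw [← e10, ← e11]; rfl
  have key := sigma_mEl ε e₁ e₂ g.sgn (c := g.mat 1 0) hd
  have hX0 : kubotaX g.mat = if g.mat 1 0 ≠ 0 then g.mat 1 0 else g.mat 1 1 := rfl
  have es : (mEl e₁ e₂).sgn = e₂ := rfl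
  rw [if_neg (mul_ne_zero hd he), if_neg hd, mul_sgn, es, cocycle, hX, hX0, ey, omegaChar, key,
    mul_div_mul_right _ _ he, abs_mul, hab, mul_one, omegaChar]
  simp only [mul_inv]
  ring

theorem extFun_transform (ε : ℤˣ) (ν : ℂ) (φ : ℝ → ℂ) (g : Mp) (e₁ e₂ : ℤˣ) (u : ℝ) (hu : 0 < u)
    (y : ℝ) : extFun ε ν φ (g * (mEl e₁ e₂ * aEl u hu * nmEl y)) =
      (omegaChar ε ν e₁ e₂ u)⁻¹ * extFun ε ν φ g := by
  rw [← mul_assoc, ← mul_assoc, extFun_nmEl, extFun_aEl, extFun_mEl, omegaChar, mul_inv]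
  ring

theorem contDiffAt_cpow {r : ℝ → ℝ} {x : ℝ} (w : ℂ) (hr : ContDiffAt ℝ ∞ r x) (h0 : 0 < r x) :
    ContDiffAt ℝ ∞ (fun t => ((r t : ℝ) : ℂ) ^ w) x := by
  have h1 : ContDiffAt ℝ ∞ (fun t => Complex.exp ((Real.log (r t) : ℂ) * w)) x :=
    ((Complex.ofRealCLM.contDiff.contDiffAt.comp x (hr.log h0.ne')).mul contDiffAt_const).cexp
  refine h1.congr_of_eventuallyEq ?_
  filter_upwards [hr.continuousAt.eventually (lt_mem_nhds h0)] with t ht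
  have ht' : 0 < r t := ht
  rw [Complex.cpow_def_of_ne_zero (by exact_mod_cast ht'.ne'), Complex.ofReal_log ht'.le]

theorem extFun_mul_nEl (ε : ℤˣ) (ν : ℂ) (φ : ℝ → ℂ) (g : Mp) (x : ℝ) :
    extFun ε ν φ (g * nEl x) = if g.mat 1 0 * x + g.mat 1 1 = 0 then 0
      else (omegaChar ε ν (sgnU (g.mat 1 0 * x + g.mat 1 1))
        (g.sgn * hilbert (-g.mat 1 0) (g.mat 1 0 * x + g.mat 1 1))
        |g.mat 1 0 * x + g.mat 1 1|⁻¹)⁻¹ *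
          φ ((g.mat 0 0 * x + g.mat 0 1) / (g.mat 1 0 * x + g.mat 1 1)) := by
  have e01 : (g * nEl x).mat 0 1 = g.mat 0 0 * x + g.mat 0 1 := by
    rw [mul_mat, mul_entry]; simp [nEl]
  have e11 : (g * nEl x).mat 1 1 = g.mat 1 0 * x + g.mat 1 1 := by
    rw [mul_mat, mul_entry]; simp [nEl]
  have e10 : (g * nEl x).mat 1 0 = g.mat 1 0 := by rw [mul_mat, mul_entry]; simp [nEl]
  have hX : kubotaX (g.mat * (nEl x).mat) = kubotaX g.mat := by
    by_cases h : g.mat 1 0 = 0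
    · rw [kubotaX_of_eq h, kubotaX_of_eq (by rw [← mul_mat, e10, h]), ← mul_mat, e11, h]; simp
    · rw [kubotaX_of_ne h, kubotaX_of_ne (by rw [← mul_mat, e10]; exact h), ← mul_mat, e10]
  have es : (g * nEl x).sgn = g.sgn := by
    have h1 : (nEl x).sgn = 1 := rfl
    rw [mul_sgn, h1, cocycle, hX, div_self (kubotaX_ne_zero _)]
    simp [hilbert, not_lt.2 (zero_le_one' ℝ)]
  unfold extFun
  rw [e01, e11, e10, es]

theorem contDiff_extFun_nEl (ε : ℤˣ) (ν : ℂ) {φ : ℝ → ℂ} (hφ : ContDiff ℝ ∞ φ)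
    (hc : HasCompactSupport φ) (g : Mp) : ContDiff ℝ ∞ fun x => extFun ε ν φ (g * nEl x) := by
  have hdet := det_entry g.mat
  simp only [extFun_mul_nEl]
  generalize g.mat 0 0 = a at *
  generalize g.mat 0 1 = b at *
  generalize g.mat 1 0 = c at *
  generalize g.mat 1 1 = d at *
  have hN : ContDiff ℝ ∞ fun x : ℝ => a * x + b := by fun_prop
  have hD : ContDiff ℝ ∞ fun x : ℝ => c * x + d := by fun_prop
  rw [contDiff_iff_contDiffAt]
  intro x
  by_cases h0 : c * x + d = 0
  · obtain ⟨R, hR⟩ := hc.isCompact.isBounded.subset_closedBall 0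
    have hNx : a * x + b ≠ 0 := by
      intro h
      apply one_ne_zero (α := ℝ)
      linear_combination a * h0 - c * h - hdet
    have hev : ∀ᶠ t in nhds x, R * |c * t + d| < |a * t + b| := by
      have c1 : Filter.Tendsto (fun t : ℝ => R * |c * t + d|) (nhds x) (nhds (R * |c * x + d|)) :=
        (continuous_const.mul (hD.continuous.abs)).tendsto x
      have c2 : Filter.Tendsto (fun t : ℝ => |a * t + b|) (nhds x) (nhds |a * x + b|) :=
        hN.continuous.abs.tendsto x
      refine c1.eventually_lt c2 ?_
      rw [h0, abs_zero, mul_zero]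
      exact abs_pos.2 hNx
    refine (contDiffAt_const (c := (0 : ℂ))).congr_of_eventuallyEq ?_
    filter_upwards [hev] with t ht
    split_ifs with h
    · rfl
    · have hz : φ ((a * t + b) / (c * t + d)) = 0 := by
        by_contra hne
        have hm := hR (subset_tsupport φ (Function.mem_support.2 hne))
        rw [Metric.mem_closedBall, dist_zero_right, Real.norm_eq_abs, abs_div,
          div_le_iff₀ (abs_pos.2 h)] at hm
        exact absurd hm (not_le.2 ht)
      rw [hz, mul_zero]
  · have hev : ∀ᶠ t in nhds x, c * t + d ≠ 0 ∧ (c * t + d < 0 ↔ c * x + d < 0) := by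
      rcases lt_or_gt_of_ne h0 with h | h
      · filter_upwards [hD.continuous.continuousAt.eventually (gt_mem_nhds h)] with t ht
        exact ⟨ht.ne, iff_of_true ht h⟩
      · filter_upwards [hD.continuous.continuousAt.eventually (lt_mem_nhds h)] with t ht
        exact ⟨(ht : (0 : ℝ) < c * t + d).ne', iff_of_false (not_lt.2 (le_of_lt ht)) h.not_gt⟩
    have hr : ContDiffAt ℝ ∞ (fun t : ℝ => |c * t + d|⁻¹) x :=
      (ContDiffAt.abs hD.contDiffAt h0).inv (abs_ne_zero.2 h0)
    have hp := contDiffAt_cpow (ν - 1) hr (inv_pos.2 (abs_pos.2 h0))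
    have hp0 : ((|c * x + d|⁻¹ : ℝ) : ℂ) ^ (ν - 1) ≠ 0 := by
      rw [Complex.cpow_def_of_ne_zero]
      · exact Complex.exp_ne_zero _
      · exact_mod_cast inv_ne_zero (abs_ne_zero.2 h0)
    have hq : ContDiffAt ℝ ∞ (fun t : ℝ => φ ((a * t + b) / (c * t + d))) x :=
      ContDiffAt.comp x hφ.contDiffAt (hN.contDiffAt.div hD.contDiffAt h0)
    have hall := ((contDiffAt_const (x := x)
      (c := (sigmaChar ε (sgnU (c * x + d)) (g.sgn * hilbert (-c) (c * x + d)))⁻¹)).mul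
        (hp.inv hp0)).mul hq
    refine hall.congr_of_eventuallyEq ?_
    filter_upwards [hev] with t ht
    have e1 : sgnU (c * t + d) = sgnU (c * x + d) := by simp only [sgnU, ht.2]
    have e2 : hilbert (-c) (c * t + d) = hilbert (-c) (c * x + d) := by
      simp only [hilbert, ht.2]
    rw [if_neg ht.1, e1, e2, omegaChar, mul_inv]
    rfl

theorem extFun_mem (ε : ℤˣ) (ν : ℂ) {φ : ℝ → ℂ} (hφ : ContDiff ℝ ∞ φ)
    (hc : HasCompactSupport φ) : extFun ε ν φ ∈ Smooth ε ν := by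
  refine ⟨fun g => ?_, extFun_transform ε ν φ⟩
  have h1 : ContDiff ℝ ∞ fun t : ℝ => (((Real.exp t : ℝ) : ℂ) ^ (ν - 1))⁻¹ := by
    rw [contDiff_iff_contDiffAt]
    intro t
    refine (contDiffAt_cpow (ν - 1) Real.contDiff_exp.contDiffAt (Real.exp_pos t)).inv ?_
    rw [Complex.cpow_def_of_ne_zero (by exact_mod_cast (Real.exp_pos t).ne')]
    exact Complex.exp_ne_zero _
  have h2 := contDiff_extFun_nEl ε ν hφ hc g
  have h3 : ContDiff ℝ ∞ fun p : ℝ × ℝ × ℝ =>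
      (((Real.exp p.2.1 : ℝ) : ℂ) ^ (ν - 1))⁻¹ * extFun ε ν φ (g * nEl p.1) :=
    (ContDiff.snd' (ContDiff.fst' h1)).mul (ContDiff.fst' h2)
  convert h3 using 2 with p
  rw [← mul_assoc, ← mul_assoc, extFun_nmEl, extFun_aEl]

/-- The element `h_φ` of `V^∞_{ε,ν}` whose restriction to `Ñ` is the test function `φ`. -/
def ext (ε : ℤˣ) (ν : ℂ) (φ : 𝓓((⊤ : Opens ℝ), ℂ)) : Smooth ε ν :=
  ⟨extFun ε ν φ, extFun_mem ε ν φ.contDiff φ.hasCompactSupport⟩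

/-- The restriction `T₀` of `T` to `Ñ ≅ ℝ`, as a functional on test functions. -/
def restrictN {ε : ℤˣ} {ν : ℂ} (T : Functional ε ν) (φ : 𝓓((⊤ : Opens ℝ), ℂ)) : ℂ :=
  T (ext (-ε) (-ν) φ)

/-! ### Fourier coefficients of periodic distributions -/

/-- A smooth compactly supported function whose integer translates add up to `1`. -/
def IsPeriodUnity (ψ : 𝓓((⊤ : Opens ℝ), ℂ)) : Prop :=
  ∀ x : ℝ, HasSum (fun k : ℤ => ψ (x + k)) 1

/-- The test function `ψ(x) e(-nx)`, where `e(x) = exp(2πix)`. -/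
def modulate (ψ : 𝓓((⊤ : Opens ℝ), ℂ)) (n : ℤ) : 𝓓((⊤ : Opens ℝ), ℂ) where
  toFun x := ψ x * Complex.exp (2 * Real.pi * Complex.I * (-n * x))
  contDiff' := by
    have h : ContDiff ℝ ∞ fun x : ℝ => Complex.exp (2 * Real.pi * Complex.I * (-n * x)) :=
      (contDiff_const.mul (contDiff_const.mul Complex.ofRealCLM.contDiff)).cexp
    exact ψ.contDiff.mul h
  hasCompactSupport' := ψ.hasCompactSupport.mul_right
  tsupport_subset' := fun _ _ => trivial

/-- `a` is the `n`-th Fourier coefficient `∫₀¹ T(x) e(-nx) dx` of the `1`-periodic distribution `T`: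
integration over a period is pairing with any `ψ` whose integer translates add up to `1`. -/
def IsFourierCoeff (T : 𝓓((⊤ : Opens ℝ), ℂ) → ℂ) (n : ℤ) (a : ℂ) : Prop :=
  ∀ ψ : 𝓓((⊤ : Opens ℝ), ℂ), IsPeriodUnity ψ → T (modulate ψ n) = a

theorem exists_isPeriodUnity : ∃ ψ : 𝓓((⊤ : Opens ℝ), ℂ), IsPeriodUnity ψ := by
  have h0 : ∀ {x : ℝ}, x ≤ 0 → Real.smoothTransition x = 0 := Real.smoothTransition.zero_of_nonpos
  have h1 : ∀ {x : ℝ}, 1 ≤ x → Real.smoothTransition x = 1 := Real.smoothTransition.one_of_one_le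
  refine ⟨⟨fun x => ((Real.smoothTransition (x + 1) - Real.smoothTransition x : ℝ) : ℂ), ?_, ?_,
    fun _ _ => trivial⟩, fun x => ?_⟩
  · have h : ContDiff ℝ ∞ Real.smoothTransition := Real.smoothTransition.contDiff
    exact Complex.ofRealCLM.contDiff.comp ((h.comp (contDiff_id.add contDiff_const)).sub h)
  · refine HasCompactSupport.of_support_subset_isCompact (isCompact_Icc (a := (-1 : ℝ)) (b := 1)) ?_
    intro x hx
    by_contra hn
    apply hx
    rw [Set.mem_Icc, not_and_or, not_le, not_le] at hn
    rcases hn with h | h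
    · simp [h0 (by linarith : x + 1 ≤ 0), h0 (by linarith : x ≤ 0)]
    · simp [h1 (by linarith : 1 ≤ x + 1), h1 h.le]
  · have hs : ∀ k : ℤ, k ∉ ({-⌊x⌋ - 1, -⌊x⌋} : Finset ℤ) →
        ((Real.smoothTransition (x + k + 1) - Real.smoothTransition (x + k) : ℝ) : ℂ) = 0 := by
      intro k hk
      simp only [Finset.mem_insert, Finset.mem_singleton, not_or] at hk
      have hf0 := Int.floor_le x
      have hf1 := Int.lt_floor_add_one x
      rcases lt_or_gt_of_ne hk.1 with h | h
      · have h' : (k : ℝ) ≤ -⌊x⌋ - 1 - 1 := by exact_mod_cast (by omega : k ≤ -⌊x⌋ - 1 - 1)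
        simp [h0 (by linarith : x + k + 1 ≤ 0), h0 (by linarith : x + k ≤ 0)]
      · have h' : (1 : ℝ) - ⌊x⌋ ≤ k := by exact_mod_cast (by omega : 1 - ⌊x⌋ ≤ k)
        simp [h1 (by linarith : 1 ≤ x + k + 1), h1 (by linarith : 1 ≤ x + k)]
    have key : HasSum (fun k : ℤ =>
        ((Real.smoothTransition (x + k + 1) - Real.smoothTransition (x + k) : ℝ) : ℂ)) _ :=
      hasSum_sum_of_ne_finset_zero hs
    rw [Finset.sum_pair (by omega)] at key
    have hf0 := Int.floor_le x
    have hf1 := Int.lt_floor_add_one x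
    have e : ((Real.smoothTransition (x + ((-⌊x⌋ - 1 : ℤ) : ℝ) + 1) -
        Real.smoothTransition (x + ((-⌊x⌋ - 1 : ℤ) : ℝ)) : ℝ) : ℂ) +
        ((Real.smoothTransition (x + ((-⌊x⌋ : ℤ) : ℝ) + 1) -
        Real.smoothTransition (x + ((-⌊x⌋ : ℤ) : ℝ)) : ℝ) : ℂ) = 1 := by
      push_cast
      rw [h0 (by linarith : x + (-(⌊x⌋ : ℝ) - 1) ≤ 0), h1 (by linarith : 1 ≤ x + -(⌊x⌋ : ℝ) + 1)]
      have : x + (-(⌊x⌋ : ℝ) - 1) + 1 = x + -(⌊x⌋ : ℝ) := by ring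
      rw [this]
      push_cast
      ring
    rw [e] at key
    exact key

/-! ### The Eisenstein distribution -/

/-- The Kronecker symbol `(a/n)`. -/
def kronecker (a n : ℤ) : ℤ :=
  if n = 0 then (if a.natAbs = 1 then 1 else 0)
  else (if n < 0 ∧ a < 0 then -1 else 1) * ZMod.χ₈ (a : ZMod 8) ^ padicValInt 2 n *
    jacobiSym a (ordCompl[2] n.natAbs)

/-- `Γ̃₁(4)` -/
def Gamma14 : Set Mp :=
  {g | ∃ a b c d : ℤ, (g.mat 0 0 = a ∧ g.mat 0 1 = b ∧ g.mat 1 0 = c ∧ g.mat 1 1 = d) ∧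
    a ≡ 1 [ZMOD 4] ∧ d ≡ 1 [ZMOD 4] ∧ c ≡ 0 [ZMOD 4] ∧ (g.sgn : ℤ) = kronecker c d}

theorem nEl_mul (x y : ℝ) : nEl x * nEl y = nEl (x + y) := by
  ext1
  · ext i j
    rw [mul_mat, mul_entry]
    fin_cases i <;> fin_cases j <;> simp [nEl, add_comm]
  · have e : ∀ t : ℝ, kubotaX (nEl t).mat = 1 := fun t => by simp [kubotaX, nEl]
    have hm : (nEl x).mat * (nEl y).mat = (nEl (x + y)).mat := by
      ext i j
      rw [mul_entry]
      fin_cases i <;> fin_cases j <;> simp [nEl, add_comm]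
    have es : ∀ t : ℝ, (nEl t).sgn = 1 := fun t => rfl
    rw [mul_sgn, cocycle, hm, e, e, e, es, es, es]
    simp [hilbert, not_lt.2 (zero_le_one' ℝ)]

theorem nEl_zero : nEl 0 = 1 := by
  ext1
  · ext i j; fin_cases i <;> fin_cases j <;> simp [nEl]
  · rfl

/-- `Γ̃_∞`, the group of all `ñ_k` with `k ∈ ℤ`. -/
def GammaInf : Subgroup Mp where
  carrier := {g | ∃ k : ℤ, g = nEl k}
  mul_mem' := by
    rintro _ _ ⟨k, rfl⟩ ⟨l, rfl⟩
    exact ⟨k + l, by rw [nEl_mul]; push_cast; rfl⟩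
  one_mem' := ⟨0, by rw [Int.cast_zero, nEl_zero]⟩
  inv_mem' := by
    rintro _ ⟨k, rfl⟩
    exact ⟨-k, inv_eq_of_mul_eq_one_right (by
      rw [nEl_mul]; push_cast; rw [add_neg_cancel, nEl_zero])⟩

/-- The coset space `Γ̃₁(4) / Γ̃_∞`. -/
def Cosets : Set (Mp ⧸ GammaInf) := QuotientGroup.mk '' Gamma14

/-- `ζ₂(s) = (1 - 2^{-s}) ζ(s)` -/
def zeta2 (s : ℂ) : ℂ := (1 - 2 ^ (-s)) * riemannZeta s

/-- The summand `π(γ) δ_{ε,ν,∞}` that belongs to the coset `γ Γ̃_∞`; it does not depend on the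
representative, since `δ_{ε,ν,∞}` is invariant under `Γ̃_∞`. -/
def eisTerm (ε : ℤˣ) (ν : ℂ) (q : Cosets) : Functional ε ν :=
  act ε ν q.1.out (deltaInf ε ν)

open Classical in
/-- The metaplectic Eisenstein distribution at `∞`,
`ζ₂(2ν+1) ∑ π(γ) δ_{ε,ν,∞}` over `Γ̃₁(4) / Γ̃_∞`, where the series converges. -/
def eisenstein (ε : ℤˣ) (ν : ℂ) : Functional ε ν :=
  if h : ∀ f : Smooth (-ε) (-ν), Summable fun q : Cosets => eisTerm ε ν q f then
    { toFun := fun f => zeta2 (2 * ν + 1) * ∑' q : Cosets, eisTerm ε ν q f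
      map_add' := fun f f' => by
        simp only [map_add]
        rw [(h f).tsum_add (h f'), mul_add]
      map_smul' := fun c f => by
        simp only [map_smul, smul_eq_mul, RingHom.id_apply]
        rw [tsum_mul_left]
        ring }
  else 0

/-! ### The explicit formulas -/

/-- `s`: the product of the prime powers that exactly divide `m` with even exponent. -/
def evenPart (m : ℤ) : ℕ :=
  ∏ p ∈ m.natAbs.primeFactors with Even (m.natAbs.factorization p),
    p ^ m.natAbs.factorization p

/-- `t`: the sign of `m` times the product of the prime powers that exactly divide `m` with odd
exponent. -/
def oddPart (m : ℤ) : ℤ :=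
  m.sign * ((∏ p ∈ m.natAbs.primeFactors with Odd (m.natAbs.factorization p),
    p ^ m.natAbs.factorization p : ℕ) : ℤ)

/-- The Dirichlet polynomial in `𝓛(m; ν)`. -/
def dirichletPoly (m : ℤ) (ν : ℂ) : ℂ :=
  (if 2 ∣ evenPart m then 1 - (kronecker (oddPart m) 2 : ℂ) * 2 ^ (-ν - 1 / 2) else 1) *
  (1 - (kronecker m 2 : ℂ) * 2 ^ (-ν - 1 / 2)) *
  (∏ p ∈ (oddPart m).natAbs.primeFactors.erase 2,
    ∑ j ∈ Finset.range ((oddPart m).natAbs.factorization p) with Even j,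
      (p : ℂ) ^ (-(j : ℂ) * ν)) *
  (∏ p ∈ (evenPart m).primeFactors.erase 2,
    ((1 - (kronecker (oddPart m) p : ℂ) * (p : ℂ) ^ (-ν - 1 / 2)) *
      (∑ j ∈ Finset.range ((evenPart m).factorization p - 1) with Even j,
        (p : ℂ) ^ (-(j : ℂ) * ν)) +
      (p : ℂ) ^ (-((evenPart m).factorization p : ℂ) * ν)))

/-- The Dirichlet series `L(w, (t/·)) = ∑_{d > 0} (t/d) d^{-w}`. -/
def kroneckerL (t : ℤ) (w : ℂ) : ℂ := LSeries (fun d : ℕ => (kronecker t d : ℂ)) w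

/-- `𝓛(m; ν)` in the domain of convergence. -/
def scriptL (m : ℤ) (ν : ℂ) : ℂ := dirichletPoly m ν * kroneckerL (oddPart m) (ν + 1 / 2)

/-- The factor `c_{ε,ν}(n)`, for `n = 2^ℓ n'` with `n'` odd. -/
def cCoeff (ε : ℤˣ) (n : ℤ) (ν : ℂ) : ℂ :=
  let l : ℕ := padicValInt 2 n
  let m' : ℤ := (ε : ℤ) * (n / 2 ^ l)
  (1 + ((ε : ℤ) : ℂ) * Complex.I) *
    if l = 1 ∨ (ε : ℤ) * n ≡ 3 [ZMOD 4] then -(4 : ℂ) ^ (-ν - 1)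
    else if (ε : ℤ) * n ≡ 1 [ZMOD 4] then
      (4 : ℂ) ^ (-ν - 1) + (ZMod.χ₈' (((ε : ℤ) * n : ℤ) : ZMod 8) : ℂ) * 8 ^ (-ν - 1 / 2)
    else
      (∑ k ∈ Finset.range (l - 1) with Even k, 2 ^ k * ((2 : ℂ) ^ (k + 2)) ^ (-ν - 1)) -
      (if Odd l then 2 ^ (l - 1) * ((2 : ℂ) ^ (l + 1)) ^ (-ν - 1) else 0) +
      (if Even l then (ZMod.χ₄ (m' : ZMod 4) : ℂ) * (2 ^ l * ((2 : ℂ) ^ (l + 2)) ^ (-ν - 1))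
        else 0) +
      (if Even l ∧ m' ≡ 1 [ZMOD 4] then
        (ZMod.χ₈' (m' : ZMod 8) : ℂ) *
          (2 ^ ((l : ℂ) + 3 / 2) * ((2 : ℂ) ^ (l + 3)) ^ (-ν - 1))
        else 0)

end MetaEis

end

/-! For Re ν > 1 the Eisenstein series is a sum of point evaluations. The functional of γ is
evaluation at γ s̃, and by equivariance it depends only on the first column (a, c) of γ and on its
metaplectic sign: on an extension h_φ with c ≠ 0 it is a unimodular factor times |c|^(-ν-1) φ(a/c),
and for c = 0 it vanishes. The cosets are exactly the primitive columns with a ≡ 1, c ≡ 0 mod 4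
(`col_injective`, `exists_col_eq`). Since ad = 1 + bc, the sign (c/d) equals (|c|/|a|), again a
function of the column (`kronecker_eq_jacobiSym`). Making c positive moves the sign of c into the
class of a mod 4. Pairing with ψ(x)e(-nx), where the integer translates of ψ add up to 1, collapses
the sum over each class of a mod c. The coefficient becomes ζ₂(2ν+1) ∑ S(c) c^(-ν-1) over positive
multiples c of 4, with finite exponential sums S(c), here `eisSum` (`isFourierCoeff_eisenstein`).

Quadratic reciprocity rewrites S(c) through symbols modulo the odd part of c, and the Chinese
remainder theorem splits it into a sum of modulus 2^k and a normalized Gauss sum of odd modulus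
(`eisSum_two_pow_mul`). The normalization by 1 or εi makes the odd sums multiplicative
(`oddSum_mul`), and together with the sign of the quadratic Gauss sum it turns n into εn. Only
finitely many powers of 2 contribute, and they give c_{ε,ν}(n) (`hasSum_twoSum`). The odd moduli
have an Euler product with finite local sums; times the factor of ζ(2ν+1) at p, each is the Euler
factor of L(ν+1/2, (t/·)) times the factor of P at p (`tsum_oddTerm_prime`,
`zeta2_mul_tsum_oddTerm`).

The sign of the Gauss sum is obtained by Gauss's method: an alternating sum of q-binomial
coefficients is a product, which at a root of unity becomes a product of sines with visible signs
(`sum_jacobi_eAdd_prime`).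

For the continuation, the part of L(w, (t/·)) over odd d is the L-function of a Dirichlet character
modulo 4|t|, and the factors of P at 2 are exactly the inverse Euler factor at 2
(`kronecker_two_factor`). So the coefficient is an entire function times a Dirichlet L-function. The
character is trivial exactly when εn is a square; then the pole at ν = 1/2 survives, because the
other factors are products of 1 + εi and positive numbers there. -/

noncomputable section

namespace MetaEis

/-! ### The sign of the quadratic Gauss sum -/

/-- The Gaussian binomial coefficient `[i + j; j]` at `q`. -/
def gaussBinom (q : ℂ) : ℕ → ℕ → ℂ
  | 0, _ => 1
  | _ + 1, 0 => 1
  | i + 1, j + 1 => gaussBinom q i (j + 1) + q ^ (i + 1) * gaussBinom q (i + 1) j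

theorem gaussBinom_zero_left (q : ℂ) (j : ℕ) : gaussBinom q 0 j = 1 := by
  rw [gaussBinom]

theorem gaussBinom_zero_right (q : ℂ) (i : ℕ) : gaussBinom q i 0 = 1 := by
  cases i <;> rw [gaussBinom]

theorem gaussBinom_succ_succ (q : ℂ) (i j : ℕ) : gaussBinom q (i + 1) (j + 1) =
    gaussBinom q i (j + 1) + q ^ (i + 1) * gaussBinom q (i + 1) j := by
  rw [gaussBinom]

/-- Neighbouring entries in one row of the q-Pascal triangle. The cross-multiplied form avoids the
quotient formula, whose denominators can vanish at roots of unity; Pascal's rule and a double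
induction suffice. -/
theorem gaussBinom_ratio (q : ℂ) (i j : ℕ) :
    (1 - q ^ (i + 1)) * gaussBinom q (i + 1) j = (1 - q ^ (j + 1)) * gaussBinom q i (j + 1) := by
  induction i generalizing j with
  | zero =>
    induction j with
    | zero => simp [gaussBinom_zero_left, gaussBinom_zero_right]
    | succ j ih =>
      rw [gaussBinom_succ_succ, mul_add, mul_left_comm, ih]
      simp only [gaussBinom_zero_left]
      ring
  | succ i ihi =>
    induction j with
    | zero =>
      have h := ihi 0
      rw [gaussBinom_zero_right] at h
      rw [gaussBinom_zero_right, gaussBinom_succ_succ, mul_add, ← h, gaussBinom_zero_right]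
      ring
    | succ j ih =>
      rw [gaussBinom_succ_succ, mul_add, mul_left_comm, ih, gaussBinom_succ_succ q i (j + 1),
        mul_add, ← ihi (j + 1)]
      ring

theorem gaussBinom_absorb (q : ℂ) (i j : ℕ) :
    (1 - q ^ (i + 1)) * gaussBinom q (i + 1) j = (1 - q ^ (i + 1 + j)) * gaussBinom q i j := by
  cases j with
  | zero => simp [gaussBinom_zero_right]
  | succ j =>
    rw [gaussBinom_succ_succ, mul_add, mul_left_comm, gaussBinom_ratio]
    ring

/-- The alternating sum of the Gaussian binomial coefficients of order `m`. -/
def gaussAlt (q : ℂ) (m : ℕ) : ℂ :=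
  ∑ p ∈ Finset.HasAntidiagonal.antidiagonal m, (-1) ^ p.2 * gaussBinom q p.1 p.2

/-- Under Pascal's rule the alternating signs telescope order m + 2 into order m + 1 with weights 1
- q^i. Absorption then lowers the row once more, and the factor 1 - q^(m+1) is common to all terms.
-/
theorem gaussAlt_add_two (q : ℂ) (m : ℕ) :
    gaussAlt q (m + 2) = (1 - q ^ (m + 1)) * gaussAlt q m := by
  have h1 : gaussAlt q (m + 2) = ∑ p ∈ Finset.HasAntidiagonal.antidiagonal (m + 1),
      (-1) ^ p.2 * ((1 - q ^ p.1) * gaussBinom q p.1 p.2) := by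
    have e1 : ∑ p ∈ Finset.HasAntidiagonal.antidiagonal (m + 1), (-1) ^ p.2 * gaussBinom q p.1 p.2 =
        (-1) ^ (0 : ℕ) * gaussBinom q (m + 1) 0 + ∑ p ∈ Finset.HasAntidiagonal.antidiagonal m,
          (-1) ^ (p.2 + 1) * gaussBinom q p.1 (p.2 + 1) := by
      rw [Finset.Nat.sum_antidiagonal_succ']
    have e2 : ∑ p ∈ Finset.HasAntidiagonal.antidiagonal (m + 1),
        (-1) ^ p.2 * (q ^ p.1 * gaussBinom q p.1 p.2) =
        (-1) ^ (m + 1) * (q ^ 0 * gaussBinom q 0 (m + 1)) + ∑ p ∈ Finset.HasAntidiagonal.antidiagonal m,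
          (-1) ^ p.2 * (q ^ (p.1 + 1) * gaussBinom q (p.1 + 1) p.2) := by
      rw [Finset.Nat.sum_antidiagonal_succ]
    have e3 : gaussAlt q (m + 2) = (-1) ^ (m + 2) * gaussBinom q 0 (m + 2) +
        ((-1) ^ (0 : ℕ) * gaussBinom q (m + 1 + 1) 0 + ∑ p ∈ Finset.HasAntidiagonal.antidiagonal m,
          (-1) ^ (p.2 + 1) * gaussBinom q (p.1 + 1) (p.2 + 1)) := by
      unfold gaussAlt
      rw [Finset.Nat.sum_antidiagonal_succ, Finset.Nat.sum_antidiagonal_succ']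
    rw [e3]
    simp only [sub_mul, mul_sub, one_mul, Finset.sum_sub_distrib]
    rw [e1, e2]
    simp only [gaussBinom_succ_succ, mul_add, Finset.sum_add_distrib, gaussBinom_zero_left,
      gaussBinom_zero_right, pow_succ, mul_neg, mul_one, neg_mul, Finset.sum_neg_distrib]
    ring
  rw [h1, Finset.Nat.sum_antidiagonal_succ, gaussAlt, Finset.mul_sum]
  simp only [pow_zero, sub_self, zero_mul, mul_zero, zero_add]
  refine Finset.sum_congr rfl fun p hp => ?_
  rw [gaussBinom_absorb, ← Finset.HasAntidiagonal.mem_antidiagonal.1 hp, add_right_comm]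
  ring

theorem gaussAlt_even (q : ℂ) (n : ℕ) :
    gaussAlt q (2 * n) = ∏ k ∈ Finset.range n, (1 - q ^ (2 * k + 1)) := by
  induction n with
  | zero => simp [gaussAlt, gaussBinom_zero_left]
  | succ n ih => rw [mul_add, mul_one, gaussAlt_add_two, ih, Finset.prod_range_succ, mul_comm]

/-- Since q^(n+1) = 1, the ratio (1 - q^(n-j)) / (1 - q^(j+1)) of neighbouring entries is
-q^(-(j+1)); the exponents add up to triangular numbers. -/
theorem gaussBinom_root {q : ℂ} {n : ℕ} (hq : IsPrimitiveRoot q (n + 1)) (j i : ℕ)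
    (h : i + j = n) : (-1) ^ j * gaussBinom q i j * q ^ (j * (j + 1) / 2) = 1 := by
  induction j generalizing i with
  | zero => simp [gaussBinom_zero_right]
  | succ j ih =>
    have h0 := ih (i + 1) (by omega)
    have h1 := gaussBinom_ratio q i j
    have h2 : 1 - q ^ (j + 1) ≠ 0 := by
      rw [sub_ne_zero]
      exact (hq.pow_ne_one_of_pos_of_lt (by omega) (by omega)).symm
    have h3 : q ^ (i + 1) * q ^ (j + 1) = 1 := by
      rw [← pow_add, show i + 1 + (j + 1) = n + 1 by omega, hq.pow_eq_one]
    have h4 : (j + 1) * (j + 1 + 1) / 2 = j * (j + 1) / 2 + (j + 1) := by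
      rw [show (j + 1) * (j + 1 + 1) = j * (j + 1) + (j + 1) * 2 by ring,
        Nat.add_mul_div_right _ _ two_pos]
    apply mul_left_cancel₀ h2
    rw [h4, pow_add q (j * (j + 1) / 2)]
    calc (1 - q ^ (j + 1)) * ((-1) ^ (j + 1) * gaussBinom q i (j + 1) *
          (q ^ (j * (j + 1) / 2) * q ^ (j + 1)))
        = -((-1) ^ j * q ^ (j * (j + 1) / 2) * q ^ (j + 1) *
          ((1 - q ^ (j + 1)) * gaussBinom q i (j + 1))) := by ring
      _ = (q ^ (i + 1) * q ^ (j + 1) - q ^ (j + 1)) *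
          ((-1) ^ j * gaussBinom q (i + 1) j * q ^ (j * (j + 1) / 2)) := by rw [← h1]; ring
      _ = _ := by rw [h0, h3, mul_one]

theorem sum_pow_triangle {q : ℂ} {n : ℕ} (hq : IsPrimitiveRoot q (2 * n + 1)) :
    ∑ j ∈ Finset.range (2 * n + 1), (q⁻¹) ^ (j * (j + 1) / 2) =
      ∏ k ∈ Finset.range n, (1 - q ^ (2 * k + 1)) := by
  rw [← gaussAlt_even, gaussAlt, Finset.Nat.sum_antidiagonal_eq_sum_range_succ_mk,
    ← Finset.sum_range_reflect]
  refine Finset.sum_congr rfl fun k hk => ?_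
  rw [Finset.mem_range] at hk
  rw [show 2 * n + 1 - 1 - k = 2 * n - k by omega]
  have h := gaussBinom_root hq (2 * n - k) k (by omega)
  rw [inv_pow]
  exact (eq_inv_of_mul_eq_one_left h).symm

/-- The additive character `a ↦ exp(2πia/q)`. -/
def eAdd (q : ℕ) (a : ℤ) : ℂ := Complex.exp (2 * Real.pi * Complex.I * (a / q))

theorem eAdd_add (q : ℕ) (a b : ℤ) : eAdd q (a + b) = eAdd q a * eAdd q b := by
  rw [eAdd, eAdd, eAdd, ← Complex.exp_add]
  congr 1
  push_cast
  ring

@[simp] theorem eAdd_zero (q : ℕ) : eAdd q 0 = 1 := by simp [eAdd]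

theorem eAdd_nsmul (q : ℕ) (a : ℤ) (k : ℕ) : eAdd q (a * k) = eAdd q a ^ k := by
  rw [eAdd, eAdd, ← Complex.exp_nat_mul]
  congr 1
  push_cast
  ring

theorem eAdd_self_mul {q : ℕ} (hq : q ≠ 0) (k : ℤ) : eAdd q (q * k) = 1 := by
  have hq' : (q : ℂ) ≠ 0 := Nat.cast_ne_zero.2 hq
  rw [eAdd, Complex.exp_eq_one_iff]
  refine ⟨k, ?_⟩
  push_cast
  field_simp

theorem eAdd_eq_of_dvd {q : ℕ} (hq : q ≠ 0) {a b : ℤ} (h : (q : ℤ) ∣ a - b) :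
    eAdd q a = eAdd q b := by
  obtain ⟨k, hk⟩ := h
  rw [show a = b + q * k by linarith, eAdd_add, eAdd_self_mul hq, mul_one]

theorem eAdd_mul_right {r : ℕ} (hr : r ≠ 0) (q : ℕ) (a : ℤ) :
    eAdd (q * r) (a * r) = eAdd q a := by
  have hr' : (r : ℂ) ≠ 0 := Nat.cast_ne_zero.2 hr
  rw [eAdd, eAdd]
  congr 2
  push_cast
  rw [mul_div_mul_right _ _ hr']

theorem eAdd_neg (q : ℕ) (a : ℤ) : eAdd q (-a) = (eAdd q a)⁻¹ := by
  rw [eAdd, eAdd, ← Complex.exp_neg]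
  congr 1
  push_cast
  ring

theorem isPrimitiveRoot_eAdd {q : ℕ} (hq : q ≠ 0) {a : ℤ} (h : IsCoprime a q) :
    IsPrimitiveRoot (eAdd q a) q := by
  have h1 : IsPrimitiveRoot (eAdd q 1) q := by
    simpa [eAdd, div_eq_mul_inv] using Complex.isPrimitiveRoot_exp q hq
  have h2 := h1.zpow_of_gcd_eq_one a (Int.isCoprime_iff_gcd_eq_one.1 h)
  have e : eAdd q a = eAdd q 1 ^ a := by
    rw [eAdd, eAdd, ← Complex.exp_int_mul]
    congr 1
    push_cast
    ring
  rw [e]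
  exact h2

theorem one_sub_eAdd (q : ℕ) (a : ℤ) : 1 - eAdd q (2 * a) =
    -(2 * Complex.I * (Real.sin (2 * Real.pi * a / q) : ℝ)) * eAdd q a := by
  have h : eAdd q (2 * a) = eAdd q a * eAdd q a := by rw [← eAdd_add, two_mul]
  have h2 : eAdd q a = Complex.exp (((2 * Real.pi * a / q : ℝ) : ℂ) * Complex.I) := by
    rw [eAdd]
    congr 1
    push_cast
    ring
  rw [h, h2, Complex.ofReal_sin, Complex.sin]
  generalize ((2 * Real.pi * a / q : ℝ) : ℂ) = x
  have h3 : Complex.exp (-x * Complex.I) * Complex.exp (x * Complex.I) = 1 := by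
    rw [← Complex.exp_add]; simp
  have hI := Complex.I_mul_I
  linear_combination (-1 : ℂ) * h3 + (Complex.exp (-x * Complex.I) - Complex.exp (x * Complex.I)) *
    Complex.exp (x * Complex.I) * hI

theorem prod_eAdd_odd (N n : ℕ) :
    ∏ k ∈ Finset.range n, eAdd N (-(2 * k + 1 : ℕ)) = eAdd N (-(n ^ 2 : ℕ)) := by
  induction n with
  | zero => simp
  | succ n ih =>
    rw [Finset.prod_range_succ, ih, ← eAdd_add]
    congr 1
    push_cast
    ring

/-- With N = 2n + 1 and q = e(-2/N), the inverse of q to the power j(j+1)/2 is e(j(j+1)/N), and n +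
1, the inverse of 2 modulo N, completes the square. The phases of the factors 1 - q^(2k+1) multiply
to e(-n²/N), which cancels the e((n+1)²/N) from the square because (n+1)² - n² = N. -/
theorem sum_sq_odd_eq_prod_sin (n : ℕ) :
    ∑ j ∈ Finset.range (2 * n + 1), eAdd (2 * n + 1) ((j + (n + 1)) ^ 2) =
      ∏ k ∈ Finset.range n, (2 * Complex.I *
        (Real.sin (2 * Real.pi * (2 * k + 1 : ℕ) / (2 * n + 1 : ℕ)) : ℝ)) := by
  set N := 2 * n + 1 with hN
  have hN0 : N ≠ 0 := by omega
  have hq : IsPrimitiveRoot (eAdd N (-2)) N := by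
    refine isPrimitiveRoot_eAdd hN0 ⟨n, 1, ?_⟩
    rw [hN]
    push_cast
    ring
  have h1 := sum_pow_triangle hq
  have h2 : ∀ j : ℕ, (eAdd N (-2))⁻¹ ^ (j * (j + 1) / 2) * eAdd N ((n + 1) ^ 2) =
      eAdd N ((j + (n + 1)) ^ 2) := by
    intro j
    have h3 : 2 * ((j * (j + 1) / 2 : ℕ) : ℤ) = j * (j + 1) := by
      exact_mod_cast Nat.mul_div_cancel' (Nat.even_mul_succ_self j).two_dvd
    rw [← eAdd_neg, ← eAdd_nsmul, ← eAdd_add]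
    refine eAdd_eq_of_dvd hN0 ⟨-j, ?_⟩
    rw [hN, neg_neg, h3]
    push_cast
    ring
  have h4 : ∀ k : ℕ, 1 - eAdd N (-2) ^ (2 * k + 1) =
      2 * Complex.I * (Real.sin (2 * Real.pi * (2 * k + 1 : ℕ) / N) : ℝ) *
        eAdd N (-(2 * k + 1 : ℕ)) := by
    intro k
    rw [← eAdd_nsmul, show (-2 : ℤ) * (2 * k + 1 : ℕ) = 2 * (-(2 * k + 1 : ℕ)) by push_cast; ring,
      one_sub_eAdd]
    rw [show 2 * Real.pi * ((-(2 * k + 1 : ℕ) : ℤ) : ℝ) / N =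
      -(2 * Real.pi * (2 * k + 1 : ℕ) / N) by push_cast; ring, Real.sin_neg]
    push_cast
    ring
  have h5 : ∏ k ∈ Finset.range n, eAdd N (-(2 * k + 1 : ℕ)) = eAdd N (-(n ^ 2 : ℕ)) := prod_eAdd_odd N n
  have h6 : eAdd N (-(n ^ 2 : ℕ)) * eAdd N ((n + 1) ^ 2) = 1 := by
    rw [← eAdd_add]
    convert eAdd_self_mul hN0 1 using 2
    rw [hN]
    push_cast
    ring
  simp only [← h2]
  rw [← Finset.sum_mul, h1]
  simp only [h4]
  rw [Finset.prod_mul_distrib, h5, mul_assoc, h6, mul_one]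

theorem prod_ite_neg_one (n : ℕ) :
    ∏ k ∈ Finset.range n, (if 2 * k + 1 ≤ n then (1 : ℂ) else -1) = (-1) ^ (n / 2) := by
  rw [Finset.prod_ite, Finset.prod_const_one, one_mul, Finset.prod_const]
  congr 1
  have h : Finset.filter (fun k => ¬ 2 * k + 1 ≤ n) (Finset.range n) =
      Finset.Ico ((n + 1) / 2) n := by
    ext k
    simp only [Finset.mem_filter, Finset.mem_range, Finset.mem_Ico]
    omega
  rw [h, Nat.card_Ico]
  omega

/-- The angle 2π(2k+1)/(2n+1) is below π exactly when 2k + 1 ≤ n, so ⌊n/2⌋ of the sines are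
negative, and i^n (-1)^⌊n/2⌋ is 1 or i according to the parity of n. -/
theorem prod_sin_sign (n : ℕ) : ∃ r : ℝ, 0 < r ∧ ∏ k ∈ Finset.range n, (2 * Complex.I *
    ((Real.sin (2 * Real.pi * (2 * k + 1 : ℕ) / (2 * n + 1 : ℕ)) : ℝ) : ℂ)) =
      r * if Even n then 1 else Complex.I := by
  have h0 : (0 : ℝ) < (2 * n + 1 : ℕ) := by positivity
  have hpi := Real.pi_pos
  set f : ℕ → ℝ := fun k => (if 2 * k + 1 ≤ n then 1 else -1) *
    Real.sin (2 * Real.pi * (2 * k + 1 : ℕ) / (2 * n + 1 : ℕ)) with hf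
  have hs : ∀ k ∈ Finset.range n, 0 < f k := by
    intro k hk
    rw [Finset.mem_range] at hk
    simp only [hf]
    split_ifs with h
    · rw [one_mul]
      apply Real.sin_pos_of_pos_of_lt_pi
      · positivity
      · rw [div_lt_iff₀ h0]
        have : ((2 * (2 * k + 1) : ℕ) : ℝ) < (2 * n + 1 : ℕ) := by exact_mod_cast (by omega)
        push_cast at this ⊢
        nlinarith
    · rw [neg_one_mul, ← Real.sin_sub_pi]
      apply Real.sin_pos_of_pos_of_lt_pi
      · rw [sub_pos, lt_div_iff₀ h0]
        have : ((2 * n + 1 : ℕ) : ℝ) < (2 * (2 * k + 1) : ℕ) := by exact_mod_cast (by omega)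
        push_cast at this ⊢
        nlinarith
      · rw [sub_lt_iff_lt_add, div_lt_iff₀ h0]
        have : ((2 * k + 1 : ℕ) : ℝ) < (2 * n + 1 : ℕ) := by exact_mod_cast (by omega)
        push_cast at this ⊢
        nlinarith
  refine ⟨2 ^ n * ∏ k ∈ Finset.range n, f k,
    mul_pos (by positivity) (Finset.prod_pos hs), ?_⟩
  have h1 : ∀ k : ℕ, (2 * Complex.I *
      ((Real.sin (2 * Real.pi * (2 * k + 1 : ℕ) / (2 * n + 1 : ℕ)) : ℝ) : ℂ)) =
      2 * Complex.I * ((if 2 * k + 1 ≤ n then (1 : ℂ) else -1) * (f k : ℂ)) := by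
    intro k
    simp only [hf]
    split_ifs <;> simp
  have h2 : Complex.I ^ n * (-1) ^ (n / 2) = if Even n then 1 else Complex.I := by
    rcases Nat.even_or_odd' n with ⟨m, rfl | rfl⟩
    · rw [if_pos (even_two_mul m), pow_mul, Complex.I_sq, Nat.mul_div_cancel_left _ two_pos,
        ← mul_pow]
      simp
    · rw [if_neg (Nat.not_even_iff_odd.2 (odd_two_mul_add_one m)), pow_succ, pow_mul, Complex.I_sq,
        show (2 * m + 1) / 2 = m by omega, mul_right_comm, ← mul_pow]
      simp
  simp only [h1]
  rw [Finset.prod_mul_distrib, Finset.prod_const, Finset.card_range, Finset.prod_mul_distrib,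
    prod_ite_neg_one, mul_pow, ← h2]
  push_cast
  ring

theorem sum_range_eq_sum_zmod {q : ℕ} [NeZero q] (f : ZMod q → ℂ) :
    ∑ a ∈ Finset.range q, f (a : ZMod q) = ∑ x : ZMod q, f x := by
  obtain ⟨n, rfl⟩ := Nat.exists_eq_succ_of_ne_zero (NeZero.ne q)
  rw [← Fin.sum_univ_eq_sum_range (fun a : ℕ => f (a : ZMod (n + 1)))]
  exact Finset.sum_congr rfl fun x _ => congrArg f (ZMod.natCast_zmod_val (n := n + 1) x)

theorem eAdd_eq_stdAddChar (q : ℕ) [NeZero q] (a : ℤ) : eAdd q a = ZMod.stdAddChar (a : ZMod q) := by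
  rw [ZMod.stdAddChar_coe, eAdd]
  congr 1
  ring

/-- The quadratic Gauss sum of a prime, with its sign. -/
theorem sum_jacobi_eAdd_prime (p : ℕ) [hp : Fact p.Prime] (h2 : p ≠ 2) :
    ∑ a ∈ Finset.range p, (jacobiSym a p : ℂ) * eAdd p a =
      (Real.sqrt p : ℂ) * if p % 4 = 1 then 1 else Complex.I := by
  obtain ⟨n, hn⟩ := hp.out.odd_of_ne_two h2
  have hchar : ringChar (ZMod p) ≠ 2 := by rwa [ZMod.ringChar_zmod_n]
  set χ : MulChar (ZMod p) ℂ := (quadraticChar (ZMod p)).ringHomComp (Int.castRingHom ℂ) with hχ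
  have hχ1 : χ ≠ 1 := by
    rw [hχ, Ne, MulChar.ringHomComp_eq_one_iff (RingHom.injective_int _)]
    exact quadraticChar_ne_one hchar
  have hχ2 : χ.IsQuadratic := (quadraticChar_isQuadratic (ZMod p)).comp _
  have hsum : ∑ a ∈ Finset.range p, (jacobiSym a p : ℂ) * eAdd p a =
      gaussSum χ (ZMod.stdAddChar (N := p)) := by
    rw [gaussSum, ← sum_range_eq_sum_zmod]
    refine Finset.sum_congr rfl fun a _ => ?_
    rw [eAdd_eq_stdAddChar, ← jacobiSym.legendreSym.to_jacobiSym, legendreSym, hχ,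
      MulChar.ringHomComp_apply]
    simp
  -- The square determines the modulus; the phase comes from the product of sines.
  have hsq := gaussSum_sq hχ1 hχ2 (ZMod.isPrimitive_stdAddChar p)
  have hneg : χ (-1) = if p % 4 = 1 then 1 else -1 := by
    rw [hχ, MulChar.ringHomComp_apply, quadraticChar_neg_one hchar, ZMod.card]
    split_ifs with h
    · rw [ZMod.χ₄_nat_one_mod_four h]; simp
    · rw [ZMod.χ₄_nat_three_mod_four (by omega)]; simp
  have hS : gaussSum χ (ZMod.stdAddChar (N := p)) =
      ∑ j ∈ Finset.range (2 * n + 1), eAdd (2 * n + 1) ((j + (n + 1)) ^ 2) := by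
    rw [← hn]
    have e1 : ∑ j ∈ Finset.range p, eAdd p ((j + (n + 1)) ^ 2) =
        ∑ x : ZMod p, ZMod.stdAddChar (x ^ 2) := by
      rw [← Equiv.sum_comp (Equiv.addRight ((n + 1 : ℕ) : ZMod p)), ← sum_range_eq_sum_zmod]
      refine Finset.sum_congr rfl fun a _ => ?_
      rw [eAdd_eq_stdAddChar]
      simp [add_assoc]
    -- The number of square roots of a is χ(a) + 1. The summand 1 drops out below as the full sum of
    -- a nontrivial additive character.
    have e2 : ∑ x : ZMod p, ZMod.stdAddChar (x ^ 2) =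
        ∑ a : ZMod p, (χ a + 1) * ZMod.stdAddChar a := by
      rw [← Finset.sum_fiberwise (s := Finset.univ) (g := fun x : ZMod p => x ^ 2)]
      refine Finset.sum_congr rfl fun a _ => ?_
      have h3 := quadraticChar_card_sqrts hchar a
      have h4 : χ a + 1 = ((Finset.univ.filter fun x : ZMod p => x ^ 2 = a).card : ℂ) := by
        have h5 : Finset.univ.filter (fun x : ZMod p => x ^ 2 = a) =
            {x : ZMod p | x ^ 2 = a}.toFinset := by ext; simp
        rw [h5, hχ, MulChar.ringHomComp_apply]
        have := congrArg (Int.cast : ℤ → ℂ) h3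
        rw [Int.cast_natCast] at this
        rw [this]
        simp
      rw [h4, ← nsmul_eq_mul, ← Finset.sum_const]
      refine Finset.sum_congr rfl fun x hx => ?_
      rw [(Finset.mem_filter.1 hx).2]
    rw [e1, e2]
    simp only [add_mul, one_mul, Finset.sum_add_distrib]
    rw [AddChar.sum_eq_zero_of_ne_one, add_zero, gaussSum]
    have := (ZMod.isPrimitive_stdAddChar p) (one_ne_zero (α := ZMod p))
    simpa [AddChar.mulShift_one] using this
  obtain ⟨r, hr, hprod⟩ := prod_sin_sign n
  have hev : Even n ↔ p % 4 = 1 := by rw [Nat.even_iff]; omega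
  rw [sum_sq_odd_eq_prod_sin, hprod] at hS
  simp only [hev] at hS
  rw [hsum, hS]
  rw [hS, hneg, ZMod.card] at hsq
  have hr2 : r ^ 2 = p := by
    split_ifs at hsq
    · exact_mod_cast (by simpa using hsq : (r : ℂ) ^ 2 = p)
    · rw [mul_pow, Complex.I_sq] at hsq
      exact_mod_cast (by linear_combination -hsq : (r : ℂ) ^ 2 = p)
  rw [← hr2, Real.sqrt_sq hr.le]

/-! ### Finite exponential sums -/

theorem sum_range_mul (g : ℕ → ℂ) (D E : ℕ) : ∑ a ∈ Finset.range (D * E), g a =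
    ∑ b ∈ Finset.range E, ∑ a ∈ Finset.range D, g (a + D * b) := by
  induction E with
  | zero => simp
  | succ E ih =>
    rw [mul_add, mul_one, Finset.sum_range_add, ih, Finset.sum_range_succ]
    simp only [add_comm]

theorem sum_eAdd_mul {E : ℕ} (hE : E ≠ 0) (m : ℤ) :
    ∑ b ∈ Finset.range E, eAdd E (m * b) = if (E : ℤ) ∣ m then (E : ℂ) else 0 := by
  simp only [eAdd_nsmul]
  split_ifs with h
  · rw [eAdd_eq_of_dvd hE (b := 0) (by simpa using h)]
    simp
  · have h1 : eAdd E m ≠ 1 := by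
      intro h2
      rw [eAdd, Complex.exp_eq_one_iff] at h2
      obtain ⟨k, hk⟩ := h2
      have hE' : (E : ℂ) ≠ 0 := Nat.cast_ne_zero.2 hE
      have h3 : (m : ℂ) / E = k := by
        apply mul_left_cancel₀ Complex.two_pi_I_ne_zero
        rw [hk]
        ring
      rw [div_eq_iff hE'] at h3
      exact h ⟨k, by rw [mul_comm]; exact_mod_cast h3⟩
    rw [geom_sum_eq h1, ← eAdd_nsmul, mul_comm, eAdd_self_mul hE]
    simp

theorem periodic_nat_mul {F : ℤ → ℂ} {D : ℕ} (hF : ∀ a, F (a + D) = F a) (a : ℤ) (b : ℕ) :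
    F (a + D * b) = F a := by
  induction b with
  | zero => simp
  | succ b ih => rw [← ih, ← hF (a + D * b)]; congr 1; push_cast; ring

theorem periodic_emod {F : ℤ → ℂ} {D : ℕ} (hF : ∀ a, F (a + D) = F a) {a b : ℤ}
    (h : (D : ℤ) ∣ a - b) : F a = F b := by
  have hF' : Function.Periodic F (D : ℤ) := hF
  obtain ⟨k, hk⟩ := h
  have := hF'.int_mul k b
  rw [← this]
  congr 1
  push_cast
  linarith

/-- A twisted sum over the residues modulo `D * E` of a function of period `D`. -/
theorem sum_periodic_eAdd {F : ℤ → ℂ} {D E : ℕ} (hD : D ≠ 0) (hE : E ≠ 0)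
    (hF : ∀ a, F (a + D) = F a) (m : ℤ) :
    ∑ a ∈ Finset.range (D * E), F a * eAdd (D * E) (m * a) =
      if (E : ℤ) ∣ m then E * ∑ a ∈ Finset.range D, F a * eAdd D (m / E * a) else 0 := by
  -- Indices of the form a + D b separate the sum; the part over b is geometric and detects E ∣ m.
  have h1 : ∀ a b : ℕ, F ((a + D * b : ℕ) : ℤ) * eAdd (D * E) (m * (a + D * b : ℕ)) =
      F a * eAdd (D * E) (m * a) * eAdd E (m * b) := by
    intro a b
    have e1 : eAdd E (m * b) = eAdd (D * E) (m * b * D) := by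
      rw [mul_comm D E, eAdd_mul_right hD]
    rw [e1, mul_assoc, ← eAdd_add]
    push_cast
    rw [periodic_nat_mul hF]
    congr 2
    ring
  rw [sum_range_mul]
  simp only [h1]
  rw [Finset.sum_comm]
  simp only [← Finset.mul_sum, sum_eAdd_mul hE]
  split_ifs with h
  · rw [← Finset.sum_mul, mul_comm]
    congr 1
    refine Finset.sum_congr rfl fun a _ => ?_
    obtain ⟨u, rfl⟩ := h
    rw [Int.mul_ediv_cancel_left _ (Int.natCast_ne_zero.2 hE),
      show (E : ℤ) * u * a = u * a * E by ring, eAdd_mul_right hE]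
  · simp

/-- The Chinese remainder theorem for sums of periodic functions. -/
theorem sum_range_coprime {F : ℤ → ℂ} {q r : ℕ} (hq : q ≠ 0) (hr : r ≠ 0) (h : Nat.Coprime q r)
    (hF : ∀ a, F (a + (q * r : ℕ)) = F a) :
    ∑ a ∈ Finset.range (q * r), F a =
      ∑ x ∈ Finset.range q, ∑ y ∈ Finset.range r, F (x * r + y * q) := by
  have hqr : 0 < q * r := Nat.mul_pos (Nat.pos_of_ne_zero hq) (Nat.pos_of_ne_zero hr)
  rw [← Finset.sum_product']
  symm
  have hinj : Set.InjOn (fun p : ℕ × ℕ => (p.1 * r + p.2 * q) % (q * r))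
      (Finset.range q ×ˢ Finset.range r : Finset (ℕ × ℕ)) := by
    rintro ⟨x, y⟩ hxy ⟨x', y'⟩ hxy' heq
    simp only [Finset.coe_product, Set.mem_prod, Finset.mem_coe, Finset.mem_range] at hxy hxy'
    have e : x * r + y * q ≡ x' * r + y' * q [MOD q * r] := heq
    have e1 : x ≡ x' [MOD q] := by
      have := e.of_mul_right r
      simp only [Nat.ModEq, Nat.add_mul_mod_self_right] at this
      exact Nat.ModEq.cancel_right_of_coprime h this
    have e2 : y ≡ y' [MOD r] := by
      have := e.of_mul_left q
      simp only [Nat.ModEq, Nat.mul_add_mod_self_right] at this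
      exact Nat.ModEq.cancel_right_of_coprime h.symm this
    rw [Prod.mk.injEq]
    exact ⟨Nat.ModEq.eq_of_lt_of_lt e1 hxy.1 hxy'.1, Nat.ModEq.eq_of_lt_of_lt e2 hxy.2 hxy'.2⟩
  have hmaps : Set.MapsTo (fun p : ℕ × ℕ => (p.1 * r + p.2 * q) % (q * r))
      (Finset.range q ×ˢ Finset.range r : Finset (ℕ × ℕ)) (Finset.range (q * r)) := by
    intro p _
    simpa using Nat.mod_lt _ hqr
  refine Finset.sum_nbij _ hmaps hinj
    (Finset.surjOn_of_injOn_of_card_le _ hmaps hinj (by simp)) fun p _ => ?_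
  refine periodic_emod hF ?_
  push_cast
  exact Int.dvd_self_sub_emod

/-! ### Gauss sums of odd modulus -/

/-- The factor `1` or `εi` that normalizes the Gauss sum of odd modulus `c`. -/
def gaussNorm (ε : ℤˣ) (c : ℕ) : ℂ := if c % 4 = 1 then 1 else ((ε : ℤ) : ℂ) * Complex.I

/-- The normalized Gauss sum of odd modulus `c`. -/
def oddSum (ε : ℤˣ) (n : ℤ) (c : ℕ) : ℂ :=
  gaussNorm ε c * ∑ a ∈ Finset.range c, (jacobiSym a c : ℂ) * eAdd c (-n * a)

theorem jacobi_add_self (a : ℤ) (c : ℕ) : jacobiSym (a + c) c = jacobiSym a c :=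
  jacobiSym.mod_left' (by simp)

theorem sq_unit (ε : ℤˣ) : ((ε : ℤ) : ℂ) * ((ε : ℤ) : ℂ) = 1 := by
  rcases Int.units_eq_one_or ε with rfl | rfl <;> simp

theorem oddSum_one (ε : ℤˣ) (n : ℤ) : oddSum ε n 1 = 1 := by
  simp [oddSum, gaussNorm]

/-- By reciprocity (c/d)(d/c) = -1 only for c ≡ d ≡ 3 mod 4; in that case cd ≡ 1 mod 4 and (εi)² =
-1. -/
theorem gaussNorm_mul (ε : ℤˣ) {c d : ℕ} (hc : Odd c) (hd : Odd d) (h : Nat.Coprime c d) :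
    gaussNorm ε (c * d) * (jacobiSym c d * jacobiSym d c : ℤ) = gaussNorm ε c * gaussNorm ε d := by
  have hI := Complex.I_mul_I
  have hε := sq_unit ε
  have h1 := jacobiSym.quadratic_reciprocity hc hd
  have hsq := jacobiSym.sq_one (a := d) (b := c) (by simpa using h.symm)
  have h2 : jacobiSym c d * jacobiSym d c = (-1) ^ (c / 2 * (d / 2)) := by
    rw [h1, mul_assoc, ← sq, hsq, mul_one]
  rw [h2]
  have hc4 : c % 4 = 1 ∨ c % 4 = 3 := Nat.odd_mod_four_iff.1 (Nat.odd_iff.1 hc)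
  have hd4 : d % 4 = 1 ∨ d % 4 = 3 := Nat.odd_mod_four_iff.1 (Nat.odd_iff.1 hd)
  unfold gaussNorm
  rw [Nat.mul_mod]
  rcases hc4 with hc4 | hc4
  · have : Even (c / 2 * (d / 2)) := (Nat.even_iff.2 (by omega : c / 2 % 2 = 0)).mul_right _
    rw [this.neg_one_pow]
    rcases hd4 with hd4 | hd4 <;> simp [hc4, hd4]
  · rcases hd4 with hd4 | hd4
    · have : Even (c / 2 * (d / 2)) := (Nat.even_iff.2 (by omega : d / 2 % 2 = 0)).mul_left _
      rw [this.neg_one_pow]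
      simp [hc4, hd4]
    · have : Odd (c / 2 * (d / 2)) := (Nat.odd_iff.2 (by omega)).mul (Nat.odd_iff.2 (by omega))
      rw [this.neg_one_pow]
      simp [hc4, hd4]
      linear_combination hε - ((ε : ℤ) : ℂ) * ((ε : ℤ) : ℂ) * hI

/-- In the parametrization a = xd + yc the symbol modulo cd splits off (d/c)(c/d), which the
normalization absorbs. -/
theorem oddSum_mul (ε : ℤˣ) (n : ℤ) {c d : ℕ} (hc : Odd c) (hd : Odd d) (h : Nat.Coprime c d) :
    oddSum ε n (c * d) = oddSum ε n c * oddSum ε n d := by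
  have hc0 : c ≠ 0 := hc.pos.ne'
  have hd0 : d ≠ 0 := hd.pos.ne'
  have : NeZero c := ⟨hc0⟩
  have : NeZero d := ⟨hd0⟩
  unfold oddSum
  rw [sum_range_coprime (F := fun a => (jacobiSym a (c * d) : ℂ) * eAdd (c * d) (-n * a)) hc0 hd0 h]
  · have e1 : ∀ x y : ℕ, (jacobiSym (x * d + y * c) (c * d) : ℂ) *
        eAdd (c * d) (-n * (x * d + y * c)) =
        ((jacobiSym c d * jacobiSym d c : ℤ) : ℂ) * (((jacobiSym x c : ℂ) * eAdd c (-n * x)) *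
          ((jacobiSym y d : ℂ) * eAdd d (-n * y))) := by
      intro x y
      have a1 : jacobiSym (x * d + y * c) c = jacobiSym x c * jacobiSym d c := by
        rw [← jacobiSym.mul_left]
        exact jacobiSym.mod_left' (by simp)
      have a2 : jacobiSym (x * d + y * c) d = jacobiSym y d * jacobiSym c d := by
        rw [← jacobiSym.mul_left]
        exact jacobiSym.mod_left' (by simp)
      rw [jacobiSym.mul_right, a1, a2,
        show -n * (x * d + y * c : ℤ) = -n * x * d + -n * y * c by ring, eAdd_add,
        eAdd_mul_right hd0, mul_comm c d, eAdd_mul_right hc0]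
      push_cast
      ring
    simp only [e1, ← Finset.mul_sum, ← Finset.sum_mul]
    rw [← mul_assoc, gaussNorm_mul ε hc hd h]
    ring
  · intro a
    rw [jacobi_add_self]
    congr 1
    exact eAdd_eq_of_dvd (mul_ne_zero hc0 hd0) ⟨-n, by push_cast; ring⟩

theorem norm_eAdd (q : ℕ) (a : ℤ) : ‖eAdd q a‖ = 1 := by
  rw [eAdd, show 2 * (Real.pi : ℂ) * Complex.I * (a / q) =
    ((2 * Real.pi * (a / q) : ℝ) : ℂ) * Complex.I by push_cast; ring, Complex.norm_exp_ofReal_mul_I]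

theorem norm_jacobi_le (a : ℤ) (b : ℕ) : ‖(jacobiSym a b : ℂ)‖ ≤ 1 := by
  rcases jacobiSym.trichotomy a b with h | h | h <;> simp [h]

/-- The trivial bound is enough: against c^(-ν-1) it leaves c^(-Re ν), which is summable for Re ν >
1. -/
theorem norm_oddSum_le (ε : ℤˣ) (n : ℤ) (c : ℕ) : ‖oddSum ε n c‖ ≤ c := by
  have h1 : ‖gaussNorm ε c‖ ≤ 1 := by
    unfold gaussNorm
    split_ifs
    · simp
    · rcases Int.units_eq_one_or ε with rfl | rfl <;> simp
  have h2 : ‖∑ a ∈ Finset.range c, (jacobiSym a c : ℂ) * eAdd c (-n * a)‖ ≤ c := by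
    refine (norm_sum_le_of_le _ (f := fun a : ℕ => (jacobiSym a c : ℂ) * eAdd c (-n * a))
      (n := fun _ => 1) fun a _ => ?_).trans (by simp)
    rw [norm_mul, norm_eAdd, mul_one]
    exact norm_jacobi_le _ _
  rw [oddSum, norm_mul]
  calc _ ≤ 1 * (c : ℝ) := mul_le_mul h1 h2 (norm_nonneg _) zero_le_one
    _ = c := one_mul _

theorem sum_jacobi_eAdd_prime_mul (p : ℕ) [hp : Fact p.Prime] (h2 : p ≠ 2) (u : ℤ) :
    ∑ a ∈ Finset.range p, (jacobiSym a p : ℂ) * eAdd p (u * a) =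
      jacobiSym u p * ((Real.sqrt p : ℂ) * if p % 4 = 1 then 1 else Complex.I) := by
  have hchar : ringChar (ZMod p) ≠ 2 := by rwa [ZMod.ringChar_zmod_n]
  set χ := quadraticChar (ZMod p) with hχ
  have key : ∀ v : ℤ, ∑ a ∈ Finset.range p, (jacobiSym a p : ℂ) * eAdd p (v * a) =
      ∑ x : ZMod p, (χ x : ℂ) * ZMod.stdAddChar ((v : ZMod p) * x) := by
    intro v
    rw [← sum_range_eq_sum_zmod]
    refine Finset.sum_congr rfl fun a _ => ?_
    rw [eAdd_eq_stdAddChar, ← jacobiSym.legendreSym.to_jacobiSym, legendreSym, hχ]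
    push_cast
    rfl
  have hJ : jacobiSym u p = χ (u : ZMod p) := by
    rw [← jacobiSym.legendreSym.to_jacobiSym, legendreSym]
  rw [← sum_jacobi_eAdd_prime p h2, hJ]
  have k1 := key 1
  simp only [one_mul, Int.cast_one] at k1
  rw [k1, key]
  by_cases hu : (u : ZMod p) = 0
  · rw [hu, MulChar.map_zero]
    simp only [zero_mul, AddChar.map_zero_eq_one, mul_one, Int.cast_zero]
    rw [← Int.cast_sum, quadraticChar_sum_zero hchar, Int.cast_zero]
  · symm
    rw [Finset.mul_sum, ← Equiv.sum_comp (Equiv.mulLeft₀ (u : ZMod p) hu)]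
    refine Finset.sum_congr rfl fun x _ => ?_
    have h3 : (χ (u : ZMod p) : ℂ) * (χ (u : ZMod p) : ℂ) = 1 := by
      have := quadraticChar_sq_one hu
      rw [sq] at this
      exact_mod_cast this
    rw [Equiv.mulLeft₀_apply, map_mul]
    push_cast
    linear_combination ((χ x : ℂ) * ZMod.stdAddChar ((u : ZMod p) * x)) * h3

/-- This is where εn replaces n. For p ≡ 3 mod 4 the normalization and the Gauss sum contribute εi ·
i = -ε, the sign is cancelled by (-1/p) = -1, and ε = (ε/p). For p ≡ 1 mod 4 all these factors are
1. -/
theorem gaussNorm_mul_jacobi_neg (ε : ℤˣ) (u : ℤ) (p : ℕ) (hp : Odd p) :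
    gaussNorm ε p * (jacobiSym (-u) p * if p % 4 = 1 then 1 else Complex.I) =
      jacobiSym ((ε : ℤ) * u) p := by
  have hI := Complex.I_mul_I
  rw [jacobiSym.mul_left, jacobiSym.neg _ hp, gaussNorm]
  rcases Nat.odd_mod_four_iff.1 (Nat.odd_iff.1 hp) with h | h
  · rw [if_pos h, if_pos h, ZMod.χ₄_nat_one_mod_four h]
    rcases Int.units_eq_one_or ε with rfl | rfl
    · simp
    · simp [jacobiSym.at_neg_one hp, ZMod.χ₄_nat_one_mod_four h]
  · rw [if_neg (by omega), if_neg (by omega), ZMod.χ₄_nat_three_mod_four h]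
    rcases Int.units_eq_one_or ε with rfl | rfl
    · simp
      linear_combination (-(jacobiSym u p : ℂ)) * hI
    · simp [jacobiSym.at_neg_one hp, ZMod.χ₄_nat_three_mod_four h]
      linear_combination (jacobiSym u p : ℂ) * hI

theorem gaussNorm_pow_succ (ε : ℤˣ) {p k : ℕ} (hp : Odd p) :
    gaussNorm ε (p ^ (k + 1)) = if Even k then gaussNorm ε p else 1 := by
  have h2 : p ^ 2 % 4 = 1 := by
    rcases Nat.odd_mod_four_iff.1 (Nat.odd_iff.1 hp) with h | h <;> simp [Nat.pow_mod, h]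
  split_ifs with hk
  · obtain ⟨j, rfl⟩ := hk
    rw [gaussNorm, gaussNorm, ← two_mul, pow_succ, pow_mul, Nat.mul_mod, Nat.pow_mod, h2]
    simp
  · obtain ⟨j, rfl⟩ := Nat.not_even_iff_odd.1 hk
    rw [gaussNorm, show 2 * j + 1 + 1 = 2 * (j + 1) by ring, pow_mul, Nat.pow_mod, h2]
    simp

/-- The symbol modulo p^(k+1) depends only on a mod p, so the twisted sum descends to modulus p or
vanishes. -/
theorem sum_jacobi_pow_eAdd (n : ℤ) (p : ℕ) [hp : Fact p.Prime] (k : ℕ) :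
    ∑ a ∈ Finset.range (p ^ (k + 1)), (jacobiSym a (p ^ (k + 1)) : ℂ) *
      eAdd (p ^ (k + 1)) (-n * a) = if ((p ^ k : ℕ) : ℤ) ∣ n then
        (p : ℂ) ^ k * ∑ a ∈ Finset.range p, (jacobiSym a p : ℂ) ^ (k + 1) *
          eAdd p (-(n / (p ^ k : ℕ)) * a) else 0 := by
  have h := sum_periodic_eAdd (F := fun a => (jacobiSym a p : ℂ) ^ (k + 1)) hp.out.ne_zero
    (pow_ne_zero k hp.out.ne_zero) (fun a => by simp only [jacobi_add_self]) (-n)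
  rw [pow_succ' p k]
  have hpk : ∀ a : ℤ, (jacobiSym a (p * p ^ k) : ℂ) = (jacobiSym a p : ℂ) ^ (k + 1) := by
    intro a
    rw [← pow_succ', jacobiSym.pow_right]
    push_cast
    rfl
  simp only [hpk]
  rw [h]
  simp only [dvd_neg, Nat.cast_pow]
  split_ifs with h1
  · rw [Int.neg_ediv_of_dvd h1]
  · rfl

theorem jacobi_pow_odd (a : ℤ) (p : ℕ) {k : ℕ} (hk : Even k) :
    (jacobiSym a p : ℂ) ^ (k + 1) = jacobiSym a p := by
  rcases jacobiSym.trichotomy a p with h | h | h <;> simp [h, pow_succ, hk.neg_one_pow]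

/-- For an odd exponent k + 1 the symbol is (a/p) itself, and a Gauss sum of modulus p remains. -/
theorem oddSum_prime_pow_odd (ε : ℤˣ) (n : ℤ) (p : ℕ) [hp : Fact p.Prime] (h2 : p ≠ 2) (k : ℕ)
    (hk : Even k) : oddSum ε n (p ^ (k + 1)) =
      if ((p ^ k : ℕ) : ℤ) ∣ n then
        (p : ℂ) ^ k * (jacobiSym ((ε : ℤ) * (n / (p ^ k : ℕ))) p * (Real.sqrt p : ℂ))
      else 0 := by
  have hodd := hp.out.odd_of_ne_two h2
  rw [oddSum, sum_jacobi_pow_eAdd, gaussNorm_pow_succ ε hodd, if_pos hk]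
  split_ifs with h
  · simp only [jacobi_pow_odd _ _ hk]
    rw [sum_jacobi_eAdd_prime_mul p h2, ← gaussNorm_mul_jacobi_neg ε _ p hodd]
    ring
  · rw [mul_zero]

theorem jacobi_pow_even (a : ℕ) (p : ℕ) [hp : Fact p.Prime] {k : ℕ} (hk : Odd k) :
    (jacobiSym a p : ℂ) ^ (k + 1) = 1 - if p ∣ a then 1 else 0 := by
  split_ifs with h
  · rw [jacobiSym.eq_zero_iff.2 ⟨hp.out.ne_zero, ?_⟩]
    · simp
    · rw [Int.gcd_natCast_natCast, Nat.gcd_eq_right h]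
      exact hp.out.one_lt.ne'
  · rcases jacobiSym.eq_one_or_neg_one (a := a) (b := p) (by
      rw [Int.gcd_natCast_natCast]
      exact ((Nat.Prime.coprime_iff_not_dvd hp.out).2 h).symm) with h | h
    · simp [h]
    · simp [h, (hk.add_one).neg_one_pow]

/-- For an even exponent k + 1 the symbol is the indicator of p ∤ a, and a Ramanujan sum of modulus
p remains. -/
theorem oddSum_prime_pow_even (ε : ℤˣ) (n : ℤ) (p : ℕ) [hp : Fact p.Prime] (h2 : p ≠ 2) (k : ℕ)
    (hk : Odd k) : oddSum ε n (p ^ (k + 1)) =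
      if ((p ^ k : ℕ) : ℤ) ∣ n then
        (p : ℂ) ^ k * ((if ((p ^ (k + 1) : ℕ) : ℤ) ∣ n then (p : ℂ) else 0) - 1) else 0 := by
  have hodd := hp.out.odd_of_ne_two h2
  rw [oddSum, sum_jacobi_pow_eAdd, gaussNorm_pow_succ ε hodd, if_neg (Nat.not_even_iff_odd.2 hk),
    one_mul]
  split_ifs with h h'
  all_goals try rfl
  all_goals
    obtain ⟨u, rfl⟩ := h
    have hpk : ((p ^ k : ℕ) : ℤ) ≠ 0 := Int.natCast_ne_zero.2 (pow_ne_zero k hp.out.ne_zero)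
    have hiff : ((p ^ (k + 1) : ℕ) : ℤ) ∣ (p ^ k : ℕ) * u ↔ (p : ℤ) ∣ u := by
      rw [pow_succ, Nat.cast_mul]
      exact mul_dvd_mul_iff_left hpk
    rw [hiff] at h'
    rw [Int.mul_ediv_cancel_left _ hpk]
    congr 1
    simp only [jacobi_pow_even _ p hk, sub_mul, one_mul, Finset.sum_sub_distrib]
    rw [sum_eAdd_mul hp.out.ne_zero, Finset.sum_eq_single 0]
    · simp [h']
    · intro b hb hb0
      rw [if_neg, zero_mul]
      intro hd
      exact absurd (Nat.le_of_dvd (Nat.pos_of_ne_zero hb0) hd) (not_le.2 (Finset.mem_range.1 hb))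
    · intro h0
      exact absurd (Finset.mem_range.2 hp.out.pos) h0

/-! ### The exponential sums of the Eisenstein series -/

/-- The weight `εi` or `1` of an odd residue modulo `4`. -/
def wt (ε : ℤˣ) (a : ℤ) : ℂ :=
  if a % 4 = 1 then ((ε : ℤ) : ℂ) * Complex.I else if a % 4 = 3 then 1 else 0

/-- The coefficient of the point `a / c` in the Eisenstein series. -/
def eisCoef (ε : ℤˣ) (c : ℕ) (a : ℤ) : ℂ := wt ε a * jacobiSym c a.natAbs

/-- The exponential sum of modulus `c` in the Fourier coefficient of the Eisenstein series. -/
def eisSum (ε : ℤˣ) (n : ℤ) (c : ℕ) : ℂ :=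
  ∑ a ∈ Finset.range c, eisCoef ε c a * eAdd c (-n * a)

/-- The exponential sum of modulus `2 ^ k`. -/
def twoSum (ε : ℤˣ) (n : ℤ) (k : ℕ) : ℂ :=
  ∑ a ∈ Finset.range (2 ^ k), (wt ε a * (ZMod.χ₈ ((a : ℤ) : ZMod 8) : ℂ) ^ k) *
    eAdd (2 ^ k) (-n * a)

theorem wt_even (ε : ℤˣ) {a : ℤ} (h : ¬ Odd a) : wt ε a = 0 := by
  rw [Int.odd_iff] at h
  rw [wt, if_neg (by omega), if_neg (by omega)]

theorem wt_congr (ε : ℤˣ) {a b : ℤ} (h : (4 : ℤ) ∣ a - b) : wt ε a = wt ε b := by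
  have : a % 4 = b % 4 := by omega
  rw [wt, wt, this]

theorem chi4_congr {a b : ℤ} (h : (4 : ℤ) ∣ a - b) :
    ZMod.χ₄ (a : ZMod 4) = ZMod.χ₄ (b : ZMod 4) := by
  rw [(ZMod.intCast_eq_intCast_iff_dvd_sub b a 4).2 (by exact_mod_cast h)]

theorem chi8_congr {a b : ℤ} (h : (8 : ℤ) ∣ a - b) :
    ZMod.χ₈ (a : ZMod 8) = ZMod.χ₈ (b : ZMod 8) := by
  rw [(ZMod.intCast_eq_intCast_iff_dvd_sub b a 8).2 (by exact_mod_cast h)]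

theorem chi8_sq_odd {a : ℤ} (h : Odd a) : ZMod.χ₈ (a : ZMod 8) ^ 2 = 1 := by
  obtain ⟨b, rfl⟩ := h
  push_cast
  generalize (b : ZMod 8) = x
  revert x
  decide

theorem chi8_even {a : ℤ} (h : ¬ Odd a) : ZMod.χ₈ (a : ZMod 8) = 0 := by
  obtain ⟨b, rfl⟩ := (Int.not_odd_iff_even.1 h).two_dvd
  push_cast
  generalize (b : ZMod 8) = x
  revert x
  decide

theorem chi8_sq_congr {a b : ℤ} (h : (2 : ℤ) ∣ a - b) :
    ZMod.χ₈ (a : ZMod 8) ^ 2 = ZMod.χ₈ (b : ZMod 8) ^ 2 := by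
  by_cases ha : Odd a
  · have hb : Odd b := by rw [Int.odd_iff] at *; omega
    rw [chi8_sq_odd ha, chi8_sq_odd hb]
  · have hb : ¬ Odd b := by rw [Int.odd_iff] at *; omega
    rw [chi8_even ha, chi8_even hb]

/-- A class mod 4 does not determine χ₈, but for k = 2 only the square enters, which is the
indicator of odd numbers; from k = 3 on the modulus is a multiple of 8. -/
theorem chi8_pow_congr {a b : ℤ} {k : ℕ} (hk : 2 ≤ k) (h : (2 ^ k : ℤ) ∣ a - b) :
    ZMod.χ₈ (a : ZMod 8) ^ k = ZMod.χ₈ (b : ZMod 8) ^ k := by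
  rcases hk.eq_or_lt with rfl | hk
  · exact chi8_sq_congr ((by norm_num : (2 : ℤ) ∣ 2 ^ 2).trans h)
  · rw [chi8_congr ((pow_dvd_pow (2 : ℤ) hk : (2 : ℤ) ^ 3 ∣ _).trans h)]

/-- Reciprocity with signs. Replacing a by -a changes (a/c) by (-1/c), and for c ≡ 3 mod 4 this is
compensated by χ₄(-1) = -1, so the right side can be written with a although the left side knows
only |a|. -/
theorem jacobi_natAbs_right {a : ℤ} (ha : Odd a) {k c : ℕ} (hc : Odd c) :
    jacobiSym (2 ^ k * c : ℕ) a.natAbs = ZMod.χ₈ (a : ZMod 8) ^ k *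
      (jacobiSym a c * if c % 4 = 1 then 1 else ZMod.χ₄ (a : ZMod 4)) := by
  have hb : Odd a.natAbs := Int.natAbs_odd.2 ha
  have n8 : ∀ x : ZMod 8, ZMod.χ₈ (-x) = ZMod.χ₈ x := by decide
  have n4 : ∀ x : ZMod 4, ZMod.χ₄ (-x) = -ZMod.χ₄ x := by decide
  have h8 : ZMod.χ₈ (a : ZMod 8) = ZMod.χ₈ (a.natAbs : ZMod 8) := by
    rcases Int.natAbs_eq a with h | h <;> rw [h] <;> push_cast <;> simp [n8]
  push_cast
  rw [jacobiSym.mul_left, jacobiSym.pow_left, jacobiSym.at_two hb, h8]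
  congr 1
  have key : jacobiSym c a.natAbs =
      jacobiSym a.natAbs c * if c % 4 = 1 then 1 else ZMod.χ₄ (a.natAbs : ZMod 4) := by
    rcases Nat.odd_mod_four_iff.1 (Nat.odd_iff.1 hc) with h | h
    · rw [if_pos h, mul_one, jacobiSym.quadratic_reciprocity_one_mod_four h hb]
    · rw [if_neg (by omega)]
      rcases Nat.odd_mod_four_iff.1 (Nat.odd_iff.1 hb) with h' | h'
      · rw [jacobiSym.quadratic_reciprocity_one_mod_four' hc h', ZMod.χ₄_nat_one_mod_four h',
          mul_one]
      · rw [jacobiSym.quadratic_reciprocity_three_mod_four h h', ZMod.χ₄_nat_three_mod_four h',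
          mul_neg_one]
  rw [key]
  rcases Int.natAbs_eq a with h | h
  · generalize a.natAbs = b at *
    subst h
    simp
  · generalize a.natAbs = b at *
    subst h
    rw [jacobiSym.neg _ hc]
    push_cast
    rw [n4]
    rcases Nat.odd_mod_four_iff.1 (Nat.odd_iff.1 hc) with h | h
    · rw [if_pos h, if_pos h, ZMod.χ₄_nat_one_mod_four h]
      ring
    · rw [if_neg (by omega), if_neg (by omega), ZMod.χ₄_nat_three_mod_four h]
      ring

theorem eisCoef_eq (ε : ℤˣ) (k : ℕ) {c : ℕ} (hc : Odd c) (a : ℤ) :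
    eisCoef ε (2 ^ k * c) a = wt ε a * ((ZMod.χ₈ (a : ZMod 8) : ℂ) ^ k *
      (jacobiSym a c * if c % 4 = 1 then (1 : ℂ) else (ZMod.χ₄ (a : ZMod 4) : ℂ))) := by
  by_cases ha : Odd a
  · rw [eisCoef, jacobi_natAbs_right ha hc]
    push_cast
    rfl
  · rw [eisCoef, wt_even ε ha, zero_mul, zero_mul]

theorem two_pow_dvd_four {k : ℕ} (hk : 2 ≤ k) : (4 : ℤ) ∣ 2 ^ k := by
  have := pow_dvd_pow (2 : ℤ) hk
  norm_num at this
  exact this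

theorem eisCoef_two_pow_congr (ε : ℤˣ) {k : ℕ} (hk : 2 ≤ k) {c : ℕ} (hc : Odd c) {a b : ℤ}
    (h : ((2 ^ k * c : ℕ) : ℤ) ∣ a - b) : eisCoef ε (2 ^ k * c) a = eisCoef ε (2 ^ k * c) b := by
  push_cast at h
  have h2 : (2 ^ k : ℤ) ∣ a - b := (dvd_mul_right _ _).trans h
  have h4 : (4 : ℤ) ∣ a - b := (two_pow_dvd_four hk).trans h2
  have h8 : (ZMod.χ₈ (a : ZMod 8) : ℂ) ^ k = (ZMod.χ₈ (b : ZMod 8) : ℂ) ^ k := by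
    exact_mod_cast chi8_pow_congr hk h2
  have hJ : jacobiSym a c = jacobiSym b c :=
    jacobiSym.mod_left' (Int.emod_eq_emod_iff_emod_sub_eq_zero.2
      (Int.emod_eq_zero_of_dvd ((dvd_mul_left _ _).trans h)))
  rw [eisCoef_eq ε k hc, eisCoef_eq ε k hc, wt_congr ε h4, chi4_congr h4, h8, hJ]

theorem exists_two_pow_mul_odd {c : ℕ} (hc : c ≠ 0) (h4 : 4 ∣ c) :
    ∃ k c' : ℕ, 2 ≤ k ∧ Odd c' ∧ c = 2 ^ k * c' := by
  obtain ⟨k, c', hodd, rfl⟩ := Nat.exists_eq_two_pow_mul_odd hc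
  refine ⟨k, c', ?_, hodd, rfl⟩
  by_contra! hk
  rw [Nat.odd_iff] at hodd
  interval_cases k <;> omega

/-- Periodicity is hidden in the definition, where a enters the symbol through |a|; it appears after
reciprocity and uses 4 ∣ c. -/
theorem eisCoef_congr (ε : ℤˣ) {c : ℕ} (hc : c ≠ 0) (h4 : 4 ∣ c) {a b : ℤ}
    (h : (c : ℤ) ∣ a - b) : eisCoef ε c a = eisCoef ε c b := by
  obtain ⟨k, c', hk, hodd, rfl⟩ := exists_two_pow_mul_odd hc h4
  exact eisCoef_two_pow_congr ε hk hodd h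

/-- A factor c ≡ 3 mod 4 exchanges the two weights εi and 1, and the twist by χ₄ turns this exchange
into multiplication by εi. -/
theorem wt_mul_odd (ε : ℤˣ) {c : ℕ} (hc : Odd c) (a : ℤ) :
    wt ε (a * c) * (if c % 4 = 1 then (1 : ℂ) else (ZMod.χ₄ ((a * c : ℤ) : ZMod 4) : ℂ)) =
      gaussNorm ε c * wt ε a := by
  have hI := Complex.I_mul_I
  have hε := sq_unit ε
  rcases Nat.odd_mod_four_iff.1 (Nat.odd_iff.1 hc) with h | h
  · have h' : (c : ℤ) % 4 = 1 := by omega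
    rw [if_pos h, gaussNorm, if_pos h, mul_one, one_mul]
    refine wt_congr ε ?_
    obtain ⟨d, hd⟩ : (4 : ℤ) ∣ c - 1 := by omega
    exact ⟨a * d, by linear_combination a * hd⟩
  · obtain ⟨d, hd⟩ : (4 : ℤ) ∣ c + 1 := by omega
    have h4 : (4 : ℤ) ∣ a * c - (-a) := ⟨a * d, by linear_combination a * hd⟩
    rw [if_neg (by omega), gaussNorm, if_neg (by omega), wt_congr ε h4, chi4_congr h4]
    have hm : a % 4 = 0 ∨ a % 4 = 1 ∨ a % 4 = 2 ∨ a % 4 = 3 := by omega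
    rcases hm with hm | hm | hm | hm
    · rw [wt_even _ (by rw [Int.odd_iff]; omega), wt_even _ (by rw [Int.odd_iff]; omega)]
      simp
    · rw [ZMod.χ₄_int_three_mod_four (by omega), wt, wt, if_neg (by omega), if_pos (by omega),
        if_pos hm]
      push_cast
      linear_combination (-1 : ℂ) * ((ε : ℤ) : ℂ) * ((ε : ℤ) : ℂ) * hI + hε
    · rw [wt_even _ (by rw [Int.odd_iff]; omega), wt_even _ (by rw [Int.odd_iff]; omega)]
      simp
    · rw [ZMod.χ₄_int_one_mod_four (by omega), wt, wt, if_pos (by omega), if_neg (by omega),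
        if_pos hm]
      simp

/-- The exponential sum of modulus `2 ^ k * c` with `c` odd. -/
theorem eisSum_two_pow_mul (ε : ℤˣ) (n : ℤ) {k : ℕ} (hk : 2 ≤ k) {c : ℕ} (hc : Odd c) :
    eisSum ε n (2 ^ k * c) = twoSum ε n k * oddSum ε n c := by
  have hc0 : c ≠ 0 := hc.pos.ne'
  have h20 : 2 ^ k ≠ 0 := by positivity
  have hcop : Nat.Coprime (2 ^ k) c := Nat.Coprime.pow_left _ (Nat.coprime_two_left.2 hc)
  rw [eisSum, sum_range_coprime (F := fun a => eisCoef ε (2 ^ k * c) a *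
    eAdd (2 ^ k * c) (-n * a)) h20 hc0 hcop]
  · have e1 : ∀ x y : ℕ, eisCoef ε (2 ^ k * c) (x * c + y * (2 ^ k : ℕ)) *
        eAdd (2 ^ k * c) (-n * (x * c + y * (2 ^ k : ℕ))) =
        ((wt ε x * (ZMod.χ₈ ((x : ℤ) : ZMod 8) : ℂ) ^ k) * eAdd (2 ^ k) (-n * x)) *
          (gaussNorm ε c * ((jacobiSym y c : ℂ) * eAdd c (-n * y))) := by
      intro x y
      have h2 : (2 ^ k : ℤ) ∣ (x * c + y * (2 ^ k : ℕ)) - x * c := ⟨y, by push_cast; ring⟩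
      have h4 := (two_pow_dvd_four hk).trans h2
      have a1 : jacobiSym (x * c + y * (2 ^ k : ℕ)) c = jacobiSym y c * jacobiSym 2 c ^ k := by
        rw [← jacobiSym.pow_left, ← jacobiSym.mul_left]
        exact jacobiSym.mod_left' (by simp)
      have hg : Int.gcd 2 (c : ℤ) = 1 := Nat.coprime_two_left.2 hc
      -- The factor (2/c)^k occurs twice, from the symbol modulo c at y 2^k and from χ₈(c)^k, and
      -- cancels.
      have a2 : jacobiSym 2 c ^ k * jacobiSym 2 c ^ k = 1 := by
        rw [← mul_pow, ← sq, jacobiSym.sq_one hg, one_pow]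
      have a3 : (ZMod.χ₈ ((x * c + y * (2 ^ k : ℕ) : ℤ) : ZMod 8) : ℂ) ^ k =
          (ZMod.χ₈ ((x : ℤ) : ZMod 8) : ℂ) ^ k * (jacobiSym 2 c : ℂ) ^ k := by
        rw [jacobiSym.at_two hc]
        have := chi8_pow_congr hk h2
        rw [Int.cast_mul, map_mul, mul_pow, Int.cast_natCast c] at this
        exact_mod_cast this
      have a2' : (jacobiSym 2 c : ℂ) ^ k * (jacobiSym 2 c : ℂ) ^ k = 1 := by exact_mod_cast a2
      rw [eisCoef_eq ε k hc, a1, a3, wt_congr ε h4, chi4_congr h4,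
        show -n * (x * c + y * (2 ^ k : ℕ) : ℤ) = -n * x * c + -n * y * (2 ^ k : ℕ) by ring,
        eAdd_add, eAdd_mul_right hc0, mul_comm (2 ^ k) c, eAdd_mul_right h20]
      have a4 := wt_mul_odd ε hc (x : ℤ)
      push_cast at a4 ⊢
      linear_combination ((ZMod.χ₈ (x : ZMod 8) : ℂ) ^ k * eAdd (2 ^ k) (-n * x) *
        ((jacobiSym y c : ℂ) * eAdd c (-n * y))) * (((jacobiSym 2 c : ℂ) ^ k *
          (jacobiSym 2 c : ℂ) ^ k) * a4 + gaussNorm ε c * wt ε x * a2')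
    simp only [e1, ← Finset.mul_sum, ← Finset.sum_mul]
    rfl
  · intro a
    rw [eisCoef_two_pow_congr ε hk hc (b := a) (by simp)]
    congr 1
    exact eAdd_eq_of_dvd (mul_ne_zero h20 hc0) ⟨-n, by push_cast; ring⟩

/-! ### The sums of modulus `2 ^ k` -/

/-- The values of `twoSum` for even exponents. -/
def twoVal (ε : ℤˣ) (u : ℤ) : ℂ :=
  if u % 4 = 0 then 1 else if u % 4 = 2 then -1 else (ZMod.χ₄ (((ε : ℤ) * u : ℤ) : ZMod 4) : ℂ)

theorem eAdd_four_one : eAdd 4 1 = Complex.I := by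
  rw [eAdd, show 2 * (Real.pi : ℂ) * Complex.I * ((1 : ℤ) / (4 : ℕ)) = Real.pi / 2 * Complex.I by
    push_cast; ring, Complex.exp_pi_div_two_mul_I]

theorem eAdd_eight_one :
    eAdd 8 1 = (Real.sqrt 2 / 2 : ℝ) * (1 + Complex.I) := by
  rw [eAdd, show 2 * (Real.pi : ℂ) * Complex.I * ((1 : ℤ) / (8 : ℕ)) =
    ((Real.pi / 4 : ℝ) : ℂ) * Complex.I by push_cast; ring, Complex.exp_mul_I, ← Complex.ofReal_cos,
    ← Complex.ofReal_sin, Real.cos_pi_div_four, Real.sin_pi_div_four]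
  ring

theorem eAdd_natCast (q j : ℕ) : eAdd q j = eAdd q 1 ^ j := by
  rw [← eAdd_nsmul, one_mul]

theorem eAdd_eq_pow {q : ℕ} (hq : q ≠ 0) {a : ℤ} (j : ℕ) (h : (q : ℤ) ∣ a - j) :
    eAdd q a = eAdd q 1 ^ j := by
  rw [eAdd_eq_of_dvd hq h, eAdd_natCast]

theorem sum_range_four_wt (ε : ℤˣ) (u : ℤ) :
    ∑ a ∈ Finset.range 4, wt ε a * eAdd 4 (-u * a) =
      (1 + ((ε : ℤ) : ℂ) * Complex.I) * twoVal ε u := by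
  have hI := Complex.I_mul_I
  have w : wt ε 0 = 0 ∧ wt ε 1 = ((ε : ℤ) : ℂ) * Complex.I ∧ wt ε 2 = 0 ∧ wt ε 3 = 1 := by
    simp [wt]
  simp only [Finset.sum_range_succ, Finset.sum_range_zero, Nat.cast_zero, Nat.cast_one,
    Nat.cast_ofNat, w]
  have hm : u % 4 = 0 ∨ u % 4 = 1 ∨ u % 4 = 2 ∨ u % 4 = 3 := by omega
  rcases hm with hm | hm | hm | hm
  · rw [eAdd_eq_pow four_ne_zero 0 (a := -u * 1) (by omega),
      eAdd_eq_pow four_ne_zero 0 (a := -u * 3) (by omega), twoVal, if_pos hm]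
    ring
  · rw [eAdd_eq_pow four_ne_zero 3 (a := -u * 1) (by omega),
      eAdd_eq_pow four_ne_zero 1 (a := -u * 3) (by omega), twoVal, if_neg (by omega),
      if_neg (by omega), eAdd_four_one, Complex.I_pow_three]
    rcases Int.units_eq_one_or ε with rfl | rfl
    · rw [ZMod.χ₄_int_one_mod_four (by simpa using hm)]
      simp
    · rw [ZMod.χ₄_int_three_mod_four (by simp; omega)]
      simp [add_comm]
  · rw [eAdd_eq_pow four_ne_zero 2 (a := -u * 1) (by omega),
      eAdd_eq_pow four_ne_zero 2 (a := -u * 3) (by omega), twoVal, if_neg (by omega),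
      if_pos hm, eAdd_four_one, Complex.I_sq]
    ring
  · rw [eAdd_eq_pow four_ne_zero 1 (a := -u * 1) (by omega),
      eAdd_eq_pow four_ne_zero 3 (a := -u * 3) (by omega), twoVal, if_neg (by omega),
      if_neg (by omega), eAdd_four_one, Complex.I_pow_three]
    rcases Int.units_eq_one_or ε with rfl | rfl
    · rw [ZMod.χ₄_int_three_mod_four (by simpa using hm)]
      simp
      ring
    · rw [ZMod.χ₄_int_one_mod_four (by simp; omega)]
      simp

theorem sum_range_eight_wt (ε : ℤˣ) (u : ℤ) :
    ∑ a ∈ Finset.range 8, (wt ε a * (ZMod.χ₈ ((a : ℤ) : ZMod 8) : ℂ)) * eAdd 8 (-u * a) =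
      (1 + ((ε : ℤ) : ℂ) * Complex.I) * if (ε : ℤ) * u % 4 = 1 then
        (ZMod.χ₈' (((ε : ℤ) * u : ℤ) : ZMod 8) : ℂ) * (2 * (Real.sqrt 2 : ℝ)) else 0 := by
  have hI := Complex.I_mul_I
  have w : wt ε 0 = 0 ∧ wt ε 1 = ((ε : ℤ) : ℂ) * Complex.I ∧ wt ε 2 = 0 ∧ wt ε 3 = 1 ∧
      wt ε 4 = 0 ∧ wt ε 5 = ((ε : ℤ) : ℂ) * Complex.I ∧ wt ε 6 = 0 ∧ wt ε 7 = 1 := by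
    simp [wt]
  have c : ZMod.χ₈ ((1 : ℤ) : ZMod 8) = 1 ∧ ZMod.χ₈ ((3 : ℤ) : ZMod 8) = -1 ∧
      ZMod.χ₈ ((5 : ℤ) : ZMod 8) = -1 ∧ ZMod.χ₈ ((7 : ℤ) : ZMod 8) = 1 := by
    decide
  simp only [Finset.sum_range_succ, Finset.sum_range_zero, Nat.cast_zero, Nat.cast_one,
    Nat.cast_ofNat, w, c, zero_mul, zero_add, add_zero]
  have h2 : ((Real.sqrt 2 : ℝ) : ℂ) ^ 2 = 2 := by
    rw [← Complex.ofReal_pow, Real.sq_sqrt zero_le_two]; simp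
  have z1 := eAdd_eight_one
  set z := eAdd 8 1 with hz
  have z2 : z ^ 2 = Complex.I := by
    rw [z1]
    push_cast
    linear_combination (1 / 4 * (1 + Complex.I) ^ 2) * h2 + (1 / 2 : ℂ) * hI
  have z4 : z ^ 4 = -1 := by linear_combination (z ^ 2 + Complex.I) * z2 + hI
  have z3 : z ^ 3 = (Real.sqrt 2 / 2 : ℝ) * (-1 + Complex.I) := by
    rw [pow_succ, z2, z1]
    linear_combination ((Real.sqrt 2 / 2 : ℝ) : ℂ) * hI
  have z5 : z ^ 5 = -z := by linear_combination z * z4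
  have z6 : z ^ 6 = -Complex.I := by linear_combination z ^ 2 * z4 - z2
  have z7 : z ^ 7 = -z ^ 3 := by linear_combination z ^ 3 * z4
  have P : ∀ j1 j3 j5 j7 : ℕ, (8 : ℤ) ∣ -u - j1 → (8 : ℤ) ∣ -u * 3 - j3 → (8 : ℤ) ∣ -u * 5 - j5 →
      (8 : ℤ) ∣ -u * 7 - j7 → eAdd 8 (-u * 1) = z ^ j1 ∧ eAdd 8 (-u * 3) = z ^ j3 ∧
        eAdd 8 (-u * 5) = z ^ j5 ∧ eAdd 8 (-u * 7) = z ^ j7 := by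
    intro j1 j3 j5 j7 h1 h3 h5 h7
    exact ⟨eAdd_eq_pow (by norm_num) j1 (by rw [mul_one]; exact h1),
      eAdd_eq_pow (by norm_num) j3 h3, eAdd_eq_pow (by norm_num) j5 h5,
      eAdd_eq_pow (by norm_num) j7 h7⟩
  have x8 : ∀ r : ℤ, (8 : ℤ) ∣ (ε : ℤ) * u - r →
      ZMod.χ₈' (((ε : ℤ) * u : ℤ) : ZMod 8) = ZMod.χ₈' (r : ZMod 8) := by
    intro r hr
    rw [(ZMod.intCast_eq_intCast_iff_dvd_sub r _ 8).2 (by exact_mod_cast hr)]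
  have y : ZMod.χ₈' ((1 : ℤ) : ZMod 8) = 1 ∧ ZMod.χ₈' ((5 : ℤ) : ZMod 8) = -1 := by decide
  have hm : u % 8 = 0 ∨ u % 8 = 1 ∨ u % 8 = 2 ∨ u % 8 = 3 ∨ u % 8 = 4 ∨ u % 8 = 5 ∨ u % 8 = 6 ∨
      u % 8 = 7 := by omega
  have hε : (ε : ℤ) = 1 ∨ (ε : ℤ) = -1 := by
    rcases Int.units_eq_one_or ε with rfl | rfl <;> simp
  have hε' : ((ε : ℤ) : ℂ) * Complex.I * ((ε : ℤ) : ℂ) * Complex.I = -1 := by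
    linear_combination Complex.I * Complex.I * sq_unit ε + hI
  rcases hm with hm | hm | hm | hm | hm | hm | hm | hm
  · obtain ⟨p1, p3, p5, p7⟩ := P 0 0 0 0 (by omega) (by omega) (by omega) (by omega)
    rw [p1, p3, p5, p7, if_neg (by rcases hε with h | h <;> rw [h] <;> omega)]
    push_cast
    ring
  · obtain ⟨p1, p3, p5, p7⟩ := P 7 5 3 1 (by omega) (by omega) (by omega) (by omega)
    rw [p1, p3, p5, p7, z7, z5, z3, z1]
    rcases hε with h | h
    · rw [if_pos (by rw [h]; omega), x8 1 (by rw [h]; omega), y.1, h]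
      push_cast
      linear_combination (-(Real.sqrt 2 : ℝ) : ℂ) * hI
    · rw [if_neg (by rw [h]; omega), h]
      push_cast
      linear_combination ((Real.sqrt 2 : ℝ) : ℂ) * hI
  · obtain ⟨p1, p3, p5, p7⟩ := P 6 2 6 2 (by omega) (by omega) (by omega) (by omega)
    rw [p1, p3, p5, p7, if_neg (by rcases hε with h | h <;> rw [h] <;> omega)]
    push_cast
    ring
  · obtain ⟨p1, p3, p5, p7⟩ := P 5 7 1 3 (by omega) (by omega) (by omega) (by omega)
    rw [p1, p3, p5, p7, z7, z5, z3, z1]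
    rcases hε with h | h
    · rw [if_neg (by rw [h]; omega), h]
      push_cast
      linear_combination (-(Real.sqrt 2 : ℝ) : ℂ) * hI
    · rw [if_pos (by rw [h]; omega), x8 5 (by rw [h]; omega), y.2, h]
      push_cast
      linear_combination ((Real.sqrt 2 : ℝ) : ℂ) * hI
  · obtain ⟨p1, p3, p5, p7⟩ := P 4 4 4 4 (by omega) (by omega) (by omega) (by omega)
    rw [p1, p3, p5, p7, if_neg (by rcases hε with h | h <;> rw [h] <;> omega)]
    push_cast
    ring
  · obtain ⟨p1, p3, p5, p7⟩ := P 3 1 7 5 (by omega) (by omega) (by omega) (by omega)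
    rw [p1, p3, p5, p7, z7, z5, z3, z1]
    rcases hε with h | h
    · rw [if_pos (by rw [h]; omega), x8 5 (by rw [h]; omega), y.2, h]
      push_cast
      linear_combination ((Real.sqrt 2 : ℝ) : ℂ) * hI
    · rw [if_neg (by rw [h]; omega), h]
      push_cast
      linear_combination (-(Real.sqrt 2 : ℝ) : ℂ) * hI
  · obtain ⟨p1, p3, p5, p7⟩ := P 2 6 2 6 (by omega) (by omega) (by omega) (by omega)
    rw [p1, p3, p5, p7, if_neg (by rcases hε with h | h <;> rw [h] <;> omega)]
    push_cast
    ring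
  · obtain ⟨p1, p3, p5, p7⟩ := P 1 3 5 7 (by omega) (by omega) (by omega) (by omega)
    rw [p1, p3, p5, p7, z7, z5, z3, z1]
    rcases hε with h | h
    · rw [if_neg (by rw [h]; omega), h]
      push_cast
      linear_combination ((Real.sqrt 2 : ℝ) : ℂ) * hI
    · rw [if_pos (by rw [h]; omega), x8 1 (by rw [h]; omega), y.1, h]
      push_cast
      linear_combination (-(Real.sqrt 2 : ℝ) : ℂ) * hI

theorem wt_mul_chi8_pow (ε : ℤˣ) (a : ℤ) {k : ℕ} (hk : k ≠ 0) :
    wt ε a * (ZMod.χ₈ (a : ZMod 8) : ℂ) ^ k =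
      if Even k then wt ε a else wt ε a * (ZMod.χ₈ (a : ZMod 8) : ℂ) := by
  by_cases ha : Odd a
  · have h1 : (ZMod.χ₈ (a : ZMod 8) : ℂ) ^ 2 = 1 := by exact_mod_cast chi8_sq_odd ha
    rcases Nat.even_or_odd' k with ⟨j, rfl | rfl⟩
    · rw [if_pos (even_two_mul j), pow_mul, h1, one_pow, mul_one]
    · rw [if_neg (Nat.not_even_iff_odd.2 (odd_two_mul_add_one j)), pow_succ, pow_mul, h1, one_pow,
        one_mul]
  · rw [wt_even ε ha]
    simp

/-- For an even exponent only powers of χ₈² occur; they are 1 wherever the weight is nonzero, so the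
summand without the exponential has period 4. -/
theorem twoSum_even (ε : ℤˣ) (n : ℤ) {i : ℕ} (hi : Even i) : twoSum ε n (i + 2) =
    (1 + ((ε : ℤ) : ℂ) * Complex.I) *
      if (2 ^ i : ℤ) ∣ n then 2 ^ i * twoVal ε (n / 2 ^ i) else 0 := by
  have h := sum_periodic_eAdd (F := wt ε) (D := 4) (E := 2 ^ i) four_ne_zero (by positivity)
    (fun a => wt_congr ε (by simp)) (-n)
  rw [show 4 * 2 ^ i = 2 ^ (i + 2) by ring] at h
  simp only [twoSum, wt_mul_chi8_pow ε _ (by omega : i + 2 ≠ 0),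
    if_pos (show Even (i + 2) from hi.add even_two)]
  rw [h]
  push_cast
  simp only [dvd_neg]
  split_ifs with hd
  · rw [Int.neg_ediv_of_dvd hd, sum_range_four_wt]
    ring
  · rw [mul_zero]

/-- For an odd exponent one factor χ₈ survives, and the period is 8. -/
theorem twoSum_odd (ε : ℤˣ) (n : ℤ) {i : ℕ} (hi : Even i) : twoSum ε n (i + 3) =
    (1 + ((ε : ℤ) : ℂ) * Complex.I) *
      if (2 ^ i : ℤ) ∣ n ∧ (ε : ℤ) * (n / 2 ^ i) % 4 = 1 then
        2 ^ i * ((ZMod.χ₈' (((ε : ℤ) * (n / 2 ^ i) : ℤ) : ZMod 8) : ℂ) * (2 * (Real.sqrt 2 : ℝ)))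
      else 0 := by
  have h := sum_periodic_eAdd (F := fun a => wt ε a * (ZMod.χ₈ (a : ZMod 8) : ℂ)) (D := 8)
    (E := 2 ^ i) (by norm_num) (by positivity)
    (fun a => by
      rw [wt_congr ε (b := a) (by norm_num), chi8_congr (b := a) (by norm_num)]) (-n)
  rw [show 8 * 2 ^ i = 2 ^ (i + 3) by ring] at h
  simp only [twoSum, wt_mul_chi8_pow ε _ (by omega : i + 3 ≠ 0),
    if_neg (show ¬ Even (i + 3) from Nat.not_even_iff_odd.2 (hi.add_odd (by decide)))]
  rw [h]
  push_cast
  simp only [dvd_neg]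
  by_cases hd : (2 ^ i : ℤ) ∣ n
  · have h8 := sum_range_eight_wt ε (n / 2 ^ i)
    push_cast at h8
    rw [if_pos hd, Int.neg_ediv_of_dvd hd, h8]
    simp only [hd, true_and]
    split_ifs <;> ring
  · simp [hd]

/-! ### The Euler factor at `2` -/

theorem cast_sqrt_two : ((Real.sqrt 2 : ℝ) : ℂ) = 2 ^ (1 / 2 : ℂ) := by
  rw [Real.sqrt_eq_rpow, Complex.ofReal_cpow zero_le_two]
  push_cast
  rfl

theorem two_cpow_add_three_halves (l : ℕ) :
    (2 : ℂ) ^ ((l : ℂ) + 3 / 2) = 2 ^ l * (2 * (Real.sqrt 2 : ℝ)) := by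
  rw [cast_sqrt_two, show (l : ℂ) + 3 / 2 = l + 1 + 1 / 2 by ring,
    Complex.cpow_add _ _ two_ne_zero, Complex.cpow_add _ _ two_ne_zero, Complex.cpow_natCast,
    Complex.cpow_one]
  ring

theorem eight_cpow (ν : ℂ) :
    (8 : ℂ) ^ (-ν - 1 / 2) = 2 * (Real.sqrt 2 : ℝ) * 8 ^ (-ν - 1) := by
  have h8 : (8 : ℂ) ≠ 0 := by norm_num
  have e : ((Real.sqrt 8 : ℝ) : ℂ) = 8 ^ (1 / 2 : ℂ) := by
    rw [Real.sqrt_eq_rpow, Complex.ofReal_cpow (by norm_num)]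
    push_cast
    rfl
  rw [show -ν - 1 / 2 = 1 / 2 + (-ν - 1) by ring, Complex.cpow_add _ _ h8, ← e,
    show (8 : ℝ) = 2 ^ 2 * 2 by norm_num, Real.sqrt_mul (by norm_num), Real.sqrt_sq zero_le_two]
  push_cast
  ring

/-- The contribution of `2` to the Fourier coefficient, for `n = 2 ^ l * n'` and `m' = ε n'`. -/
def twoFactor (l : ℕ) (m' : ℤ) (ν : ℂ) : ℂ :=
  (∑ k ∈ Finset.range (l - 1) with Even k, 2 ^ k * ((2 : ℂ) ^ (k + 2)) ^ (-ν - 1)) -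
    (if Odd l then 2 ^ (l - 1) * ((2 : ℂ) ^ (l + 1)) ^ (-ν - 1) else 0) +
    (if Even l then (ZMod.χ₄ (m' : ZMod 4) : ℂ) * (2 ^ l * ((2 : ℂ) ^ (l + 2)) ^ (-ν - 1))
      else 0) +
    (if Even l ∧ m' ≡ 1 [ZMOD 4] then
      (ZMod.χ₈' (m' : ZMod 8) : ℂ) *
        (2 ^ ((l : ℂ) + 3 / 2) * ((2 : ℂ) ^ (l + 3)) ^ (-ν - 1))
      else 0)

theorem exists_two_pow_mul {n : ℤ} (hn : n ≠ 0) :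
    ∃ n' : ℤ, Odd n' ∧ n = 2 ^ padicValInt 2 n * n' := by
  have h1 : ((2 : ℕ) : ℤ) ^ padicValInt 2 n ∣ n := padicValInt_dvd n
  obtain ⟨n', hn'⟩ := h1
  push_cast at hn'
  refine ⟨n', ?_, hn'⟩
  rw [← Int.not_even_iff_odd]
  rintro ⟨k, hk⟩
  have h2 : ((2 : ℕ) : ℤ) ^ (padicValInt 2 n + 1) ∣ n := by
    refine ⟨k, ?_⟩
    rw [pow_succ]
    push_cast
    rw [mul_assoc, two_mul, ← hk]
    exact hn'
  rw [padicValInt_dvd_iff] at h2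
  omega

/-- The cases in the definition are values of one expression. For ℓ = 1 only its second term is
present; for ℓ = 0 only the third, with sign χ₄(εn), and for εn ≡ 1 mod 4 also the fourth. The sum
is empty in both cases, as ℓ - 1 truncates to 0. -/
theorem cCoeff_eq (ε : ℤˣ) {n : ℤ} (hn : n ≠ 0) (ν : ℂ) : cCoeff ε n ν =
    (1 + ((ε : ℤ) : ℂ) * Complex.I) *
      twoFactor (padicValInt 2 n) ((ε : ℤ) * (n / 2 ^ padicValInt 2 n)) ν := by
  obtain ⟨n', hodd, hnn⟩ := exists_two_pow_mul hn
  have hε : (ε : ℤ) = 1 ∨ (ε : ℤ) = -1 := by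
    rcases Int.units_eq_one_or ε with rfl | rfl <;> simp
  rw [Int.odd_iff] at hodd
  unfold cCoeff
  simp only
  congr 1
  generalize padicValInt 2 n = l at *
  have hq : n / 2 ^ l = n' := by rw [hnn]; exact Int.mul_ediv_cancel_left _ (by positivity)
  rw [hq]
  by_cases h1 : l = 1 ∨ (ε : ℤ) * n ≡ 3 [ZMOD 4]
  · rw [if_pos h1]
    rcases h1 with rfl | h1
    · norm_num [twoFactor]
    · have hl : l = 0 := by
        by_contra hl
        obtain ⟨j, rfl⟩ := Nat.exists_eq_succ_of_ne_zero hl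
        have h3 : (ε : ℤ) * n % 4 = 3 := h1
        rw [pow_succ, mul_right_comm, mul_comm] at hnn
        rw [hnn] at h3
        rcases hε with h | h <;> rw [h] at h3 <;> omega
      subst hl
      have h3 : (ε : ℤ) * n' % 4 = 3 := by
        rw [hnn, pow_zero, one_mul] at h1
        exact h1
      have h4 : ¬ ((ε : ℤ) * n' ≡ 1 [ZMOD 4]) := by rw [Int.ModEq]; omega
      rw [twoFactor, ZMod.χ₄_int_three_mod_four h3]
      simp [h4]
      norm_num
  rw [if_neg h1]
  by_cases h2 : (ε : ℤ) * n ≡ 1 [ZMOD 4]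
  · rw [if_pos h2]
    have hl : l = 0 := by
      by_contra hl
      obtain ⟨j, rfl⟩ := Nat.exists_eq_succ_of_ne_zero hl
      have h3 : (ε : ℤ) * n % 4 = 1 := h2
      rw [pow_succ, mul_right_comm, mul_comm] at hnn
      rw [hnn] at h3
      rcases hε with h | h <;> rw [h] at h3 <;> omega
    subst hl
    have hnn' : n = n' := by simpa using hnn
    rw [hnn'] at h2 ⊢
    have h3 : (ε : ℤ) * n' % 4 = 1 := h2
    have e := two_cpow_add_three_halves 0
    rw [twoFactor, ZMod.χ₄_int_one_mod_four h3, eight_cpow, e]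
    simp [h2]
    norm_num
  · rw [if_neg h2]
    rfl

theorem int_two_pow_mul_ediv {n n' : ℤ} {l i : ℕ} (hnn : n = 2 ^ l * n') (h : i ≤ l) :
    (2 ^ i : ℤ) ∣ n ∧ n / 2 ^ i = 2 ^ (l - i) * n' := by
  have h1 : n = 2 ^ i * (2 ^ (l - i) * n') := by
    rw [hnn, ← mul_assoc, ← pow_add, Nat.add_sub_cancel' h]
  refine ⟨⟨_, h1⟩, ?_⟩
  rw [h1]
  exact Int.mul_ediv_cancel_left _ (by positivity)

theorem not_two_pow_dvd {n n' : ℤ} {l i : ℕ} (hnn : n = 2 ^ l * n') (hodd : Odd n') (h : l < i) :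
    ¬ (2 ^ i : ℤ) ∣ n := by
  intro hd
  have h1 : (2 ^ l * 2 : ℤ) ∣ 2 ^ l * n' := by
    rw [← hnn, ← pow_succ]
    exact (pow_dvd_pow 2 h).trans hd
  rw [mul_dvd_mul_iff_left (by positivity)] at h1
  rw [Int.odd_iff] at hodd
  omega

/-- The moduli run from 2^2 to 2^(ℓ+3). Even k ≤ ℓ - 2 give the main sum, and k = ℓ - 1 gives the
negative term if ℓ is odd. For even ℓ the terms k = ℓ and k = ℓ + 1 carry χ₄ and `ZMod.χ₈'`. A
modulus 2^(i+3) with i even contributes only for i = ℓ, since ε n / 2^i must be odd. -/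
theorem sum_twoSum (ε : ℤˣ) {n n' : ℤ} {l : ℕ} (hnn : n = 2 ^ l * n') (hodd : Odd n') (ν : ℂ) :
    ∑ k ∈ Finset.range (l + 2), twoSum ε n (k + 2) * ((2 : ℂ) ^ (k + 2)) ^ (-ν - 1) =
      (1 + ((ε : ℤ) : ℂ) * Complex.I) * twoFactor l ((ε : ℤ) * n') ν := by
  have hodd' := Int.odd_iff.1 hodd
  have hε : (ε : ℤ) = 1 ∨ (ε : ℤ) = -1 := by
    rcases Int.units_eq_one_or ε with rfl | rfl <;> simp
  set δ : ℂ := 1 + ((ε : ℤ) : ℂ) * Complex.I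
  have hzero : ∀ i, Even i → i ≠ l → twoSum ε n (i + 3) = 0 := by
    intro i hi hne
    rw [twoSum_odd ε n hi, if_neg, mul_zero]
    rintro ⟨h1, h2⟩
    have hl : i < l := by
      by_contra! h
      exact not_two_pow_dvd hnn hodd (lt_of_le_of_ne h hne.symm) h1
    rw [(int_two_pow_mul_ediv hnn hl.le).2, show l - i = l - i - 1 + 1 by omega, pow_succ,
      mul_right_comm, mul_comm] at h2
    rcases hε with h | h <;> rw [h] at h2 <;> omega
  have hA : ∀ k, Even k → k + 2 ≤ l → twoSum ε n (k + 2) = δ * 2 ^ k := by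
    intro k hk hl
    obtain ⟨h1, h2⟩ := int_two_pow_mul_ediv hnn (show k ≤ l by omega)
    rw [twoSum_even ε n hk, if_pos h1, h2, show l - k = l - k - 2 + 2 by omega, pow_add, twoVal,
      if_pos (by rw [mul_right_comm]; norm_num), mul_one]
  have hB : ∀ k, Even k → k + 1 = l → twoSum ε n (k + 2) = -(δ * 2 ^ k) := by
    intro k hk hl
    obtain ⟨h1, h2⟩ := int_two_pow_mul_ediv hnn (show k ≤ l by omega)
    rw [twoSum_even ε n hk, if_pos h1, h2, show l - k = 1 by omega, pow_one, twoVal,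
      if_neg (by omega), if_pos (by omega)]
    ring
  have hC : Even l → twoSum ε n (l + 2) =
      δ * (2 ^ l * (ZMod.χ₄ (((ε : ℤ) * n' : ℤ) : ZMod 4) : ℂ)) := by
    intro hk
    obtain ⟨h1, h2⟩ := int_two_pow_mul_ediv hnn le_rfl
    rw [twoSum_even ε n hk, if_pos h1, h2, Nat.sub_self, pow_zero, one_mul, twoVal,
      if_neg (by omega), if_neg (by omega)]
  have hD : Even l → twoSum ε n (l + 3) = δ * if (ε : ℤ) * n' ≡ 1 [ZMOD 4] then
      2 ^ l * ((ZMod.χ₈' (((ε : ℤ) * n' : ℤ) : ZMod 8) : ℂ) * (2 * (Real.sqrt 2 : ℝ))) else 0 := by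
    intro hk
    obtain ⟨h1, h2⟩ := int_two_pow_mul_ediv hnn le_rfl
    rw [twoSum_odd ε n hk, h2, Nat.sub_self, pow_zero, one_mul]
    simp only [h1, true_and]
    rfl
  have hlow : ∑ k ∈ Finset.range (l - 1), twoSum ε n (k + 2) * ((2 : ℂ) ^ (k + 2)) ^ (-ν - 1) =
      δ * ∑ k ∈ Finset.range (l - 1) with Even k, 2 ^ k * ((2 : ℂ) ^ (k + 2)) ^ (-ν - 1) := by
    rw [Finset.sum_filter, Finset.mul_sum]
    refine Finset.sum_congr rfl fun k hk => ?_
    rw [Finset.mem_range] at hk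
    split_ifs with he
    · rw [hA k he (by omega)]
      ring
    · obtain ⟨j, rfl⟩ := Nat.not_even_iff_odd.1 he
      rw [show 2 * j + 1 + 2 = 2 * j + 3 by ring, hzero _ (even_two_mul j) (by omega)]
      ring
  have htop : twoSum ε n (l + 2) * ((2 : ℂ) ^ (l + 2)) ^ (-ν - 1) = δ * if Even l then
      (ZMod.χ₄ (((ε : ℤ) * n' : ℤ) : ZMod 4) : ℂ) * (2 ^ l * ((2 : ℂ) ^ (l + 2)) ^ (-ν - 1))
      else 0 := by
    split_ifs with he
    · rw [hC he]
      ring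
    · obtain ⟨j, hj⟩ := Nat.not_even_iff_odd.1 he
      rw [show l + 2 = 2 * j + 3 by omega, hzero _ (even_two_mul j) (by omega)]
      ring
  have hlast : twoSum ε n (l + 3) * ((2 : ℂ) ^ (l + 3)) ^ (-ν - 1) =
      δ * if Even l ∧ (ε : ℤ) * n' ≡ 1 [ZMOD 4] then
      (ZMod.χ₈' (((ε : ℤ) * n' : ℤ) : ZMod 8) : ℂ) *
        (2 ^ ((l : ℂ) + 3 / 2) * ((2 : ℂ) ^ (l + 3)) ^ (-ν - 1)) else 0 := by
    by_cases he : Even l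
    · rw [hD he, two_cpow_add_three_halves]
      simp only [he, true_and]
      split_ifs <;> ring
    · rw [if_neg (fun h => he h.1), show l + 3 = (l + 1) + 2 by ring, twoSum_even ε n
        (Nat.not_even_iff_odd.1 he).add_one, if_neg (not_two_pow_dvd hnn hodd (by omega))]
      ring
  rw [Finset.sum_range_succ, show l + 1 + 2 = l + 3 by ring, hlast, Finset.sum_range_succ, htop,
    twoFactor, mul_add, mul_add, mul_sub, ← hlow]
  congr 2
  rcases Nat.eq_zero_or_pos l with rfl | hl
  · simp
  · obtain ⟨j, rfl⟩ := Nat.exists_eq_succ_of_ne_zero hl.ne'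
    simp only [Nat.succ_eq_add_one, Nat.add_sub_cancel]
    rw [Finset.sum_range_succ, sub_eq_add_neg]
    split_ifs with ho
    · rw [hB j (by rw [Nat.odd_add_one] at ho; simpa using ho) rfl]
      ring
    · rw [Nat.not_odd_iff_even, Nat.even_add_one, Nat.not_even_iff_odd] at ho
      obtain ⟨i, rfl⟩ := ho
      rw [show 2 * i + 1 + 2 = 2 * i + 3 by ring, hzero _ (even_two_mul i) (by omega)]
      ring

theorem hasSum_twoSum (ε : ℤˣ) {n : ℤ} (hn : n ≠ 0) (ν : ℂ) :
    HasSum (fun k : ℕ => twoSum ε n (k + 2) * ((2 : ℂ) ^ (k + 2)) ^ (-ν - 1)) (cCoeff ε n ν) := by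
  obtain ⟨n', hodd, hnn⟩ := exists_two_pow_mul hn
  have hq := (int_two_pow_mul_ediv hnn le_rfl).2
  rw [cCoeff_eq ε hn, hq, Nat.sub_self, pow_zero, one_mul, ← sum_twoSum ε hnn hodd]
  refine hasSum_sum_of_ne_finset_zero fun k hk => ?_
  rw [Finset.mem_range, not_lt] at hk
  have h0 : twoSum ε n (k + 2) = 0 := by
    rcases Nat.even_or_odd k with he | ⟨j, rfl⟩
    · rw [twoSum_even ε n he, if_neg (not_two_pow_dvd hnn hodd (by omega)), mul_zero]
    · rw [show 2 * j + 1 + 2 = 2 * j + 3 by ring, twoSum_odd ε n (even_two_mul j),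
        if_neg (fun h => not_two_pow_dvd hnn hodd (by omega) h.1), mul_zero]
  rw [h0, zero_mul]

/-! ### The decomposition `m = s t` -/

theorem finsupp_filter_prod_pow (m : ℕ) (P : ℕ → Prop) [DecidablePred P] :
    (∏ p ∈ m.primeFactors with P p, p ^ m.factorization p).factorization =
      m.factorization.filter P := by
  have h : ∏ p ∈ m.primeFactors with P p, p ^ m.factorization p =
      (m.factorization.filter P).prod fun p e => p ^ e := by
    rw [Finsupp.prod_filter_index]
    congr 1
  rw [h]
  refine Nat.prod_pow_factorization_eq_self fun p hp => ?_
  rw [Finsupp.support_filter, Finset.mem_filter] at hp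
  exact Nat.prime_of_mem_primeFactors hp.1

theorem factorization_evenPart (m : ℤ) (p : ℕ) : (evenPart m).factorization p =
    if Even (m.natAbs.factorization p) then m.natAbs.factorization p else 0 := by
  rw [evenPart, finsupp_filter_prod_pow, Finsupp.filter_apply]

theorem natAbs_oddPart {m : ℤ} (hm : m ≠ 0) : (oddPart m).natAbs =
    ∏ p ∈ m.natAbs.primeFactors with Odd (m.natAbs.factorization p),
      p ^ m.natAbs.factorization p := by
  rw [oddPart, Int.natAbs_mul, Int.natAbs_sign_of_ne_zero hm, one_mul, Int.natAbs_natCast]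

theorem factorization_oddPart {m : ℤ} (hm : m ≠ 0) (p : ℕ) : (oddPart m).natAbs.factorization p =
    if Odd (m.natAbs.factorization p) then m.natAbs.factorization p else 0 := by
  rw [natAbs_oddPart hm, finsupp_filter_prod_pow, Finsupp.filter_apply]

theorem evenPart_mul_oddPart {m : ℤ} (hm : m ≠ 0) : (evenPart m : ℤ) * oddPart m = m := by
  have h : (evenPart m : ℕ) * ∏ p ∈ m.natAbs.primeFactors with Odd (m.natAbs.factorization p),
      p ^ m.natAbs.factorization p = m.natAbs := by
    conv_rhs => rw [← Nat.prod_factorization_pow_eq_self (Int.natAbs_ne_zero.2 hm)]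
    rw [evenPart, Finsupp.prod, Nat.support_factorization]
    simp only [← Nat.not_even_iff_odd]
    exact Finset.prod_filter_mul_prod_filter_not _ _ _
  rw [oddPart, mul_left_comm, ← Nat.cast_mul, h, Int.sign_mul_natAbs]

theorem evenPart_ne_zero {m : ℤ} (hm : m ≠ 0) : evenPart m ≠ 0 := by
  intro h
  apply hm
  rw [← evenPart_mul_oddPart hm, h]
  simp

theorem oddPart_ne_zero {m : ℤ} (hm : m ≠ 0) : oddPart m ≠ 0 := by
  intro h
  apply hm
  rw [← evenPart_mul_oddPart hm, h, mul_zero]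

theorem isSquare_evenPart (m : ℤ) : IsSquare (evenPart m) := by
  refine ⟨∏ p ∈ m.natAbs.primeFactors with Even (m.natAbs.factorization p),
    p ^ (m.natAbs.factorization p / 2), ?_⟩
  rw [evenPart, ← Finset.prod_mul_distrib]
  refine Finset.prod_congr rfl fun p hp => ?_
  obtain ⟨k, hk⟩ := (Finset.mem_filter.1 hp).2
  rw [← pow_add, hk]
  congr 1
  omega

theorem primeFactors_evenPart (m : ℤ) : (evenPart m).primeFactors =
    {p ∈ m.natAbs.primeFactors | Even (m.natAbs.factorization p)} := by
  ext p
  rw [← Nat.support_factorization, Finsupp.mem_support_iff, factorization_evenPart,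
    Finset.mem_filter, ← Nat.support_factorization, Finsupp.mem_support_iff]
  split_ifs with h <;> simp [h]

theorem primeFactors_oddPart {m : ℤ} (hm : m ≠ 0) : (oddPart m).natAbs.primeFactors =
    {p ∈ m.natAbs.primeFactors | ¬ Even (m.natAbs.factorization p)} := by
  ext p
  rw [← Nat.support_factorization, Finsupp.mem_support_iff, factorization_oddPart hm,
    Finset.mem_filter, ← Nat.support_factorization, Finsupp.mem_support_iff, Nat.not_even_iff_odd]
  split_ifs with h <;> simp [h]

theorem jacobi_sq_mul {u p : ℕ} (a : ℤ) (h : Nat.Coprime u p) :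
    jacobiSym ((u * u : ℕ) * a) p = jacobiSym a p := by
  have hg : Int.gcd (u : ℤ) p = 1 := h
  rw [jacobiSym.mul_left]
  push_cast
  rw [jacobiSym.mul_left, ← sq, jacobiSym.sq_one hg, one_mul]

/-- At a prime of even multiplicity, the residue symbol of `t` is that of the unit part of `m`. -/
theorem jacobi_oddPart {m : ℤ} (hm : m ≠ 0) {p : ℕ} (hp : p.Prime)
    (he : Even (m.natAbs.factorization p)) :
    jacobiSym (m / (p ^ m.natAbs.factorization p : ℕ)) p = jacobiSym (oddPart m) p := by
  obtain ⟨u, hu⟩ := isSquare_evenPart m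
  have hu0 : u ≠ 0 := by
    rintro rfl
    exact evenPart_ne_zero hm hu
  have hfac := factorization_evenPart m p
  rw [if_pos he, hu, Nat.factorization_mul hu0 hu0, Finsupp.add_apply] at hfac
  set k := u.factorization p with hk
  have hu' : u = p ^ k * (u / p ^ k) := (Nat.ordProj_mul_ordCompl_eq_self u p).symm
  have hcop : Nat.Coprime (u / p ^ k) p := (Nat.coprime_ordCompl hp hu0).symm
  -- With s = u², the unit part of m at p is t times the square of the prime-to-p part of u.
  have hm' : m = (p ^ m.natAbs.factorization p : ℕ) *
      (((u / p ^ k) * (u / p ^ k) : ℕ) * oddPart m) := by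
    conv_lhs => rw [← evenPart_mul_oddPart hm, hu, hu']
    rw [← hfac]
    push_cast
    ring
  have h0 : ((p ^ m.natAbs.factorization p : ℕ) : ℤ) ≠ 0 :=
    Int.natCast_ne_zero.2 (pow_ne_zero _ hp.ne_zero)
  have : m / (p ^ m.natAbs.factorization p : ℕ) =
      ((u / p ^ k) * (u / p ^ k) : ℕ) * oddPart m := by
    conv_lhs => enter [1]; rw [hm']
    exact Int.mul_ediv_cancel_left _ h0
  rw [this, jacobi_sq_mul _ hcop]

/-! ### Kronecker symbols with positive lower argument, and the factors of P -/

theorem kronecker_natCast (a : ℤ) {d : ℕ} (hd : d ≠ 0) : kronecker a d =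
    ZMod.χ₈ (a : ZMod 8) ^ padicValNat 2 d * jacobiSym a (ordCompl[2] d) := by
  rw [kronecker, if_neg (by exact_mod_cast hd), if_neg (by omega), one_mul, padicValInt,
    Int.natAbs_natCast]

theorem kronecker_odd (a : ℤ) {d : ℕ} (hd : Odd d) : kronecker a d = jacobiSym a d := by
  have h2 : ¬ 2 ∣ d := by rw [Nat.odd_iff] at hd; omega
  rw [kronecker_natCast a hd.pos.ne', padicValNat.eq_zero_of_not_dvd h2,
    Nat.factorization_eq_zero_of_not_dvd h2]
  simp

theorem kronecker_two (a : ℤ) : kronecker a 2 = ZMod.χ₈ (a : ZMod 8) := by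
  have := kronecker_natCast a two_ne_zero
  rw [Nat.Prime.factorization_self Nat.prime_two, padicValNat.self one_lt_two] at this
  simpa using this

theorem kronecker_two_mul (a : ℤ) {d : ℕ} (hd : d ≠ 0) :
    kronecker a (2 * d : ℕ) = kronecker a 2 * kronecker a d := by
  rw [kronecker_natCast a (mul_ne_zero two_ne_zero hd), kronecker_natCast a hd, kronecker_two,
    padicValNat.mul two_ne_zero hd, padicValNat.self one_lt_two]
  have h : ordCompl[2] (2 * d) = ordCompl[2] d := by
    rw [Nat.ordCompl_mul, Nat.Prime.factorization_self Nat.prime_two]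
    simp
  rw [h]
  ring

theorem abs_kronecker_le (a : ℤ) {d : ℕ} (hd : d ≠ 0) : ‖(kronecker a d : ℂ)‖ ≤ 1 := by
  have h8 : ‖(ZMod.χ₈ (a : ZMod 8) : ℂ)‖ ≤ 1 := by
    rcases ZMod.isQuadratic_χ₈ (a : ZMod 8) with h | h | h <;> rw [h] <;> simp
  rw [kronecker_natCast a hd]
  push_cast
  rw [norm_mul, norm_pow]
  exact mul_le_one₀ (pow_le_one₀ (norm_nonneg _) h8) (norm_nonneg _) (norm_jacobi_le _ _)

/-- The local factor of the Dirichlet polynomial at an odd prime. -/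
def localPoly (m : ℤ) (p : ℕ) (ν : ℂ) : ℂ :=
  if Even (m.natAbs.factorization p) then
    (1 - (jacobiSym (oddPart m) p : ℂ) * (p : ℂ) ^ (-ν - 1 / 2)) *
      (∑ j ∈ Finset.range (m.natAbs.factorization p - 1) with Even j, (p : ℂ) ^ (-(j : ℂ) * ν)) +
    (p : ℂ) ^ (-(m.natAbs.factorization p : ℂ) * ν)
  else ∑ j ∈ Finset.range (m.natAbs.factorization p) with Even j, (p : ℂ) ^ (-(j : ℂ) * ν)

/-- The part of the Dirichlet polynomial that comes from the odd primes. -/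
def oddPoly (m : ℤ) (ν : ℂ) : ℂ := ∏ p ∈ m.natAbs.primeFactors.erase 2, localPoly m p ν

theorem kronecker_two_even {m : ℤ} (h : ¬ Odd m) : kronecker m 2 = 0 := by
  rw [kronecker_two, chi8_even h]

/-- The two factors at 2 collapse to the inverse Euler factor of (t/·) at 2. If 2 ∣ s then m is even
and (m/2) = 0; otherwise s is an odd square, so (m/2) = (t/2). -/
theorem kronecker_two_factor {m : ℤ} (hm : m ≠ 0) (z : ℂ) :
    (if 2 ∣ evenPart m then 1 - (kronecker (oddPart m) 2 : ℂ) * z else 1) *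
      (1 - (kronecker m 2 : ℂ) * z) = 1 - (kronecker (oddPart m) 2 : ℂ) * z := by
  have hst := evenPart_mul_oddPart hm
  split_ifs with h
  · have : ¬ Odd m := by
      rw [Int.not_odd_iff_even, ← hst]
      exact even_iff_two_dvd.2 (Dvd.dvd.mul_right (by exact_mod_cast h) _)
    rw [kronecker_two_even this]
    simp
  · obtain ⟨u, hu⟩ := isSquare_evenPart m
    have hs : Odd ((u : ℤ)) := by
      rw [Int.odd_iff]
      by_contra hu'
      exact h (hu ▸ (show 2 ∣ u by omega).mul_right u)
    have h8 : kronecker m 2 = kronecker (oddPart m) 2 := by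
      rw [hu] at hst
      rw [kronecker_two, kronecker_two]
      generalize oddPart m = t at *
      rw [← hst]
      push_cast
      have := chi8_sq_odd hs
      rw [map_mul, map_mul, ← sq]
      rw [Int.cast_natCast] at this
      rw [this, one_mul]
    rw [h8, one_mul]

theorem dirichletPoly_eq {m : ℤ} (hm : m ≠ 0) (ν : ℂ) : dirichletPoly m ν =
    (1 - (kronecker (oddPart m) 2 : ℂ) * 2 ^ (-ν - 1 / 2)) * oddPoly m ν := by
  have hodd : ∀ p ∈ m.natAbs.primeFactors.erase 2, Odd p := fun p hp =>
    (Nat.prime_of_mem_primeFactors (Finset.mem_of_mem_erase hp)).odd_of_ne_two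
      (Finset.ne_of_mem_erase hp)
  rw [dirichletPoly, kronecker_two_factor hm, mul_assoc]
  congr 1
  rw [oddPoly, ← Finset.prod_filter_mul_prod_filter_not (m.natAbs.primeFactors.erase 2)
    (fun p => Even (m.natAbs.factorization p)) (fun p => localPoly m p ν), mul_comm, primeFactors_evenPart,
    primeFactors_oddPart hm, ← Finset.filter_erase, ← Finset.filter_erase]
  congr 1
  · refine Finset.prod_congr rfl fun p hp => ?_
    rw [Finset.mem_filter] at hp
    rw [localPoly, if_pos hp.2, factorization_evenPart, if_pos hp.2, kronecker_odd _ (hodd p hp.1)]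
  · refine Finset.prod_congr rfl fun p hp => ?_
    rw [Finset.mem_filter] at hp
    rw [localPoly, if_neg hp.2, factorization_oddPart hm, if_pos (Nat.not_even_iff_odd.1 hp.2)]

/-! ### The quadratic character of `t` -/

/-- The Dirichlet character modulo `4|t|` with the values `(t/d)` for odd `d`. -/
def jacobiChar (t : ℤ) [NeZero t.natAbs] : DirichletCharacter ℂ (4 * t.natAbs) where
  toFun x := if Odd x.val then (jacobiSym t x.val : ℂ) else 0
  map_one' := by
    have : Fact (1 < 4 * t.natAbs) := ⟨by have := NeZero.pos t.natAbs; omega⟩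
    simp [ZMod.val_one]
  map_mul' := by
    intro x y
    have h2 : ∀ a : ℕ, Odd (a % (4 * t.natAbs)) ↔ Odd a := fun a => by
      rw [Nat.odd_iff, Nat.odd_iff, Nat.mod_mod_of_dvd _ ((by norm_num : 2 ∣ 4).mul_right _)]
    simp only [ZMod.val_mul, h2, Nat.odd_mul]
    by_cases hx : Odd x.val
    · by_cases hy : Odd y.val
      · rw [if_pos ⟨hx, hy⟩, if_pos hx, if_pos hy, ← jacobiSym.mod_right t (hx.mul hy),
          jacobiSym.mul_right' t hx.pos.ne' hy.pos.ne']
        push_cast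
        rfl
      · simp [hy]
    · simp [hx]
  map_nonunit' := by
    intro x hx
    have hx' : ¬ Nat.Coprime x.val (4 * t.natAbs) := by
      rwa [← ZMod.isUnit_iff_coprime, ZMod.natCast_zmod_val]
    split_ifs with h
    · rw [jacobiSym.eq_zero_iff.2 ⟨h.pos.ne', fun hg => hx' ?_⟩, Int.cast_zero]
      refine Nat.Coprime.mul_right ?_ ?_
      · exact (Nat.Coprime.pow_right 2 (Nat.coprime_two_right.2 h) : Nat.Coprime x.val (2 ^ 2))
      · rw [Int.gcd_comm] at hg
        exact hg
    · rfl

theorem jacobiChar_natCast (t : ℤ) [NeZero t.natAbs] (d : ℕ) :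
    jacobiChar t (d : ZMod (4 * t.natAbs)) = if Odd d then (jacobiSym t d : ℂ) else 0 := by
  change (if Odd (d : ZMod (4 * t.natAbs)).val then
    (jacobiSym t (d : ZMod (4 * t.natAbs)).val : ℂ) else 0) = _
  have h2 : Odd (d % (4 * t.natAbs)) ↔ Odd d := by
    rw [Nat.odd_iff, Nat.odd_iff, Nat.mod_mod_of_dvd _ ((by norm_num : 2 ∣ 4).mul_right _)]
  rw [ZMod.val_natCast]
  simp only [h2]
  split_ifs with h
  · rw [← jacobiSym.mod_right t h]
  · rfl

/-- The Dirichlet series of the Kronecker symbol and the `L`-series of the character. -/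
theorem kroneckerL_mul (t : ℤ) [NeZero t.natAbs] {w : ℂ} (hw : 1 < w.re) :
    LSeriesSummable (fun d : ℕ => (kronecker t d : ℂ)) w ∧
      (1 - (kronecker t 2 : ℂ) * 2 ^ (-w)) * kroneckerL t w =
        LSeries (fun d : ℕ => jacobiChar t d) w := by
  have hsum : LSeriesSummable (fun d : ℕ => (kronecker t d : ℂ)) w :=
    LSeriesSummable_of_bounded_of_one_lt_re (m := 1) (fun d hd => abs_kronecker_le t hd) hw
  refine ⟨hsum, ?_⟩
  have h2 : Function.Injective (fun k : ℕ => 2 * k) := fun a b h => by simpa using h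
  have h2' : Function.Injective (fun k : ℕ => 2 * k + 1) := fun a b h => by simpa using h
  -- The terms with even d reproduce the whole series times (t/2) 2^(-w); the terms with odd d are
  -- those of the character.
  have e0 : ∀ k : ℕ, LSeries.term (fun d : ℕ => (kronecker t d : ℂ)) w (2 * k) =
      (kronecker t 2 : ℂ) * 2 ^ (-w) *
        LSeries.term (fun d : ℕ => (kronecker t d : ℂ)) w k := by
    intro k
    rcases Nat.eq_zero_or_pos k with rfl | hk
    · simp
    · rw [LSeries.term_of_ne_zero (by omega), LSeries.term_of_ne_zero hk.ne',
        kronecker_two_mul t hk.ne', Nat.cast_mul, Complex.natCast_mul_natCast_cpow,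
        Complex.cpow_neg]
      push_cast
      field_simp
  have e1 : ∀ k : ℕ, LSeries.term (fun d : ℕ => (kronecker t d : ℂ)) w (2 * k + 1) =
      LSeries.term (fun d : ℕ => jacobiChar t d) w (2 * k + 1) := by
    intro k
    rw [LSeries.term_of_ne_zero (by omega), LSeries.term_of_ne_zero (by omega),
      jacobiChar_natCast, if_pos (odd_two_mul_add_one k), kronecker_odd t (odd_two_mul_add_one k)]
  have e2 : ∀ k : ℕ, LSeries.term (fun d : ℕ => jacobiChar t d) w (2 * k) = 0 := by
    intro k
    rcases Nat.eq_zero_or_pos k with rfl | hk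
    · simp
    · rw [LSeries.term_of_ne_zero (by omega), jacobiChar_natCast,
        if_neg (Nat.not_odd_iff_even.2 (even_two_mul k)), zero_div]
  have hsum' : LSeriesSummable (fun d : ℕ => jacobiChar t d) w :=
    DirichletCharacter.LSeriesSummable_of_one_lt_re _ hw
  have s1 := tsum_even_add_odd (hsum.comp_injective h2) (hsum.comp_injective h2')
  have s2 := tsum_even_add_odd (hsum'.comp_injective h2) (hsum'.comp_injective h2')
  simp only [e0, e1, tsum_mul_left] at s1
  simp only [e2, tsum_zero, zero_add] at s2
  rw [s2] at s1
  simp only [kroneckerL, LSeries] at *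
  linear_combination -s1

/-! ### The Euler product over the odd moduli -/

/-- The term of odd modulus in the Dirichlet series of normalized Gauss sums. -/
def oddTerm (ε : ℤˣ) (n : ℤ) (ν : ℂ) (c : ℕ) : ℂ :=
  if Odd c then oddSum ε n c * (c : ℂ) ^ (-ν - 1) else 0

theorem oddTerm_mul (ε : ℤˣ) (n : ℤ) (ν : ℂ) {c d : ℕ} (h : Nat.Coprime c d) :
    oddTerm ε n ν (c * d) = oddTerm ε n ν c * oddTerm ε n ν d := by
  unfold oddTerm
  by_cases hc : Odd c
  · by_cases hd : Odd d
    · rw [if_pos (hc.mul hd), if_pos hc, if_pos hd, oddSum_mul ε n hc hd h, Nat.cast_mul,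
        Complex.natCast_mul_natCast_cpow]
      ring
    · rw [if_neg (fun h' => hd (Nat.odd_mul.1 h').2), if_neg hd, mul_zero]
  · rw [if_neg (fun h' => hc (Nat.odd_mul.1 h').1), if_neg hc, zero_mul]

theorem norm_oddTerm_le (ε : ℤˣ) (n : ℤ) (ν : ℂ) (c : ℕ) :
    ‖oddTerm ε n ν c‖ ≤ (c : ℝ) ^ (-ν.re) := by
  unfold oddTerm
  split_ifs with h
  · have hc : 0 < c := h.pos
    rw [norm_mul, Complex.norm_natCast_cpow_of_pos hc]
    calc _ ≤ (c : ℝ) * (c : ℝ) ^ (-ν - 1).re := by gcongr; exact norm_oddSum_le ε n c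
      _ = (c : ℝ) ^ (1 + (-ν - 1).re) := by
        rw [Real.rpow_add (by positivity), Real.rpow_one]
      _ = _ := by congr 1; simp
  · rw [norm_zero]
    positivity

theorem summable_norm_oddTerm (ε : ℤˣ) (n : ℤ) {ν : ℂ} (hν : 1 < ν.re) :
    Summable fun c => ‖oddTerm ε n ν c‖ :=
  (Real.summable_nat_rpow.2 (by linarith)).of_nonneg_of_le (fun _ => norm_nonneg _)
    (norm_oddTerm_le ε n ν)

theorem oddTerm_one (ε : ℤˣ) (n : ℤ) (ν : ℂ) : oddTerm ε n ν 1 = 1 := by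
  simp [oddTerm, oddSum_one]

theorem hasProd_oddTerm (ε : ℤˣ) (n : ℤ) {ν : ℂ} (hν : 1 < ν.re) :
    HasProd (fun p : Nat.Primes => ∑' e, oddTerm ε n ν (p ^ e)) (∑' c, oddTerm ε n ν c) :=
  EulerProduct.eulerProduct_hasProd (oddTerm_one ε n ν) (fun h => oddTerm_mul ε n ν h)
    (summable_norm_oddTerm ε n hν) (by simp [oddTerm])

theorem tsum_oddTerm_two (ε : ℤˣ) (n : ℤ) (ν : ℂ) : ∑' e, oddTerm ε n ν (2 ^ e) = 1 := by
  rw [tsum_eq_single 0]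
  · rw [pow_zero, oddTerm_one]
  · intro e he
    rw [oddTerm, if_neg]
    rw [Nat.not_odd_iff_even]
    exact even_two.pow_of_ne_zero he

theorem cpow_half_neg {p : ℕ} (hp : p ≠ 0) :
    ((Real.sqrt p : ℝ) : ℂ) = p * (p : ℂ) ^ (-1 / 2 : ℂ) := by
  have hp' : (p : ℂ) ≠ 0 := Nat.cast_ne_zero.2 hp
  have e : ((Real.sqrt p : ℝ) : ℂ) = (p : ℂ) ^ (1 / 2 : ℂ) := by
    rw [Real.sqrt_eq_rpow, Complex.ofReal_cpow (Nat.cast_nonneg p)]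
    push_cast
    rfl
  rw [e]
  nth_rewrite 2 [← Complex.cpow_one (p : ℂ)]
  rw [← Complex.cpow_add _ _ hp']
  norm_num

theorem natCast_pow_cpow (p k : ℕ) (s : ℂ) : ((p ^ k : ℕ) : ℂ) ^ s = ((p : ℂ) ^ s) ^ k := by
  induction k with
  | zero => simp
  | succ k ih => rw [pow_succ, Nat.cast_mul, Complex.natCast_mul_natCast_cpow, ih, pow_succ]

/-- The local series at an odd prime `p`, where `q = p^{-ν}` and `r = p^{-1/2}`. -/
theorem oddTerm_prime_pow (ε : ℤˣ) (n : ℤ) (ν : ℂ) (p : ℕ) [hp : Fact p.Prime] (h2 : p ≠ 2)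
    (k : ℕ) : oddTerm ε n ν (p ^ (k + 1)) =
      (if ((p ^ k : ℕ) : ℤ) ∣ n then
        if Even k then (jacobiSym ((ε : ℤ) * (n / (p ^ k : ℕ))) p : ℂ) * (p : ℂ) ^ (-1 / 2 : ℂ)
        else (if ((p ^ (k + 1) : ℕ) : ℤ) ∣ n then (1 : ℂ) else 0) - ((p : ℂ) ^ (-1 / 2 : ℂ)) ^ 2
      else 0) * ((p : ℂ) ^ (-ν)) ^ (k + 1) := by
  have hp0 := hp.out.ne_zero
  have hp' : (p : ℂ) ≠ 0 := Nat.cast_ne_zero.2 hp0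
  have hodd : Odd (p ^ (k + 1)) := (hp.out.odd_of_ne_two h2).pow
  have hr : (p : ℂ) * ((p : ℂ) ^ (-1 / 2 : ℂ)) ^ 2 = 1 := by
    rw [← Complex.cpow_nat_mul]
    nth_rewrite 1 [← Complex.cpow_one (p : ℂ)]
    rw [← Complex.cpow_add _ _ hp']
    norm_num
  have hpow : ((p ^ (k + 1) : ℕ) : ℂ) ^ (-ν - 1) * (p : ℂ) ^ (k + 1) =
      ((p : ℂ) ^ (-ν)) ^ (k + 1) := by
    rw [natCast_pow_cpow, ← mul_pow]
    congr 1
    nth_rewrite 2 [← Complex.cpow_one (p : ℂ)]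
    rw [← Complex.cpow_add _ _ hp']
    congr 1
    ring
  rw [oddTerm, if_pos hodd, ← hpow]
  by_cases hk : Even k
  · rw [oddSum_prime_pow_odd ε n p h2 k hk]
    simp only [if_pos hk]
    split_ifs with h
    · rw [cpow_half_neg hp0]
      ring
    · ring
  · rw [oddSum_prime_pow_even ε n p h2 k (Nat.not_even_iff_odd.1 hk)]
    simp only [if_neg hk]
    split_ifs with h h'
    · linear_combination (-((p ^ (k + 1) : ℕ) : ℂ) ^ (-ν - 1) * (p : ℂ) ^ k) * (-hr) 
    · linear_combination (-((p ^ (k + 1) : ℕ) : ℂ) ^ (-ν - 1) * (p : ℂ) ^ k) * (-hr)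
    · ring

theorem pow_dvd_iff_le {n : ℤ} (hn : n ≠ 0) {p : ℕ} (hp : p.Prime) (k : ℕ) :
    ((p ^ k : ℕ) : ℤ) ∣ n ↔ k ≤ n.natAbs.factorization p := by
  rw [Int.natCast_dvd, hp.pow_dvd_iff_le_factorization (Int.natAbs_ne_zero.2 hn)]

/-- A finite geometric identity for the local series of even multiplicity. -/
theorem geom_even (q r : ℂ) (i : ℕ) :
    1 + ∑ j ∈ Finset.range i, (1 - r ^ 2) * q ^ (2 * j + 2) =
      (1 - r ^ 2 * q ^ 2) * (∑ j ∈ Finset.range i, q ^ (2 * j)) + q ^ (2 * i) := by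
  induction i with
  | zero => simp
  | succ i ih =>
    rw [Finset.sum_range_succ, Finset.sum_range_succ, ← add_assoc, ih]
    ring

theorem sum_filter_even (f : ℕ → ℂ) (i : ℕ) :
    ∑ j ∈ Finset.range (2 * i) with Even j, f j = ∑ j ∈ Finset.range i, f (2 * j) := by
  induction i with
  | zero => simp
  | succ i ih =>
    rw [mul_add, mul_one, Finset.sum_range_succ, ← ih, Finset.sum_filter, Finset.sum_filter,
      Finset.sum_range_succ, Finset.sum_range_succ, if_pos (even_two_mul i),
      if_neg (Nat.not_even_iff_odd.2 (odd_two_mul_add_one i)), add_zero]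

theorem sum_filter_even' (f : ℕ → ℂ) (i : ℕ) :
    ∑ j ∈ Finset.range (2 * i + 1) with Even j, f j = ∑ j ∈ Finset.range (i + 1), f (2 * j) := by
  rw [← sum_filter_even, Finset.sum_filter, Finset.sum_filter, mul_add, mul_one,
    Finset.sum_range_succ _ (2 * i + 1), if_neg (Nat.not_even_iff_odd.2 (odd_two_mul_add_one i)),
    add_zero]

theorem sum_range_even_odd (g : ℕ → ℂ) (i : ℕ) :
    ∑ j ∈ Finset.range (2 * i), g j = ∑ j ∈ Finset.range i, (g (2 * j) + g (2 * j + 1)) := by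
  induction i with
  | zero => simp
  | succ i ih =>
    rw [mul_add, mul_one, Finset.sum_range_succ, Finset.sum_range_succ, Finset.sum_range_succ, ih]
    ring

theorem jacobi_self_mul (a : ℤ) {p : ℕ} (hp : p.Prime) : jacobiSym (p * a) p = 0 := by
  rw [jacobiSym.eq_zero_iff]
  refine ⟨hp.ne_zero, fun h => hp.one_lt.ne' ?_⟩
  have : (p : ℤ) ∣ Int.gcd (p * a) p := Int.dvd_coe_gcd (dvd_mul_right _ _) dvd_rfl
  rw [h] at this
  exact Nat.dvd_one.1 (by exact_mod_cast this)

/-- The local identity at an odd prime. -/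
theorem tsum_oddTerm_prime (ε : ℤˣ) {n : ℤ} (hn : n ≠ 0) (ν : ℂ) (p : ℕ) [hp : Fact p.Prime]
    (h2 : p ≠ 2) :
    (∑' e, oddTerm ε n ν (p ^ e)) *
      (1 - (jacobiSym (oddPart ((ε : ℤ) * n)) p : ℂ) * (p : ℂ) ^ (-ν - 1 / 2)) =
      localPoly ((ε : ℤ) * n) p ν * (1 - (p : ℂ) ^ (-(2 * ν + 1))) := by
  have hp0 := hp.out.ne_zero
  have hp' : (p : ℂ) ≠ 0 := Nat.cast_ne_zero.2 hp0
  set m := (ε : ℤ) * n with hm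
  have hm0 : m ≠ 0 := mul_ne_zero (Units.ne_zero ε) hn
  have habs : m.natAbs = n.natAbs := by rw [hm, Int.natAbs_mul, Int.natAbs_of_isUnit ε.isUnit, one_mul]
  set q := (p : ℂ) ^ (-ν) with hq
  set r := (p : ℂ) ^ (-1 / 2 : ℂ) with hr
  have hrq : (p : ℂ) ^ (-ν - 1 / 2) = r * q := by
    rw [hr, hq, ← Complex.cpow_add _ _ hp']
    congr 1
    ring
  have hrq2 : (p : ℂ) ^ (-(2 * ν + 1)) = r ^ 2 * q ^ 2 := by
    rw [← mul_pow, ← hrq, ← Complex.cpow_nat_mul]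
    congr 1
    push_cast
    ring
  have hqj : ∀ j : ℕ, (p : ℂ) ^ (-(j : ℂ) * ν) = q ^ j := by
    intro j
    rw [hq, ← Complex.cpow_nat_mul]
    congr 1
    ring
  set e := n.natAbs.factorization p with he
  set g : ℕ → ℂ := fun k => oddTerm ε n ν (p ^ (k + 1)) with hg
  -- The sum of modulus p^(k+1) vanishes unless p^k ∣ n, so k = e is the last index.
  have hsupp : ∀ k, k ∉ Finset.range (e + 1) → g k = 0 := by
    intro k hk
    rw [Finset.mem_range, not_lt] at hk
    rw [hg]
    simp only
    rw [oddTerm_prime_pow ε n ν p h2, if_neg, zero_mul]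
    rw [pow_dvd_iff_le hn hp.out]
    omega
  have htsum : ∑' e, oddTerm ε n ν (p ^ e) = 1 + ∑ k ∈ Finset.range (e + 1), g k := by
    have hs : HasSum g _ := hasSum_sum_of_ne_finset_zero hsupp
    have := ((hasSum_nat_add_iff (f := fun e => oddTerm ε n ν (p ^ e)) 1).1 hs).tsum_eq
    rw [this]
    simp [oddTerm_one]
    ring
  have hgodd : ∀ j, 2 * j + 2 ≤ e → g (2 * j + 1) = (1 - r ^ 2) * q ^ (2 * j + 2) := by
    intro j hj
    rw [hg]
    simp only
    rw [oddTerm_prime_pow ε n ν p h2, if_pos ((pow_dvd_iff_le hn hp.out _).2 (by omega)),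
      if_neg (Nat.not_even_iff_odd.2 (odd_two_mul_add_one j)),
      if_pos ((pow_dvd_iff_le hn hp.out _).2 (by omega))]
  -- Here p still divides n / p^(2j), so the residue symbol vanishes.
  have hgeven : ∀ j, 2 * j + 1 ≤ e → g (2 * j) = 0 := by
    intro j hj
    rw [hg]
    simp only
    obtain ⟨v, hv⟩ := (pow_dvd_iff_le hn hp.out (2 * j + 1)).2 hj
    have hv' : n = (p ^ (2 * j) : ℕ) * (p * v) := by rw [hv]; push_cast; ring
    have hdiv : n / (p ^ (2 * j) : ℕ) = p * v := by
      conv_lhs => enter [1]; rw [hv']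
      exact Int.mul_ediv_cancel_left _ (Int.natCast_ne_zero.2 (pow_ne_zero _ hp0))
    rw [oddTerm_prime_pow ε n ν p h2, if_pos ((pow_dvd_iff_le hn hp.out _).2 (by omega)),
      if_pos (even_two_mul j), hdiv, mul_left_comm, jacobi_self_mul _ hp.out]
    simp
  have hpairs : ∀ i, 2 * i ≤ e → ∑ k ∈ Finset.range (2 * i), g k =
      ∑ j ∈ Finset.range i, (1 - r ^ 2) * q ^ (2 * j + 2) := by
    intro i hi
    rw [sum_range_even_odd]
    refine Finset.sum_congr rfl fun j hj => ?_
    rw [Finset.mem_range] at hj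
    rw [hgeven j (by omega), hgodd j (by omega), zero_add]
  rw [htsum, localPoly, habs, ← he, hrq, hrq2]
  simp only [hqj]
  -- For even e the last term carries J = (t/p) with J² = 1, and q^e (1 + J r q)(1 - J r q) = q^e (1
  -- - r² q²) brings out the factor of ζ. For odd e the symbol J is 0 and the last term -r² q^(e+1)
  -- completes the geometric sum.
  rcases Nat.even_or_odd' e with ⟨i, hi | hi⟩
  · have hlast : g e = (jacobiSym (oddPart m) p : ℂ) * r * q ^ (e + 1) := by
      have hE : Even e := hi ▸ even_two_mul i
      have hJ : (ε : ℤ) * (n / (p ^ e : ℕ)) = m / (p ^ e : ℕ) :=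
        (Int.mul_ediv_assoc _ ((pow_dvd_iff_le hn hp.out e).2 le_rfl)).symm
      have hJ2 := jacobi_oddPart hm0 hp.out (by rw [habs]; exact hE)
      rw [habs, ← he] at hJ2
      rw [hg]
      simp only
      rw [oddTerm_prime_pow ε n ν p h2, if_pos ((pow_dvd_iff_le hn hp.out e).2 le_rfl), if_pos hE,
        hJ, hJ2]
    have hJsq : (jacobiSym (oddPart m) p : ℂ) ^ 2 = 1 := by
      have hnd : ¬ p ∣ (oddPart m).natAbs := by
        intro hd
        have h1 := (hp.out.dvd_iff_one_le_factorization
          (Int.natAbs_ne_zero.2 (oddPart_ne_zero hm0))).1 hd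
        rw [factorization_oddPart hm0, habs, ← he,
          if_neg (Nat.not_odd_iff_even.2 (hi ▸ even_two_mul i))] at h1
        omega
      have hg1 : Int.gcd (oddPart m) p = 1 :=
        ((Nat.Prime.coprime_iff_not_dvd hp.out).2 hnd).symm
      exact_mod_cast jacobiSym.sq_one hg1
    have hfil : ∑ j ∈ Finset.range (2 * i - 1) with Even j, q ^ j =
        ∑ j ∈ Finset.range i, q ^ (2 * j) := by
      cases i with
      | zero => simp
      | succ i => exact sum_filter_even' (fun j => q ^ j) i
    rw [Finset.sum_range_succ, hlast, if_pos (hi ▸ even_two_mul i), hi, hpairs i hi.ge, hfil,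
      ← add_assoc, geom_even]
    linear_combination (-(r ^ 2 * q ^ 2 * q ^ (2 * i))) * hJsq
  · have hlast : g e = -(r ^ 2 * q ^ (e + 1)) := by
      rw [hg]
      simp only
      rw [oddTerm_prime_pow ε n ν p h2, if_pos ((pow_dvd_iff_le hn hp.out e).2 le_rfl),
        if_neg (Nat.not_even_iff_odd.2 (hi ▸ odd_two_mul_add_one i)),
        if_neg (fun h => absurd ((pow_dvd_iff_le hn hp.out (e + 1)).1 h) (by omega))]
      ring
    have hJ0 : jacobiSym (oddPart m) p = 0 := by
      have hd : p ∣ (oddPart m).natAbs := by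
        rw [hp.out.dvd_iff_one_le_factorization (Int.natAbs_ne_zero.2 (oddPart_ne_zero hm0)),
          factorization_oddPart hm0, habs, ← he, if_pos (hi ▸ odd_two_mul_add_one i)]
        omega
      obtain ⟨v, hv⟩ := Int.natCast_dvd.2 hd
      rw [hv]
      exact jacobi_self_mul v hp.out
    rw [Finset.sum_range_succ, hlast, hJ0,
      if_neg (Nat.not_even_iff_odd.2 (hi ▸ odd_two_mul_add_one i)), hi, Finset.sum_range_succ,
      hgeven i hi.ge, hpairs i (by omega), sum_filter_even' (fun j => q ^ j) i,
      Finset.sum_range_succ]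
    have := geom_even q r i
    push_cast
    linear_combination this

/-- For an odd prime outside of `m`, the local factor is `1`. -/
theorem localPoly_of_not_dvd {m : ℤ} {p : ℕ} (h : ¬ p ∣ m.natAbs) (ν : ℂ) :
    localPoly m p ν = 1 := by
  rw [localPoly, Nat.factorization_eq_zero_of_not_dvd h]
  simp

theorem norm_prime_cpow_lt (p : Nat.Primes) {s : ℂ} (hs : 0 < s.re) :
    ‖((p : ℕ) : ℂ) ^ (-s)‖ < 1 := by
  rw [Complex.norm_natCast_cpow_of_pos p.prop.pos]
  exact Real.rpow_lt_one_of_one_lt_of_neg (by exact_mod_cast p.prop.one_lt) (by simpa using hs)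

theorem one_sub_ne_zero_of_norm_lt {z : ℂ} (h : ‖z‖ < 1) : 1 - z ≠ 0 := by
  intro h0
  rw [← sub_eq_zero.1 h0] at h
  simp at h

/-- The Dirichlet series over the odd moduli. -/
theorem zeta2_mul_tsum_oddTerm (ε : ℤˣ) {n : ℤ} (hn : n ≠ 0)
    [NeZero (oddPart ((ε : ℤ) * n)).natAbs] {ν : ℂ} (hν : 1 < ν.re) :
    zeta2 (2 * ν + 1) * ∑' c, oddTerm ε n ν c = oddPoly ((ε : ℤ) * n) ν *
      LSeries (fun d : ℕ => jacobiChar (oddPart ((ε : ℤ) * n)) d) (ν + 1 / 2) := by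
  set m := (ε : ℤ) * n with hm
  set t := oddPart m with ht
  have hm0 : m ≠ 0 := mul_ne_zero (Units.ne_zero ε) hn
  have hw : 1 < (ν + 1 / 2).re := by simp; linarith
  have hs : 1 < (2 * ν + 1).re := by simp; linarith
  have A := (hasProd_oddTerm ε n hν).mul (riemannZeta_eulerProduct_hasProd hs)
  have B := DirichletCharacter.LSeries_eulerProduct_hasProd (jacobiChar t) hw
  have hne1 : ∀ p : Nat.Primes, 1 - ((p : ℕ) : ℂ) ^ (-(2 * ν + 1)) ≠ 0 := fun p =>
    one_sub_ne_zero_of_norm_lt (norm_prime_cpow_lt p (by linarith))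
  have hne2 : ∀ p : Nat.Primes, 1 - jacobiChar t (p : ℕ) * ((p : ℕ) : ℂ) ^ (-(ν + 1 / 2)) ≠ 0 := by
    intro p
    apply one_sub_ne_zero_of_norm_lt
    rw [norm_mul]
    calc _ ≤ 1 * ‖((p : ℕ) : ℂ) ^ (-(ν + 1 / 2))‖ := by
          gcongr
          exact DirichletCharacter.norm_le_one _ _
      _ < 1 := by rw [one_mul]; exact norm_prime_cpow_lt p (by linarith)
  let S : Finset ℕ := insert 2 (m.natAbs.primeFactors.erase 2)
  -- The quotient of the Euler products, which can differ from 1 only at 2 and at the primes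
  -- dividing m. At 2 the odd moduli and the character both contribute 1, leaving the factor of
  -- ζ(2ν+1) that ζ₂ removes.
  let C : ℕ → ℂ := fun p => if p = 2 then (1 - (2 : ℂ) ^ (-(2 * ν + 1)))⁻¹ else localPoly m p ν
  have hC : HasProd (fun p : Nat.Primes => C p) (∏ p ∈ S.subtype Nat.Prime, C (p : ℕ)) := by
    refine hasProd_prod_of_ne_finset_one fun p hp => ?_
    have hpS : ¬ ((p : ℕ) ∈ S) := fun h => hp (Finset.mem_subtype.2 h)
    simp only [S, Finset.mem_insert, not_or, Finset.mem_erase, not_and,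
      Nat.mem_primeFactors] at hpS
    simp only [C, if_neg hpS.1]
    exact localPoly_of_not_dvd (fun hd => hpS.2 hpS.1 p.prop hd (Int.natAbs_ne_zero.2 hm0)) ν
  have hprodC : ∏ p ∈ S.subtype Nat.Prime, C (p : ℕ) =
      (1 - (2 : ℂ) ^ (-(2 * ν + 1)))⁻¹ * oddPoly m ν := by
    rw [Finset.prod_subtype_of_mem C, Finset.prod_insert (by simp), oddPoly]
    · congr 1
      exact Finset.prod_congr rfl fun p hp => if_neg (Finset.ne_of_mem_erase hp)
    · intro p hp
      rcases Finset.mem_insert.1 hp with rfl | hp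
      · exact Nat.prime_two
      · exact Nat.prime_of_mem_primeFactors (Finset.mem_of_mem_erase hp)
  have hfac : ∀ p : Nat.Primes, (∑' e, oddTerm ε n ν ((p : ℕ) ^ e)) *
      (1 - ((p : ℕ) : ℂ) ^ (-(2 * ν + 1)))⁻¹ =
      (1 - jacobiChar t (p : ℕ) * ((p : ℕ) : ℂ) ^ (-(ν + 1 / 2)))⁻¹ * C p := by
    rintro ⟨p, hp⟩
    have h1 := hne1 ⟨p, hp⟩
    have h2 := hne2 ⟨p, hp⟩
    simp only [C] at h1 h2 ⊢
    by_cases hp2 : p = 2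
    · subst hp2
      rw [tsum_oddTerm_two, if_pos rfl, jacobiChar_natCast, if_neg (by decide)]
      simp
    · have : Fact p.Prime := ⟨hp⟩
      have key := tsum_oddTerm_prime ε hn ν p hp2
      rw [jacobiChar_natCast, if_pos (hp.odd_of_ne_two hp2), neg_add' ν (1 / 2)] at h2 ⊢
      rw [if_neg hp2, ← div_eq_mul_inv, mul_comm _ (localPoly m p ν), ← div_eq_mul_inv,
        div_eq_div_iff h1 h2]
      exact key
  simp only [hfac] at A
  have hu := A.unique (B.mul hC)
  rw [hprodC] at hu
  have h2 := hne1 ⟨2, Nat.prime_two⟩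
  simp only [Nat.cast_ofNat] at h2
  rw [zeta2, mul_assoc, mul_comm (riemannZeta _), hu, mul_left_comm, mul_inv_cancel_left₀ h2,
    mul_comm]

/-! ### The Dirichlet series of the exponential sums -/

/-- The term of modulus `c` in the Fourier coefficient. -/
def eisDirichletTerm (ε : ℤˣ) (n : ℤ) (ν : ℂ) (c : ℕ) : ℂ :=
  if c ≠ 0 ∧ 4 ∣ c then eisSum ε n c * (c : ℂ) ^ (-ν - 1) else 0

/-- The parametrization of the positive multiples of `4`. -/
def twoPowMulOdd (p : ℕ × ℕ) : ℕ := 2 ^ (p.1 + 2) * (2 * p.2 + 1)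

theorem twoPowMulOdd_injective : Function.Injective twoPowMulOdd := by
  have key : ∀ k j : ℕ, (2 ^ (k + 2) * (2 * j + 1)).factorization 2 = k + 2 := by
    intro k j
    rw [Nat.factorization_mul (by positivity) (by omega), Finsupp.add_apply,
      Nat.Prime.factorization_pow Nat.prime_two, Finsupp.single_eq_same,
      Nat.factorization_eq_zero_of_not_dvd (by omega), add_zero]
  rintro ⟨k, j⟩ ⟨k', j'⟩ h
  simp only [twoPowMulOdd] at h
  have hk : k + 2 = k' + 2 := by rw [← key k j, h, key]
  rw [hk] at h
  have := Nat.eq_of_mul_eq_mul_left (by positivity) h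
  rw [Prod.mk.injEq]
  omega

theorem eisDirichletTerm_of_not_mem (ε : ℤˣ) (n : ℤ) (ν : ℂ) (c : ℕ)
    (hc : c ∉ Set.range twoPowMulOdd) : eisDirichletTerm ε n ν c = 0 := by
  rw [eisDirichletTerm, if_neg]
  rintro ⟨h0, h4⟩
  obtain ⟨k, c', hk, ⟨j, hj⟩, hc'⟩ := exists_two_pow_mul_odd h0 h4
  refine hc ⟨(k - 2, j), ?_⟩
  rw [twoPowMulOdd, Nat.sub_add_cancel hk, hc', hj]

theorem eisDirichletTerm_twoPowMulOdd (ε : ℤˣ) (n : ℤ) (ν : ℂ) (p : ℕ × ℕ) :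
    eisDirichletTerm ε n ν (twoPowMulOdd p) =
      twoSum ε n (p.1 + 2) * ((2 : ℂ) ^ (p.1 + 2)) ^ (-ν - 1) * oddTerm ε n ν (2 * p.2 + 1) := by
  obtain ⟨k, j⟩ := p
  have hodd : Odd (2 * j + 1) := odd_two_mul_add_one j
  have h4 : 4 ∣ 2 ^ (k + 2) * (2 * j + 1) :=
    Dvd.dvd.mul_right (by rw [pow_add]; exact dvd_mul_left _ _) _
  have h0 : 2 ^ (k + 2) * (2 * j + 1) ≠ 0 := by positivity
  rw [twoPowMulOdd, eisDirichletTerm, if_pos ⟨h0, h4⟩, eisSum_two_pow_mul ε n (by omega) hodd,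
    oddTerm, if_pos hodd, Nat.cast_mul, Complex.natCast_mul_natCast_cpow, Nat.cast_pow,
    Nat.cast_ofNat]
  ring

theorem hasSum_oddTerm_odd (ε : ℤˣ) (n : ℤ) {ν : ℂ} (hν : 1 < ν.re) :
    HasSum (fun j : ℕ => oddTerm ε n ν (2 * j + 1)) (∑' c, oddTerm ε n ν c) := by
  have hinj : Function.Injective fun j : ℕ => 2 * j + 1 := fun a b h => by simpa using h
  have hz : ∀ c ∉ Set.range (fun j : ℕ => 2 * j + 1), oddTerm ε n ν c = 0 := by
    intro c hc
    rw [oddTerm, if_neg]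
    rintro ⟨j, hj⟩
    exact hc ⟨j, hj.symm⟩
  exact (Function.Injective.hasSum_iff (f := oddTerm ε n ν) hinj hz).2
    (summable_norm_oddTerm ε n hν).of_norm.hasSum

theorem hasSum_of_factor_comp {A B f : ℕ → ℂ} {g : ℕ × ℕ → ℕ} {a b : ℂ} (hA : HasSum A a)
    (hB : HasSum B b) (hg : Function.Injective g) (hf : ∀ c ∉ Set.range g, f c = 0)
    (hfg : ∀ p, f (g p) = A p.1 * B p.2) : HasSum f (a * b) := by
  refine (hg.hasSum_iff hf).1 ?_
  have h := hA.mul hB (summable_mul_of_summable_norm hA.summable.norm hB.summable.norm)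
  exact (funext hfg : f ∘ g = _) ▸ h

theorem hasSum_eisDirichletTerm (ε : ℤˣ) {n : ℤ} (hn : n ≠ 0) {ν : ℂ} (hν : 1 < ν.re) :
    HasSum (eisDirichletTerm ε n ν) (cCoeff ε n ν * ∑' c, oddTerm ε n ν c) :=
  hasSum_of_factor_comp (hasSum_twoSum ε hn ν) (hasSum_oddTerm_odd ε n hν)
    twoPowMulOdd_injective (eisDirichletTerm_of_not_mem ε n ν)
    (eisDirichletTerm_twoPowMulOdd ε n ν)

/-- The Fourier coefficient as a Dirichlet series. -/
theorem zeta2_mul_tsum_eisDirichletTerm (ε : ℤˣ) {n : ℤ} (hn : n ≠ 0)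
    [NeZero (oddPart ((ε : ℤ) * n)).natAbs] {ν : ℂ} (hν : 1 < ν.re) :
    zeta2 (2 * ν + 1) * ∑' c, eisDirichletTerm ε n ν c =
      cCoeff ε n ν * (oddPoly ((ε : ℤ) * n) ν *
        LSeries (fun d : ℕ => jacobiChar (oddPart ((ε : ℤ) * n)) d) (ν + 1 / 2)) := by
  rw [(hasSum_eisDirichletTerm ε hn hν).tsum_eq, ← zeta2_mul_tsum_oddTerm ε hn hν]
  ring

/-! ### Values of elements of the principal series -/

theorem exists_decomposition (g : Mp) (hd : g.mat 1 1 ≠ 0) : ∃ κ : ℤˣ,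
    g = nEl (g.mat 0 1 / g.mat 1 1) * (mEl (sgnU (g.mat 1 1)) κ *
      aEl |g.mat 1 1|⁻¹ (inv_pos.2 (abs_pos.2 hd)) * nmEl (g.mat 1 0 / g.mat 1 1)) := by
  have hdet := det_entry g.mat
  have hs : ((sgnU (g.mat 1 1) : ℤ) : ℝ) * |g.mat 1 1| = g.mat 1 1 := by
    unfold sgnU
    split_ifs with h
    · simp [abs_of_neg h]
    · simp [abs_of_nonneg (not_lt.1 h)]
  have hs' : ((sgnU (g.mat 1 1) : ℤ) : ℝ) * |g.mat 1 1|⁻¹ = (g.mat 1 1)⁻¹ := by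
    unfold sgnU
    split_ifs with h
    · simp [abs_of_neg h]
    · simp [abs_of_nonneg (not_lt.1 h)]
  have hmat : ∀ κ : ℤˣ, (nEl (g.mat 0 1 / g.mat 1 1) * (mEl (sgnU (g.mat 1 1)) κ *
      aEl |g.mat 1 1|⁻¹ (inv_pos.2 (abs_pos.2 hd)) * nmEl (g.mat 1 0 / g.mat 1 1))).mat =
      g.mat := by
    intro κ
    ext i j
    simp only [mul_mat, mul_entry]
    fin_cases i <;> fin_cases j <;> simp [nEl, mEl, aEl, nmEl, hs, hs']
    · field_simp
      linear_combination -hdet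
    · field_simp
    · field_simp
  set h : ℤˣ → Mp := fun κ => nEl (g.mat 0 1 / g.mat 1 1) * (mEl (sgnU (g.mat 1 1)) κ *
      aEl |g.mat 1 1|⁻¹ (inv_pos.2 (abs_pos.2 hd)) * nmEl (g.mat 1 0 / g.mat 1 1)) with hh
  have hm1 : ∀ κ : ℤˣ, (mEl (sgnU (g.mat 1 1)) κ).mat = (mEl (sgnU (g.mat 1 1)) 1).mat :=
    fun κ => rfl
  have hm2 : ∀ κ : ℤˣ, (mEl (sgnU (g.mat 1 1)) κ).sgn = κ := fun κ => rfl
  -- The sign of the product is proportional to κ, so κ can be adjusted to g without evaluating a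
  -- cocycle.
  have hlin : ∀ κ : ℤˣ, (h κ).sgn = (h 1).sgn * κ := by
    intro κ
    simp only [hh, mul_sgn, mul_mat, hm1 κ, hm2, mul_one]
    ac_rfl
  refine ⟨(h 1).sgn * g.sgn, ?_⟩
  change g = h ((h 1).sgn * g.sgn)
  refine Mp.ext (hmat _).symm ?_
  rw [hlin, ← mul_assoc, Int.units_mul_self, one_mul]

/-- Both f and the extension of the constant 1 transform by the same character, so its value,
including the sign, can be read off from `extFun` without knowing κ. Only the transformation law is
used; the constant 1 need not have compact support. -/
theorem smooth_apply {ε : ℤˣ} {ν : ℂ} (f : Smooth ε ν) (g : Mp) (hd : g.mat 1 1 ≠ 0) :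
    f.1 g = extFun ε ν (fun _ => 1) g * f.1 (nEl (g.mat 0 1 / g.mat 1 1)) := by
  obtain ⟨κ, hκ⟩ := exists_decomposition g hd
  have h1 := f.2.2 (nEl (g.mat 0 1 / g.mat 1 1)) (sgnU (g.mat 1 1)) κ _
    (inv_pos.2 (abs_pos.2 hd)) (g.mat 1 0 / g.mat 1 1)
  have h2 := extFun_transform ε ν (fun _ => 1) (nEl (g.mat 0 1 / g.mat 1 1)) (sgnU (g.mat 1 1)) κ _
    (inv_pos.2 (abs_pos.2 hd)) (g.mat 1 0 / g.mat 1 1)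
  rw [← hκ] at h1 h2
  rw [h1, h2, extFun_nEl, mul_one]

theorem norm_sigmaChar (ε e₁ e₂ : ℤˣ) : ‖sigmaChar ε e₁ e₂‖ = 1 := by
  unfold sigmaChar
  rcases Int.units_eq_one_or ε with rfl | rfl <;> rcases Int.units_eq_one_or e₂ with rfl | rfl <;>
    split_ifs <;> simp

theorem norm_extFun_one (ε : ℤˣ) (ν : ℂ) (g : Mp) (hd : g.mat 1 1 ≠ 0) :
    ‖extFun ε ν (fun _ => 1) g‖ = |g.mat 1 1| ^ (ν.re - 1) := by
  have h0 : 0 < |g.mat 1 1| := abs_pos.2 hd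
  rw [extFun, if_neg hd, mul_one, norm_inv, omegaChar, norm_mul, norm_sigmaChar, one_mul,
    Complex.norm_cpow_eq_rpow_re_of_pos (inv_pos.2 h0), Real.inv_rpow h0.le, inv_inv,
    Complex.sub_re, Complex.one_re]

theorem mEl_one_one : mEl 1 1 = 1 := by
  ext1
  · ext i j; fin_cases i <;> fin_cases j <;> simp [mEl]
  · rfl

theorem aEl_one : aEl 1 one_pos = 1 := by
  ext1
  · ext i j; fin_cases i <;> fin_cases j <;> simp [aEl]
  · rfl

theorem nmEl_zero : nmEl 0 = 1 := by
  ext1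
  · ext i j; fin_cases i <;> fin_cases j <;> simp [nmEl]
  · rfl

theorem smooth_mul_nmEl {ε : ℤˣ} {ν : ℂ} (f : Smooth ε ν) (g : Mp) (y : ℝ) :
    f.1 (g * nmEl y) = f.1 g := by
  have h := f.2.2 g 1 1 1 one_pos y
  rw [mEl_one_one, aEl_one, one_mul, one_mul] at h
  rw [h]
  simp [omegaChar, sigmaChar]

theorem continuous_smooth_nEl {ε : ℤˣ} {ν : ℂ} (f : Smooth ε ν) (g : Mp) :
    Continuous fun x : ℝ => f.1 (g * nEl x) := by
  have h := (f.2.1 g).continuous.comp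
    (by fun_prop : Continuous fun x : ℝ => ((x, 0, 0) : ℝ × ℝ × ℝ))
  refine h.congr fun x => ?_
  have e : aEl (Real.exp 0) (Real.exp_pos _) = 1 := by
    rw [← aEl_one]
    congr 1
    exact Real.exp_zero
  simp only [Function.comp, nmEl_zero, mul_one, e]

theorem sEl_mat_mul (g : Mp) : (sEl * g).mat 0 1 = -g.mat 1 1 ∧ (sEl * g).mat 1 1 = g.mat 0 1 := by
  constructor <;> rw [mul_mat, mul_entry] <;> simp [sEl]

theorem exists_bound_smooth {ε : ℤˣ} {ν : ℂ} (f : Smooth ε ν) : ∃ B : ℝ, ∀ x : ℝ, |x| ≤ 1 →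
    ‖f.1 (nEl x)‖ ≤ B ∧ ‖f.1 (sEl⁻¹ * nEl x)‖ ≤ B := by
  have h1 := continuous_smooth_nEl f 1
  have h2 := continuous_smooth_nEl f sEl⁻¹
  simp only [one_mul] at h1
  obtain ⟨B₁, hB₁⟩ := (isCompact_Icc (a := (-1 : ℝ)) (b := 1)).exists_bound_of_continuousOn
    h1.continuousOn
  obtain ⟨B₂, hB₂⟩ := (isCompact_Icc (a := (-1 : ℝ)) (b := 1)).exists_bound_of_continuousOn
    h2.continuousOn
  exact ⟨max B₁ B₂, fun x hx => ⟨(hB₁ x (abs_le.1 hx)).trans (le_max_left _ _),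
    (hB₂ x (abs_le.1 hx)).trans (le_max_right _ _)⟩⟩

/-- The second column (b, d) selects the chart: for |b| ≤ |d| the point b/d lies in [-1, 1], and
otherwise s̃ exchanges the two entries up to sign. The character contributes the power of the larger
entry. -/
theorem norm_smooth_le {ε : ℤˣ} {ν : ℂ} (f : Smooth ε ν) {B : ℝ}
    (hB : ∀ x : ℝ, |x| ≤ 1 → ‖f.1 (nEl x)‖ ≤ B ∧ ‖f.1 (sEl⁻¹ * nEl x)‖ ≤ B) (g : Mp) :
    ‖f.1 g‖ ≤ max |g.mat 0 1| |g.mat 1 1| ^ (ν.re - 1) * B := by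
  have hdet := det_entry g.mat
  rcases le_or_gt |g.mat 0 1| |g.mat 1 1| with h | h
  · have hd : g.mat 1 1 ≠ 0 := by
      intro h0
      rw [h0, abs_zero] at h
      have := abs_nonpos_iff.1 h
      rw [h0, this] at hdet
      simp at hdet
    rw [smooth_apply f g hd, norm_mul, norm_extFun_one ε ν g hd, max_eq_right h]
    refine mul_le_mul_of_nonneg_left (hB _ ?_).1 (Real.rpow_nonneg (abs_nonneg _) _)
    rw [abs_div]
    exact div_le_one_of_le₀ h (abs_nonneg _)
  · obtain ⟨e0, e1⟩ := sEl_mat_mul g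
    have hb : (sEl * g).mat 1 1 ≠ 0 := by
      rw [e1]
      intro h0
      rw [h0, abs_zero] at h
      exact h.not_ge (abs_nonneg _)
    have key : f.1 g = (smoothAct ε ν sEl f).1 (sEl * g) := by
      change f.1 g = f.1 (sEl⁻¹ * (sEl * g))
      rw [inv_mul_cancel_left]
    rw [key, smooth_apply _ _ hb, norm_mul, norm_extFun_one ε ν _ hb, e1, max_eq_left h.le]
    refine mul_le_mul_of_nonneg_left ?_ (Real.rpow_nonneg (abs_nonneg _) _)
    refine (hB _ ?_).2
    rw [e0, abs_div, abs_neg]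
    exact div_le_one_of_le₀ h.le (abs_nonneg _)

theorem mul_sEl_mat (g : Mp) : (g * sEl).mat 0 1 = -g.mat 0 0 ∧ (g * sEl).mat 1 1 = -g.mat 1 0 ∧
    (g * sEl).mat 1 0 = g.mat 1 1 := by
  refine ⟨?_, ?_, ?_⟩ <;> rw [mul_mat, mul_entry] <;> simp [sEl]

/-- The sign of d enters both the cocycle and the Hilbert symbol and drops out of their product. -/
theorem mul_sEl_sgn (g : Mp) (hc : g.mat 1 0 ≠ 0) (hd : g.mat 1 1 ≠ 0) :
    (g * sEl).sgn * hilbert (-g.mat 1 1) (-g.mat 1 0) =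
      g.sgn * (if g.mat 1 0 < 0 then 1 else -1) := by
  have hX : kubotaX (g.mat * sEl.mat) = g.mat 1 1 := by
    have e := (mul_sEl_mat g).2.2
    rw [mul_mat] at e
    rw [kubotaX_of_ne (by rw [e]; exact hd), e]
  have hs : kubotaX sEl.mat = 1 := by simp [kubotaX, sEl]
  have hs1 : sEl.sgn = 1 := rfl
  rw [mul_sgn, cocycle, hX, hs, kubotaX_of_ne hc, hs1, mul_one, div_one, mul_comm (hilbert _ _),
    mul_assoc]
  congr 1
  simp only [hilbert, div_neg_iff_xor hd hc]
  rcases sign_cases (g.mat 1 0) with ⟨h1, h1', h1''⟩ | ⟨h1, h1', h1''⟩ | ⟨h1, h1', h1''⟩ <;>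
    rcases sign_cases (g.mat 1 1) with ⟨h3, h3', h3''⟩ | ⟨h3, h3', h3''⟩ | ⟨h3, h3', h3''⟩ <;>
    first | exact absurd h1'' hc | exact absurd h3'' hd | simp [h1, h3, h1', h3']

/-- The value at `γ s̃`, in terms of the first column of `γ`. -/
theorem smooth_mul_sEl {ε : ℤˣ} {ν : ℂ} (f : Smooth (-ε) (-ν)) (g : Mp) (hc : g.mat 1 0 ≠ 0)
    (hd : g.mat 1 1 ≠ 0) :
    f.1 (g * sEl) = ((g.sgn : ℤ) : ℂ) * (if g.mat 1 0 < 0 then 1 else (ε : ℤ) * Complex.I) *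
      ((|g.mat 1 0| : ℝ) : ℂ) ^ (-ν - 1) * f.1 (nEl (g.mat 0 0 / g.mat 1 0)) := by
  obtain ⟨e0, e1, e2⟩ := mul_sEl_mat g
  have h0 : 0 < |g.mat 1 0| := abs_pos.2 hc
  rw [smooth_apply f _ (by rw [e1]; exact neg_ne_zero.2 hc), e0, e1, neg_div_neg_eq]
  congr 1
  rw [extFun, e1, e2, if_neg (neg_ne_zero.2 hc), mul_sEl_sgn g hc hd, abs_neg, omegaChar,
    mul_inv, mul_one]
  congr 1
  · rcases sign_cases (g.mat 1 0) with ⟨h1, h1', h1''⟩ | ⟨h1, h1', h1''⟩ | ⟨h1, h1', h1''⟩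
    · simp only [sigmaChar, sgnU, neg_lt_zero, h1, h1', if_true, if_false, mul_one]
      rcases Int.units_eq_one_or g.sgn with h | h <;> simp [h]
    · exact absurd h1'' hc
    · simp only [sigmaChar, sgnU, neg_lt_zero, h1, h1', if_true, if_false]
      rw [if_neg (by decide)]
      rcases Int.units_eq_one_or g.sgn with h | h <;>
        rcases Int.units_eq_one_or ε with h' | h' <;> simp [h, h']
  · rw [Complex.ofReal_inv, Complex.inv_cpow, inv_inv]
    rw [Complex.arg_ofReal_of_nonneg h0.le]
    exact Real.pi_pos.ne

/-! ### The cosets -/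

/-- Passing s̃ turns upper into lower unipotents, under which elements of the principal series are
right invariant. Hence the value at γ s̃ depends only on the coset of γ. -/
theorem nEl_mul_sEl (x : ℝ) : nEl x * sEl = sEl * nmEl (-x) := by
  have hm : (nEl x).mat * sEl.mat = sEl.mat * (nmEl (-x)).mat := by
    ext i j
    simp only [mul_entry]
    fin_cases i <;> fin_cases j <;> simp [nEl, sEl, nmEl]
  have h10 : (sEl.mat * (nmEl (-x)).mat) 1 0 = 1 := by rw [mul_entry]; simp [sEl, nmEl]
  have hX : kubotaX (sEl.mat * (nmEl (-x)).mat) = 1 := by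
    rw [kubotaX_of_ne (by rw [h10]; exact one_ne_zero), h10]
  have h1 : kubotaX (nEl x).mat = 1 := by simp [kubotaX, nEl]
  have h2 : kubotaX sEl.mat = 1 := by simp [kubotaX, sEl]
  have s1 : (nEl x).sgn = 1 := rfl
  have s2 : sEl.sgn = 1 := rfl
  have s3 : (nmEl (-x)).sgn = 1 := rfl
  refine Mp.ext hm ?_
  rw [mul_sgn, mul_sgn, cocycle, cocycle, hm, hX, h1, h2, s1, s2, s3]
  simp [hilbert, not_lt.2 (zero_le_one' ℝ)]

theorem mul_nEl_entries (g : Mp) (x : ℝ) : (g * nEl x).mat 0 0 = g.mat 0 0 ∧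
    (g * nEl x).mat 0 1 = g.mat 0 0 * x + g.mat 0 1 ∧ (g * nEl x).mat 1 0 = g.mat 1 0 ∧
    (g * nEl x).mat 1 1 = g.mat 1 0 * x + g.mat 1 1 := by
  refine ⟨?_, ?_, ?_, ?_⟩ <;> rw [mul_mat, mul_entry] <;> simp [nEl]

theorem mul_nEl_sgn (g : Mp) (x : ℝ) : (g * nEl x).sgn = g.sgn := by
  obtain ⟨-, -, e10, e11⟩ := mul_nEl_entries g x
  have hX : kubotaX (g.mat * (nEl x).mat) = kubotaX g.mat := by
    by_cases h : g.mat 1 0 = 0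
    · rw [kubotaX_of_eq h, kubotaX_of_eq (by rw [← mul_mat, e10, h]), ← mul_mat, e11, h]; simp
    · rw [kubotaX_of_ne h, kubotaX_of_ne (by rw [← mul_mat, e10]; exact h), ← mul_mat, e10]
  have h1 : (nEl x).sgn = 1 := rfl
  rw [mul_sgn, h1, cocycle, hX, div_self (kubotaX_ne_zero _)]
  simp [hilbert, not_lt.2 (zero_le_one' ℝ)]

theorem eisTerm_apply (ε : ℤˣ) (ν : ℂ) (q : Cosets) {g : Mp}
    (hg : (QuotientGroup.mk g : Mp ⧸ GammaInf) = q.1) (f : Smooth (-ε) (-ν)) :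
    eisTerm ε ν q f = f.1 (g * sEl) := by
  have h1 : eisTerm ε ν q f = f.1 (q.1.out * sEl) := by
    change f.1 (q.1.out⁻¹⁻¹ * (sEl⁻¹⁻¹ * 1)) = _
    rw [inv_inv, inv_inv, mul_one]
  obtain ⟨⟨h, k, rfl⟩, hk⟩ := QuotientGroup.mk_out_eq_mul GammaInf g
  rw [h1, ← hg, hk]
  change f.1 (g * nEl k * sEl) = _
  rw [mul_assoc, nEl_mul_sEl, ← mul_assoc, smooth_mul_nmEl]

/-! ### The metaplectic sign as a function of the first column -/

theorem kronecker_of_one_mod_four {a : ℤ} (ha : a ≡ 1 [ZMOD 4]) (c : ℤ) :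
    kronecker c a = jacobiSym c.natAbs a.natAbs := by
  have hodd : ¬ 2 ∣ a.natAbs := by have := ha; unfold Int.ModEq at this; omega
  have h0 : a ≠ 0 := by rintro rfl; simp [Int.ModEq] at ha
  have hp : padicValInt 2 a = 0 := by
    rw [padicValInt, padicValNat.eq_zero_of_not_dvd hodd]
  have ho : a.natAbs / 2 ^ a.natAbs.factorization 2 = a.natAbs := by
    rw [Nat.factorization_eq_zero_of_not_dvd hodd, pow_zero, Nat.div_one]
  have hO : Odd a.natAbs := by rw [← Nat.not_even_iff_odd, even_iff_two_dvd]; exact hodd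
  rw [kronecker, if_neg h0, hp, pow_zero, mul_one, ho]
  rcases le_or_gt 0 c with hc | hc
  · rw [if_neg (by omega), one_mul, Int.natAbs_of_nonneg hc]
  · have hc' : c = -(c.natAbs : ℤ) := by omega
    rw [show jacobiSym c a.natAbs = jacobiSym (-(c.natAbs : ℤ)) a.natAbs by rw [← hc'],
      jacobiSym.neg _ hO]
    -- For a < 0 with a ≡ 1 mod 4 one has |a| ≡ 3 mod 4, so (-1/|a|) = -1 cancels the extra sign of
    -- the Kronecker symbol at two negative arguments.
    unfold Int.ModEq at ha
    by_cases h : a < 0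
    · rw [if_pos ⟨h, hc⟩, ZMod.χ₄_nat_three_mod_four (by omega)]; ring
    · rw [if_neg (by tauto), ZMod.χ₄_nat_one_mod_four (by omega)]; ring

theorem jacobiSym_four_mul (C n : ℕ) (hn : Odd n) :
    jacobiSym ((4 * C : ℕ) : ℤ) n = jacobiSym C n := by
  have h2 : IsCoprime (2 : ℤ) n := by
    exact_mod_cast Nat.isCoprime_iff_coprime.2 (Nat.coprime_two_left.2 hn)
  rw [Nat.cast_mul, jacobiSym.mul_left, show ((4 : ℕ) : ℤ) = 2 ^ 2 by norm_num,
    jacobiSym.sq_one' (Int.isCoprime_iff_gcd_eq_one.1 h2), one_mul]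

/-- With C = 4D the symbol (C/·) equals (D/·) at odd arguments and so has period 4D = C. The
absolute value is 1 or -1 modulo C, and in the second case (C/(C-1)) = (1/(C-1)) = 1. -/
theorem jacobiSym_natAbs_one_add_mul {C : ℕ} (hC : C ≠ 0) (h4 : 4 ∣ C) (k : ℤ) :
    jacobiSym C (1 + k * C).natAbs = 1 := by
  obtain ⟨D, rfl⟩ := h4
  have hD : 0 < D := by omega
  have hkD : k * ((4 * D : ℕ) : ℤ) = 4 * (k * D) := by push_cast; ring
  have hodd : Odd (1 + k * ((4 * D : ℕ) : ℤ)).natAbs := by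
    rw [hkD, Nat.odd_iff]; omega
  have hmod : (4 * (D : ℤ).natAbs) = 4 * D := by simp
  rw [jacobiSym_four_mul _ _ hodd, jacobiSym.mod_right _ hodd, hmod]
  rcases le_or_gt 0 (1 + k * ((4 * D : ℕ) : ℤ)) with h | h
  · have e : (1 + k * ((4 * D : ℕ) : ℤ)).natAbs % (4 * D) = 1 := by
      zify
      rw [Nat.cast_mul, Nat.cast_ofNat] at h
      rw [abs_of_nonneg h]
      have := Int.add_mul_emod_self_right 1 k ((4 * D : ℕ) : ℤ)
      push_cast at this ⊢
      rw [this]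
      exact Int.emod_eq_of_lt (by omega) (by omega)
    rw [e, jacobiSym.one_right]
  · have e : (1 + k * ((4 * D : ℕ) : ℤ)).natAbs % (4 * D) = 4 * D - 1 := by
      have : ((4 * D - 1 : ℕ) : ℤ) = 4 * D - 1 := by omega
      zify
      rw [Nat.cast_mul, Nat.cast_ofNat] at h
      rw [abs_of_neg h, this]
      have h3 := Int.add_mul_emod_self_right (4 * (D : ℤ) - 1) (-k - 1) ((4 * D : ℕ) : ℤ)
      rw [show -(1 + k * (4 * (D : ℤ))) = 4 * (D : ℤ) - 1 + (-k - 1) * (4 * D) by ring]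
      push_cast at h3 ⊢
      rw [h3]
      exact Int.emod_eq_of_lt (by omega) (by omega)
    rw [e, ← jacobiSym_four_mul _ _ (by rw [Nat.odd_iff]; omega), jacobiSym.mod_left]
    have h5 : ((4 * D : ℕ) : ℤ) % ((4 * D - 1 : ℕ) : ℤ) = 1 := by
      have : ((4 * D : ℕ) : ℤ) = 1 + ((4 * D - 1 : ℕ) : ℤ) := by omega
      rw [this, Int.add_emod_right]
      exact Int.emod_eq_of_lt (by omega) (by omega)
    rw [h5, jacobiSym.one_left]

/-- The two descriptions of the metaplectic sign on `Γ̃₁(4)`, through either diagonal entry. -/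
theorem kronecker_eq_jacobiSym {a b c d : ℤ} (hdet : a * d - b * c = 1) (ha : a ≡ 1 [ZMOD 4])
    (hd : d ≡ 1 [ZMOD 4]) (hc : c ≡ 0 [ZMOD 4]) :
    kronecker c d = jacobiSym c.natAbs a.natAbs := by
  rw [kronecker_of_one_mod_four hd]
  by_cases h0 : c = 0
  · subst h0
    have h1 : a * d = 1 := by linarith
    have : a.natAbs = d.natAbs := by
      rcases Int.eq_one_or_neg_one_of_mul_eq_one' h1 with ⟨rfl, rfl⟩ | ⟨rfl, rfl⟩ <;> rfl
    rw [this]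
  · have hC : c.natAbs ≠ 0 := Int.natAbs_ne_zero.2 h0
    have h4 : 4 ∣ c.natAbs := by have := hc; unfold Int.ModEq at this; omega
    have hs : c.sign * (c.natAbs : ℤ) = c := Int.sign_mul_natAbs c
    -- Here 1 + b sgn(c) |c| = 1 + bc = ad, so the symbols at |a| and |d| have product 1 and agree.
    have key := jacobiSym_natAbs_one_add_mul hC h4 (b * c.sign)
    rw [mul_assoc, hs, show 1 + b * c = a * d by linarith, Int.natAbs_mul] at key
    have hA : a.natAbs ≠ 0 := by rw [Int.natAbs_ne_zero]; rintro rfl; simp [Int.ModEq] at ha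
    have hD : d.natAbs ≠ 0 := by rw [Int.natAbs_ne_zero]; rintro rfl; simp [Int.ModEq] at hd
    have := NeZero.mk hA
    have := NeZero.mk hD
    rw [jacobiSym.mul_right] at key
    rcases Int.eq_one_or_neg_one_of_mul_eq_one' key with ⟨h, h'⟩ | ⟨h, h'⟩ <;> rw [h, h']

/-- A representative in `Γ̃₁(4)`. -/
def rep (q : Cosets) : Mp := q.2.choose

theorem rep_mem (q : Cosets) : rep q ∈ Gamma14 := q.2.choose_spec.1

theorem mk_rep (q : Cosets) : (QuotientGroup.mk (rep q) : Mp ⧸ GammaInf) = q.1 :=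
  q.2.choose_spec.2

theorem exists_col {g : Mp} (hg : g ∈ Gamma14) : ∃ p : ℤ × ℤ, ∃ b d : ℤ,
    (g.mat 0 0 = p.1 ∧ g.mat 0 1 = b ∧ g.mat 1 0 = p.2 ∧ g.mat 1 1 = d) ∧
    p.1 * d - b * p.2 = 1 ∧ p.1 ≡ 1 [ZMOD 4] ∧ d ≡ 1 [ZMOD 4] ∧ p.2 ≡ 0 [ZMOD 4] ∧
    (g.sgn : ℤ) = jacobiSym p.2.natAbs p.1.natAbs := by
  obtain ⟨a, b, c, d, ⟨h1, h2, h3, h4⟩, ha, hd, hc, hs⟩ := hg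
  have hdet := det_entry g.mat
  rw [h1, h2, h3, h4] at hdet
  have hdet' : a * d - b * c = 1 := by exact_mod_cast hdet
  exact ⟨(a, c), b, d, ⟨h1, h2, h3, h4⟩, hdet', ha, hd, hc,
    hs.trans (kronecker_eq_jacobiSym hdet' ha hd hc)⟩

/-- The first column of the representatives of a coset. -/
def col (q : Cosets) : ℤ × ℤ := (exists_col (rep_mem q)).choose

theorem col_spec (q : Cosets) : ∃ b d : ℤ,
    ((rep q).mat 0 0 = (col q).1 ∧ (rep q).mat 0 1 = b ∧ (rep q).mat 1 0 = (col q).2 ∧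
      (rep q).mat 1 1 = d) ∧
    (col q).1 * d - b * (col q).2 = 1 ∧ (col q).1 ≡ 1 [ZMOD 4] ∧ d ≡ 1 [ZMOD 4] ∧
    (col q).2 ≡ 0 [ZMOD 4] ∧ ((rep q).sgn : ℤ) = jacobiSym (col q).2.natAbs (col q).1.natAbs :=
  (exists_col (rep_mem q)).choose_spec

theorem col_injective : Function.Injective col := by
  intro q q' h
  obtain ⟨b, d, ⟨h1, h2, h3, h4⟩, hdet, -, -, -, hs⟩ := col_spec q
  obtain ⟨b', d', ⟨h1', h2', h3', h4'⟩, hdet', -, -, -, hs'⟩ := col_spec q'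
  rw [← h] at h1' h3' hdet' hs'
  generalize (col q).1 = a at *
  generalize (col q).2 = c at *
  -- Two completions (b, d) and (b', d') of one column differ by right translation by ñ_k with k = d
  -- b' - b d'; the signs agree because they are functions of the column.
  have hg : rep q' = rep q * nEl ((d * b' - b * d' : ℤ) : ℝ) := by
    obtain ⟨e1, e2, e3, e4⟩ := mul_nEl_entries (rep q) ((d * b' - b * d' : ℤ) : ℝ)
    refine Mp.ext ?_ ?_
    · ext i j
      fin_cases i <;> fin_cases j
      · exact h1'.trans (h1.symm.trans e1.symm)
      · refine h2'.trans (Eq.trans ?_ e2.symm)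
        rw [h1, h2]
        exact_mod_cast (by linear_combination b * hdet' - b' * hdet :
          b' = a * (d * b' - b * d') + b)
      · exact h3'.trans (h3.symm.trans e3.symm)
      · refine h4'.trans (Eq.trans ?_ e4.symm)
        rw [h3, h4]
        exact_mod_cast (by linear_combination d * hdet' - d' * hdet :
          d' = c * (d * b' - b * d') + d)
    · rw [mul_nEl_sgn]
      exact Units.ext (hs'.trans hs.symm)
  apply Subtype.ext
  rw [← mk_rep q, ← mk_rep q', QuotientGroup.eq]
  exact ⟨_, by rw [hg, inv_mul_cancel_left]⟩

/-- Bézout completes the column, and the determinant modulo 4 forces d ≡ 1. The chosen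
representative of the coset may differ from this matrix, but right translation by ñ_k keeps the
first column. -/
theorem exists_col_eq {a c : ℤ} (hac : IsCoprime a c) (ha : a ≡ 1 [ZMOD 4])
    (hc : c ≡ 0 [ZMOD 4]) : ∃ q : Cosets, col q = (a, c) := by
  obtain ⟨d, b, hdb⟩ := hac
  have hdet : a * d - (-b) * c = 1 := by linarith
  have hd : d ≡ 1 [ZMOD 4] := by
    have h1 : d * a + b * c ≡ d * 1 + b * 0 [ZMOD 4] := (ha.mul_left d).add (hc.mul_left b)
    rw [hdb, mul_one, mul_zero, add_zero] at h1
    exact h1.symm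
  have hk := kronecker_eq_jacobiSym hdet ha hd hc
  have hgcd : Int.gcd (c.natAbs : ℤ) (a.natAbs : ℤ) = 1 := by
    have : IsCoprime c a := ⟨b, d, by linarith⟩
    rw [Int.isCoprime_iff_gcd_eq_one] at this
    rw [Int.gcd] at this ⊢
    simpa only [Int.natAbs_natCast] using this
  obtain ⟨κ, hκ⟩ : ∃ κ : ℤˣ, (κ : ℤ) = kronecker c d := by
    rcases jacobiSym.eq_one_or_neg_one hgcd with h | h
    · exact ⟨1, by rw [hk, h]; rfl⟩
    · exact ⟨-1, by rw [hk, h]; rfl⟩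
  let g : Mp := ⟨⟨!![(a : ℝ), ((-b : ℤ) : ℝ); (c : ℝ), (d : ℝ)], by
    rw [Matrix.det_fin_two_of]; exact_mod_cast hdet⟩, κ⟩
  have hg : g ∈ Gamma14 := ⟨a, -b, c, d, ⟨rfl, rfl, rfl, rfl⟩, ha, hd, hc, hκ⟩
  refine ⟨⟨QuotientGroup.mk g, g, hg, rfl⟩, ?_⟩
  generalize hq : (⟨QuotientGroup.mk g, g, hg, rfl⟩ : Cosets) = q
  obtain ⟨b', d', ⟨h1, -, h3, -⟩, -⟩ := col_spec q
  have hmk : (QuotientGroup.mk g : Mp ⧸ GammaInf) = QuotientGroup.mk (rep q) := by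
    rw [mk_rep, ← hq]
  obtain ⟨k, hk⟩ := QuotientGroup.eq.1 hmk
  have hrep : rep q = g * nEl k := by rw [← hk, mul_inv_cancel_left]
  obtain ⟨e1, -, e3, -⟩ := mul_nEl_entries g k
  rw [hrep, e1] at h1
  rw [hrep, e3] at h3
  have h1' : (a : ℝ) = (col q).1 := h1
  have h3' : (c : ℝ) = (col q).2 := h3
  exact Prod.ext (by exact_mod_cast h1'.symm) (by exact_mod_cast h3'.symm)

/-! ### Convergence of the Eisenstein series -/

theorem norm_eisTerm_le (ε : ℤˣ) (ν : ℂ) (q : Cosets) (f : Smooth (-ε) (-ν)) {B : ℝ}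
    (hB : ∀ x : ℝ, |x| ≤ 1 → ‖f.1 (nEl x)‖ ≤ B ∧ ‖f.1 (sEl⁻¹ * nEl x)‖ ≤ B) :
    ‖eisTerm ε ν q f‖ ≤ max |((col q).1 : ℝ)| |((col q).2 : ℝ)| ^ (-(ν.re + 1)) * B := by
  obtain ⟨b, d, ⟨h1, -, h3, -⟩, -⟩ := col_spec q
  obtain ⟨e0, e1, -⟩ := mul_sEl_mat (rep q)
  rw [eisTerm_apply ε ν q (mk_rep q) f]
  have h := norm_smooth_le f hB (rep q * sEl)
  rw [e0, e1, abs_neg, abs_neg, h1, h3, Complex.neg_re] at h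
  rwa [neg_add']

theorem summable_max_abs_rpow {s : ℝ} (hs : 2 < s) :
    Summable fun p : ℤ × ℤ => max |(p.1 : ℝ)| |(p.2 : ℝ)| ^ (-s) := by
  have h := EisensteinSeries.summable_one_div_norm_rpow hs
  rw [← (finTwoArrowEquiv ℤ).symm.summable_iff] at h
  refine h.congr fun p => ?_
  have e : ‖(finTwoArrowEquiv ℤ).symm p‖ = max |(p.1 : ℝ)| |(p.2 : ℝ)| := by
    apply le_antisymm
    · rw [pi_norm_le_iff_of_nonneg (le_max_of_le_left (abs_nonneg _))]
      intro i
      fin_cases i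
      · exact le_max_left _ _
      · exact le_max_right _ _
    · exact max_le (norm_le_pi_norm ((finTwoArrowEquiv ℤ).symm p) 0)
        (norm_le_pi_norm ((finTwoArrowEquiv ℤ).symm p) 1)
  simp only [Function.comp, e]

/-- A sum over part of the lattice ℤ², which converges since the exponent Re ν + 1 exceeds the rank
2. -/
theorem summable_col {ν : ℂ} (hν : 1 < ν.re) :
    Summable fun q : Cosets => max |((col q).1 : ℝ)| |((col q).2 : ℝ)| ^ (-(ν.re + 1)) :=
  (summable_max_abs_rpow (by linarith : 2 < ν.re + 1)).comp_injective col_injective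

theorem summable_norm_eisTerm (ε : ℤˣ) {ν : ℂ} (hν : 1 < ν.re) (f : Smooth (-ε) (-ν)) :
    Summable fun q : Cosets => ‖eisTerm ε ν q f‖ := by
  obtain ⟨B, hB⟩ := exists_bound_smooth f
  exact Summable.of_nonneg_of_le (fun _ => norm_nonneg _)
    (fun q => norm_eisTerm_le ε ν q f hB) ((summable_col hν).mul_right B)

theorem eisenstein_apply (ε : ℤˣ) {ν : ℂ} (hν : 1 < ν.re) (f : Smooth (-ε) (-ν)) :
    eisenstein ε ν f = zeta2 (2 * ν + 1) * ∑' q : Cosets, eisTerm ε ν q f := by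
  rw [eisenstein, dif_pos fun f => (summable_norm_eisTerm ε hν f).of_norm]
  rfl

theorem hasSum_eisenstein (ε : ℤˣ) {ν : ℂ} (hν : 1 < ν.re) (f : Smooth (-ε) (-ν)) :
    HasSum (fun q : Cosets => zeta2 (2 * ν + 1) * eisTerm ε ν q f) (eisenstein ε ν f) := by
  rw [eisenstein_apply ε hν f]
  exact (summable_norm_eisTerm ε hν f).of_norm.hasSum.mul_left _

/-- Each term is bounded linearly by the suprema of f on [-1, 1] in the two charts, so no
derivatives are needed. -/
theorem eisenstein_mem_dist (ε : ℤˣ) {ν : ℂ} (hν : 1 < ν.re) : eisenstein ε ν ∈ Dist ε ν := by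
  refine ⟨0, 1, ‖zeta2 (2 * ν + 1)‖ *
    ∑' q : Cosets, max |((col q).1 : ℝ)| |((col q).2 : ℝ)| ^ (-(ν.re + 1)), ?_, fun f B hB => ?_⟩
  · exact mul_nonneg (norm_nonneg _) (tsum_nonneg fun q =>
      Real.rpow_nonneg (le_max_of_le_left (abs_nonneg _)) _)
  · have hB' : ∀ x : ℝ, |x| ≤ 1 → ‖f.1 (nEl x)‖ ≤ B ∧ ‖f.1 (sEl⁻¹ * nEl x)‖ ≤ B :=
      fun x hx => by simpa only [iteratedDeriv_zero] using hB 0 le_rfl x hx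
    rw [eisenstein_apply ε hν f, norm_mul, mul_assoc, ← tsum_mul_right]
    exact mul_le_mul_of_nonneg_left (tsum_of_norm_bounded ((summable_col hν).mul_right B).hasSum
      fun q => norm_eisTerm_le ε ν q f hB') (norm_nonneg _)

/-! ### The Fourier coefficients -/

/-- The first column, normalized to a nonnegative lower entry. -/
def posCol (q : Cosets) : ℕ × ℤ := ((col q).2.natAbs, (col q).2.sign * (col q).1)

/-- The sign of c is not lost: as a ≡ 1 mod 4, it can be recovered from sgn(c) a mod 4. For c = 0
the second component is 0, but the determinant together with a ≡ 1 mod 4 forces a = 1. -/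
theorem posCol_injective : Function.Injective posCol := by
  intro q q' h
  obtain ⟨b, d, -, hdet, ha, hd, hc, -⟩ := col_spec q
  obtain ⟨b', d', -, hdet', ha', hd', hc', -⟩ := col_spec q'
  apply col_injective
  simp only [posCol, Prod.mk.injEq] at h
  obtain ⟨h1, h2⟩ := h
  unfold Int.ModEq at ha hd ha' hd'
  generalize (col q) = x at *
  generalize (col q') = y at *
  obtain ⟨a, c⟩ := x
  obtain ⟨a', c'⟩ := y
  simp only at *
  rw [Prod.mk.injEq]
  rcases lt_trichotomy c 0 with h0 | h0 | h0
  · rcases lt_trichotomy c' 0 with h0' | h0' | h0'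
    · rw [Int.sign_eq_neg_one_of_neg h0, Int.sign_eq_neg_one_of_neg h0'] at h2; omega
    · omega
    · rw [Int.sign_eq_neg_one_of_neg h0, Int.sign_eq_one_of_pos h0'] at h2; omega
  · have h0' : c' = 0 := by omega
    subst h0 h0'
    rw [mul_zero, sub_zero] at hdet hdet'
    rcases Int.eq_one_or_neg_one_of_mul_eq_one hdet with e | e <;>
      rcases Int.eq_one_or_neg_one_of_mul_eq_one hdet' with e' | e' <;> omega
  · rcases lt_trichotomy c' 0 with h0' | h0' | h0'
    · rw [Int.sign_eq_one_of_pos h0, Int.sign_eq_neg_one_of_neg h0'] at h2; omega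
    · omega
    · rw [Int.sign_eq_one_of_pos h0, Int.sign_eq_one_of_pos h0'] at h2; omega

/-- The value of the summand of lower left entry `c > 0` and upper left entry `a`, at the
extension of a function `φ` on the real line. -/
def colTerm (ε : ℤˣ) (ν : ℂ) (φ : ℝ → ℂ) (p : ℕ × ℤ) : ℂ :=
  if p.1 ≠ 0 ∧ 4 ∣ p.1 then eisCoef ε p.1 p.2 * (p.1 : ℂ) ^ (-ν - 1) * φ (p.2 / p.1) else 0

theorem eisTerm_ext (ε : ℤˣ) (ν : ℂ) (φ : 𝓓((⊤ : Opens ℝ), ℂ)) (q : Cosets) :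
    eisTerm ε ν q (ext (-ε) (-ν) φ) = colTerm ε ν φ (posCol q) := by
  obtain ⟨b, d, ⟨h1, h2, h3, h4⟩, hdet, ha, hd, hc, hs⟩ := col_spec q
  rw [eisTerm_apply ε ν q (mk_rep q), colTerm, posCol]
  generalize (col q).1 = a at *
  generalize (col q).2 = c at *
  by_cases h0 : c = 0
  · rw [if_neg (by simp [h0])]
    -- For c = 0 the point γ s̃ lies outside Ñ B̃, where the extension vanishes.
    have e := (mul_sEl_mat (rep q)).2.1
    rw [h3, h0, Int.cast_zero, neg_zero] at e
    exact if_pos e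
  · have h4' : 4 ∣ c.natAbs := by have := hc; unfold Int.ModEq at this; omega
    have hd0 : d ≠ 0 := by rintro rfl; simp [Int.ModEq] at hd
    rw [if_pos ⟨Int.natAbs_ne_zero.2 h0, h4'⟩, smooth_mul_sEl _ _
      (by rw [h3]; exact_mod_cast h0) (by rw [h4]; exact_mod_cast hd0), h1, h3, hs]
    have hf : ∀ x, (ext (-ε) (-ν) φ).1 (nEl x) = φ x := extFun_nEl _ _ _
    have hx : ((c.sign * a : ℤ) : ℝ) / ((c.natAbs : ℕ) : ℝ) = a / c := by
      have e : (c : ℝ) = c.sign * c.natAbs := by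
        conv_lhs => rw [← Int.sign_mul_natAbs c]
        rw [Int.cast_mul, Int.cast_natCast]
      have hsg : (c.sign : ℝ) ≠ 0 := by
        rw [Int.cast_ne_zero, Ne, Int.sign_eq_zero_iff_zero]; exact h0
      rw [Int.cast_mul]
      conv_rhs => rw [e]
      have hn : ((c.natAbs : ℕ) : ℝ) ≠ 0 := by exact_mod_cast Int.natAbs_ne_zero.2 h0
      have hss : (c.sign : ℝ) * c.sign = 1 := by
        rcases lt_or_gt_of_ne h0 with h | h
        · simp [Int.sign_eq_neg_one_of_neg h]
        · simp [Int.sign_eq_one_of_pos h]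
      field_simp
      linear_combination (a : ℝ) * hss
    have hab : ((|(c : ℝ)| : ℝ) : ℂ) = ((c.natAbs : ℕ) : ℂ) := by
      rw [← Int.cast_abs, Int.abs_eq_natAbs, Int.cast_natCast, Complex.ofReal_natCast]
    rw [hf, hx, hab, eisCoef]
    congr 2
    have hna : (c.sign * a).natAbs = a.natAbs := by
      rw [Int.natAbs_mul, Int.natAbs_sign_of_ne_zero h0, one_mul]
    rw [hna, mul_comm]
    congr 1
    -- Since a ≡ 1 mod 4, the normalized entry sgn(c) a is 1 or 3 mod 4 according to the sign of c,
    -- which is what the weight records.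
    unfold Int.ModEq at ha
    rcases lt_or_gt_of_ne h0 with h | h
    · rw [if_pos (by exact_mod_cast h), Int.sign_eq_neg_one_of_neg h, wt, if_neg (by omega),
        if_pos (by omega)]
    · rw [if_neg (by exact_mod_cast h.not_gt), Int.sign_eq_one_of_pos h, wt, if_pos (by omega)]

/-- The sum over cosets may be extended to all pairs (c, a): even a have weight 0, and pairs that
are not coprime have Jacobi symbol 0. A coprime pair with a ≡ 3 mod 4 comes from the column (-a,
-c). -/
theorem colTerm_of_not_mem (ε : ℤˣ) (ν : ℂ) (φ : ℝ → ℂ) (p : ℕ × ℤ)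
    (hp : p ∉ Set.range posCol) : colTerm ε ν φ p = 0 := by
  obtain ⟨c, a⟩ := p
  by_contra hne
  rw [colTerm] at hne
  have hc : c ≠ 0 ∧ 4 ∣ c := by by_contra h; exact hne (if_neg h)
  rw [if_pos hc] at hne
  have he := left_ne_zero_of_mul (left_ne_zero_of_mul hne)
  rw [eisCoef] at he
  have hw := left_ne_zero_of_mul he
  have hj : jacobiSym c a.natAbs ≠ 0 := by
    intro h
    exact right_ne_zero_of_mul he (by simp only [h, Int.cast_zero])
  have hodd : Odd a := by
    by_contra h
    exact hw (wt_even ε h)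
  have hcop : IsCoprime a c := by
    by_contra h
    have ha0 : a.natAbs ≠ 0 := by rintro h0; simp [Int.natAbs_eq_zero.1 h0] at hodd
    have := NeZero.mk ha0
    refine hj (jacobiSym.eq_zero_iff_not_coprime.2 fun hg => h ?_)
    rw [isCoprime_comm, Int.isCoprime_iff_gcd_eq_one, ← hg, Int.gcd, Int.gcd, Int.natAbs_natCast a.natAbs]
  have h4 : (c : ℤ) ≡ 0 [ZMOD 4] := by
    have := hc.2; unfold Int.ModEq; omega
  have hc0 : (0 : ℤ) < c := by have := hc.1; omega
  rcases (by rw [Int.odd_iff] at hodd; omega : a % 4 = 1 ∨ a % 4 = 3) with h | h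
  · obtain ⟨q, hq⟩ := exists_col_eq hcop (by unfold Int.ModEq; omega) h4
    exact hp ⟨q, by rw [posCol, hq, Int.sign_eq_one_of_pos hc0]; simp⟩
  · obtain ⟨q, hq⟩ := exists_col_eq (a := -a) (c := -c) hcop.neg_neg
      (by unfold Int.ModEq; omega) (by unfold Int.ModEq at *; omega)
    exact hp ⟨q, by rw [posCol, hq, Int.sign_eq_neg_one_of_neg (by simpa using hc0)]; simp⟩

theorem hasSum_of_residues {c : ℕ} (hc : c ≠ 0) {F : ℤ → ℂ} {S : ℕ → ℂ}
    (h : ∀ r < c, HasSum (fun k : ℤ => F (r + c * k)) (S r)) :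
    HasSum F (∑ r ∈ Finset.range c, S r) := by
  have hinj : ∀ r : ℕ, Function.Injective fun k : ℤ => (r : ℤ) + c * k := by
    intro r k k' hk
    simpa [hc] using hk
  have hr : ∀ r ∈ Finset.range c, HasSum (fun a : ℤ => if a % c = r then F a else 0) (S r) := by
    intro r hr
    have hlt : (r : ℤ) < c := by exact_mod_cast Finset.mem_range.1 hr
    refine ((hinj r).hasSum_iff ?_).1 ?_
    · intro a ha
      rw [if_neg]
      intro h'
      exact ha ⟨a / c, by rw [← h']; exact Int.emod_add_mul_ediv a c⟩
    · refine (h r (Finset.mem_range.1 hr)).congr_fun ?_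
      intro k
      rw [Function.comp, if_pos]
      rw [Int.add_mul_emod_self_left]
      exact Int.emod_eq_of_lt (by omega) hlt
  refine (hasSum_sum hr).congr_fun ?_
  intro a
  have h0 : 0 ≤ a % c := Int.emod_nonneg _ (by exact_mod_cast hc)
  have h1 : a % c < c := Int.emod_lt_of_pos _ (by omega)
  rw [Finset.sum_eq_single (a % c).toNat]
  · rw [if_pos (by omega)]
  · intro b _ hb
    rw [if_neg (by omega)]
  · intro hb
    rw [Finset.mem_range] at hb
    omega

/-- On a class r + cℤ the coefficient and the exponential are constant, and the values ψ(r/c + k)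
add up to 1. -/
theorem hasSum_colTerm (ε : ℤˣ) (n : ℤ) (ν : ℂ) {ψ : 𝓓((⊤ : Opens ℝ), ℂ)} (hψ : IsPeriodUnity ψ)
    (c : ℕ) : HasSum (fun a : ℤ => colTerm ε ν (modulate ψ n) (c, a)) (eisDirichletTerm ε n ν c) := by
  rw [eisDirichletTerm]
  simp only [colTerm]
  split_ifs with h
  · obtain ⟨h0, h4⟩ := h
    have hcR : (c : ℝ) ≠ 0 := by exact_mod_cast h0
    rw [eisSum, Finset.sum_mul]
    refine hasSum_of_residues h0 fun r _ => ?_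
    have hk := (hψ ((r : ℝ) / c)).mul_left
      (eisCoef ε c r * eAdd c (-n * r) * (c : ℂ) ^ (-ν - 1))
    rw [mul_one] at hk
    refine hk.congr_fun fun k => ?_
    have e1 : eisCoef ε c (r + c * k) = eisCoef ε c r :=
      eisCoef_congr ε h0 h4 (by simp)
    have e2 : (((r : ℤ) + c * k : ℤ) : ℝ) / c = (r : ℝ) / c + k := by
      push_cast
      field_simp
    have e3 : Complex.exp (2 * Real.pi * Complex.I * (-n * (((r : ℝ) / c + k : ℝ) : ℂ))) =
        eAdd c (-n * r) := by
      have : eAdd c (-n * r) = eAdd c (-n * (r + c * k)) :=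
        eAdd_eq_of_dvd (by exact_mod_cast h0) ⟨n * k, by ring⟩
      rw [this, eAdd]
      congr 1
      have hcC : (c : ℂ) ≠ 0 := by exact_mod_cast h0
      push_cast
      field_simp
    have e4 : ∀ x : ℝ, (modulate ψ n) x =
      ψ x * Complex.exp (2 * Real.pi * Complex.I * (-n * x)) := fun _ => rfl
    rw [e1, e4, e2, e3]
    ring
  · exact hasSum_zero

/-- Absolute convergence over the cosets, extended by zero to all pairs, permits summation over a
first for each c. -/
theorem isFourierCoeff_eisenstein (ε : ℤˣ) (n : ℤ) {ν : ℂ} (hν : 1 < ν.re) :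
    IsFourierCoeff (restrictN (eisenstein ε ν)) n
      (zeta2 (2 * ν + 1) * ∑' c, eisDirichletTerm ε n ν c) := by
  intro ψ hψ
  have h1 := (summable_norm_eisTerm ε hν (ext (-ε) (-ν) (modulate ψ n))).of_norm.hasSum
  have h2 : HasSum (colTerm ε ν (modulate ψ n) ∘ posCol)
      (∑' q : Cosets, eisTerm ε ν q (ext (-ε) (-ν) (modulate ψ n))) :=
    h1.congr_fun fun q => (eisTerm_ext ε ν (modulate ψ n) q).symm
  rw [posCol_injective.hasSum_iff (colTerm_of_not_mem ε ν _)] at h2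
  have h3 := h2.prod_fiberwise (hasSum_colTerm ε n ν hψ)
  rw [restrictN, eisenstein_apply ε hν, h3.tsum_eq]

/-! ### Triviality of the character -/

theorem oddPart_of_isSquare {m : ℤ} (hm : m ≠ 0) (h : IsSquare m) : oddPart m = 1 := by
  obtain ⟨k, rfl⟩ := h
  have hk : k.natAbs ≠ 0 := by rw [Int.natAbs_ne_zero]; rintro rfl; simp at hm
  have hpos : 0 < k * k := lt_of_le_of_ne (mul_self_nonneg k) hm.symm
  rw [oddPart, Int.sign_eq_one_of_pos hpos, one_mul, Finset.filter_false_of_mem, Finset.prod_empty,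
    Nat.cast_one]
  intro p _
  rw [Int.natAbs_mul, Nat.factorization_mul hk hk, Finsupp.add_apply, Nat.not_odd_iff_even]
  exact ⟨_, rfl⟩

/-- Take d ≡ 1 modulo 4|v| and d a nonresidue modulo p. Then (v/d) = 1 by periodicity, and (p/d) =
(d/p) = -1 by reciprocity with d ≡ 1 mod 4. -/
theorem exists_jacobiSym_prime_pow_mul {p : ℕ} (hp : p.Prime) (h2 : p ≠ 2) {e : ℕ} (he : Odd e)
    {v : ℤ} (hv : ¬ (p : ℤ) ∣ v) : ∃ d : ℕ, Odd d ∧ jacobiSym ((p : ℤ) ^ e * v) d = -1 := by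
  have : Fact p.Prime := ⟨hp⟩
  have hpo : Odd p := hp.odd_of_ne_two h2
  obtain ⟨r, hr⟩ := FiniteField.exists_nonsquare (F := ZMod p) (by rwa [ZMod.ringChar_zmod_n])
  have hcop : Nat.Coprime (4 * v.natAbs) p := by
    rw [Nat.coprime_comm, hp.coprime_iff_not_dvd, hp.dvd_mul]
    rintro (h | h)
    · exact h2 ((Nat.prime_dvd_prime_iff_eq hp Nat.prime_two).1
        (hp.dvd_of_dvd_pow (by simpa using h : p ∣ 2 ^ 2)))
    · exact hv (Int.natCast_dvd.2 h)
  obtain ⟨d, hd1, hd2⟩ := Nat.chineseRemainder hcop 1 r.val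
  have h4 : d % 4 = 1 := (hd1.of_mul_right _ : d ≡ 1 [MOD 4])
  have hd : Odd d := Nat.odd_iff.2 (Nat.odd_of_mod_four_eq_one h4)
  refine ⟨d, hd, ?_⟩
  have hJv : jacobiSym v d = 1 := by
    rw [jacobiSym.mod_right v hd]
    have := jacobiSym.mod_right v odd_one
    rw [jacobiSym.one_right] at this
    rw [show d % (4 * v.natAbs) = 1 % (4 * v.natAbs) from hd1, ← this]
  have hJp : jacobiSym p d = -1 := by
    rw [jacobiSym.quadratic_reciprocity_one_mod_four' hpo h4, ← jacobiSym.legendreSym.to_jacobiSym,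
      legendreSym.eq_neg_one_iff']
    rwa [(ZMod.natCast_eq_natCast_iff d r.val p).2 hd2, ZMod.natCast_zmod_val]
  rw [jacobiSym.mul_left, hJv, mul_one, jacobiSym.pow_left, hJp, he.neg_one_pow]

/-- An odd prime in t reduces to the preceding construction. Otherwise t is -1 or ±2^k with k odd,
and d = 3 or d = 5 works. -/
theorem exists_jacobiSym_oddPart {m : ℤ} (hm : m ≠ 0) (h : ¬ IsSquare m) :
    ∃ d : ℕ, Odd d ∧ jacobiSym (oddPart m) d = -1 := by
  have ht := oddPart_ne_zero hm
  have hfac := factorization_oddPart hm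
  have ht1 : oddPart m ≠ 1 := by
    intro h1
    apply h
    rw [← evenPart_mul_oddPart hm, h1, mul_one]
    obtain ⟨r, hr⟩ := isSquare_evenPart m
    exact ⟨r, by exact_mod_cast hr⟩
  generalize oddPart m = t at *
  by_cases hex : ∃ p : ℕ, p ≠ 2 ∧ Odd (m.natAbs.factorization p)
  · obtain ⟨p, h2, hodd⟩ := hex
    have hp : p.Prime := by
      by_contra hp
      rw [Nat.factorization_eq_zero_of_not_prime _ hp] at hodd
      simp at hodd
    have hf : t.natAbs.factorization p = m.natAbs.factorization p := by rw [hfac, if_pos hodd]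
    obtain ⟨v, hv⟩ : (p : ℤ) ^ (m.natAbs.factorization p) ∣ t := by
      rw [← Nat.cast_pow, Int.natCast_dvd, ← hf]
      exact Nat.ordProj_dvd _ _
    rw [hv]
    refine exists_jacobiSym_prime_pow_mul hp h2 hodd fun hpv => ?_
    have h3 : p ^ (m.natAbs.factorization p + 1) ∣ t.natAbs := by
      rw [← Int.natCast_dvd, Nat.cast_pow, hv, pow_succ]
      exact mul_dvd_mul_left _ hpv
    rw [← hf] at h3
    exact Nat.pow_succ_factorization_not_dvd (Int.natAbs_ne_zero.2 ht) hp h3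
  · push Not at hex
    have hpow : t.natAbs = 2 ^ t.natAbs.factorization 2 := by
      refine Nat.eq_of_factorization_eq (Int.natAbs_ne_zero.2 ht) (by positivity) fun p => ?_
      rw [Nat.Prime.factorization_pow Nat.prime_two]
      by_cases h2 : p = 2
      · rw [h2, Finsupp.single_eq_same]
      · rw [Finsupp.single_eq_of_ne h2, hfac, if_neg (hex p h2)]
    have hk : t.natAbs.factorization 2 = 0 ∨ Odd (t.natAbs.factorization 2) := by
      rw [hfac]
      split_ifs with h
      · exact Or.inr h
      · exact Or.inl rfl
    generalize t.natAbs.factorization 2 = k at *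
    have j3 : jacobiSym 2 3 = -1 := by norm_num
    have j5 : jacobiSym 2 5 = -1 := by norm_num
    have n3 : jacobiSym (-1) 3 = -1 := by norm_num
    have n5 : jacobiSym (-1) 5 = 1 := by norm_num
    have htk : t = 2 ^ k ∨ t = -1 * 2 ^ k := by
      rcases Int.natAbs_eq t with h | h
      · left; rw [h, hpow]; push_cast; rfl
      · right; rw [h, hpow]; push_cast; ring
    rcases hk with rfl | hk
    · rcases htk with rfl | rfl
      · exact absurd rfl ht1
      · exact ⟨3, by decide, by rw [pow_zero, mul_one]; exact n3⟩
    · rcases htk with rfl | rfl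
      · exact ⟨3, by decide, by rw [jacobiSym.pow_left, j3, hk.neg_one_pow]⟩
      · exact ⟨5, by decide, by
          rw [jacobiSym.mul_left, jacobiSym.pow_left, n5, j5, hk.neg_one_pow, one_mul]⟩

theorem jacobiChar_ne_one {t : ℤ} [NeZero t.natAbs] {d : ℕ} (hd : Odd d)
    (h : jacobiSym t d = -1) : jacobiChar t ≠ 1 := by
  intro h1
  have h2 := jacobiChar_natCast t d
  rw [if_pos hd, h] at h2
  have hu : IsUnit (d : ZMod (4 * t.natAbs)) := by
    by_contra hu
    rw [MulChar.map_nonunit _ hu] at h2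
    norm_num at h2
  rw [h1, MulChar.one_apply hu] at h2
  norm_num at h2

theorem jacobiChar_eq_one {t : ℤ} [NeZero t.natAbs] (h : t = 1) : jacobiChar t = 1 := by
  subst h
  ext a
  rw [MulChar.one_apply_coe]
  have hodd : Odd (a : ZMod (4 * (1 : ℤ).natAbs)).val := by
    rw [← Nat.coprime_two_left]
    exact (ZMod.val_coe_unit_coprime a).symm.coprime_dvd_left (by norm_num)
  have h2 := jacobiChar_natCast 1 (a : ZMod (4 * (1 : ℤ).natAbs)).val
  rw [if_pos hodd, jacobiSym.one_left, ZMod.natCast_zmod_val] at h2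
  rw [h2, Int.cast_one]

/-! ### Analyticity of the elementary factors -/

theorem differentiable_twoFactor (l : ℕ) (m' : ℤ) : Differentiable ℂ (twoFactor l m') := by
  have h : ∀ (z : ℂ) (k : ℕ), Differentiable ℂ fun ν : ℂ => z * ((2 : ℂ) ^ k) ^ (-ν - 1) := by
    intro z k
    exact (Differentiable.const_cpow (by fun_prop) (Or.inl (pow_ne_zero k two_ne_zero))).const_mul z
  unfold twoFactor
  refine ((Differentiable.sub ?_ ?_).add ?_).add ?_
  · exact Differentiable.fun_sum fun k _ => h _ _
  · split_ifs
    · exact h _ _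
    · exact differentiable_const _
  · split_ifs
    · exact (h _ _).const_mul _
    · exact differentiable_const _
  · split_ifs
    · exact (h _ _).const_mul _
    · exact differentiable_const _

theorem differentiable_cCoeff (ε : ℤˣ) {n : ℤ} (hn : n ≠ 0) : Differentiable ℂ (cCoeff ε n) := by
  rw [funext (cCoeff_eq ε hn)]
  exact (differentiable_twoFactor _ _).const_mul _

theorem differentiable_localPoly (m : ℤ) {p : ℕ} (hp : p ≠ 0) : Differentiable ℂ (localPoly m p) := by
  have hp0 : (p : ℂ) ≠ 0 := Nat.cast_ne_zero.2 hp
  have h1 : ∀ j : ℕ, Differentiable ℂ fun ν : ℂ => (p : ℂ) ^ (-(j : ℂ) * ν) :=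
    fun j => Differentiable.const_cpow (by fun_prop) (Or.inl hp0)
  have h2 : Differentiable ℂ fun ν : ℂ => (p : ℂ) ^ (-ν - 1 / 2) :=
    Differentiable.const_cpow (by fun_prop) (Or.inl hp0)
  have h3 : ∀ s : Finset ℕ, Differentiable ℂ fun ν : ℂ => ∑ j ∈ s, (p : ℂ) ^ (-(j : ℂ) * ν) :=
    fun s => Differentiable.fun_sum fun j _ => h1 j
  have h4 : ∀ z : ℂ, Differentiable ℂ fun ν : ℂ => 1 - z * (p : ℂ) ^ (-ν - 1 / 2) :=
    fun z => (h2.const_mul z).const_sub 1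
  unfold localPoly
  generalize m.natAbs.factorization p = e
  split_ifs
  · exact Differentiable.add (Differentiable.mul (h4 _) (h3 _)) (h1 e)
  · exact h3 _

theorem differentiable_oddPoly (m : ℤ) : Differentiable ℂ (oddPoly m) := by
  unfold oddPoly
  exact Differentiable.fun_finsetProd fun p hp => differentiable_localPoly m
    (Nat.prime_of_mem_primeFactors (Finset.mem_of_mem_erase hp)).ne_zero

/-! ### Nonvanishing at the pole -/

/-- Here t = 1 and p^(-ν-1/2) = 1/p < 1, so the value is a nonnegative real number plus a positive
power of p. -/
theorem localPoly_half_ne_zero {m : ℤ} (hm : m ≠ 0) (h : IsSquare m) {p : ℕ} (hp : p.Prime) :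
    localPoly m p (1 / 2) ≠ 0 := by
  have hp1 : (1 : ℝ) < p := by exact_mod_cast hp.one_lt
  have hp0 : (0 : ℝ) < p := by linarith
  have heven : Even (m.natAbs.factorization p) := by
    obtain ⟨k, rfl⟩ := h
    have hk : k.natAbs ≠ 0 := by rw [Int.natAbs_ne_zero]; rintro rfl; simp at hm
    rw [Int.natAbs_mul, Nat.factorization_mul hk hk, Finsupp.add_apply]
    exact ⟨_, rfl⟩
  have hc : ∀ x : ℝ, ((p : ℂ)) ^ (x : ℂ) = (((p : ℝ) ^ x : ℝ) : ℂ) := by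
    intro x
    rw [Complex.ofReal_cpow hp0.le, Complex.ofReal_natCast]
  have hj : ∀ j : ℕ, (p : ℂ) ^ (-(j : ℂ) * (1 / 2)) = (((p : ℝ) ^ (-(j : ℝ) / 2) : ℝ) : ℂ) := by
    intro j
    rw [← hc]
    congr 1
    push_cast
    ring
  rw [localPoly, if_pos heven, oddPart_of_isSquare hm h, jacobiSym.one_left]
  simp only [hj]
  rw [show (-(1 / 2) - 1 / 2 : ℂ) = ((-1 : ℝ) : ℂ) by push_cast; ring, hc]
  have hlt : (p : ℝ) ^ (-1 : ℝ) < 1 := Real.rpow_lt_one_of_one_lt_of_neg hp1 (by norm_num)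
  have hpos : 0 < (1 - (p : ℝ) ^ (-1 : ℝ)) *
      (∑ j ∈ Finset.range (m.natAbs.factorization p - 1) with Even j, (p : ℝ) ^ (-(j : ℝ) / 2)) +
      (p : ℝ) ^ (-(m.natAbs.factorization p : ℝ) / 2) :=
    add_pos_of_nonneg_of_pos (mul_nonneg (by linarith)
      (Finset.sum_nonneg fun j _ => (Real.rpow_pos_of_pos hp0 _).le)) (Real.rpow_pos_of_pos hp0 _)
  have := Complex.ofReal_ne_zero.2 hpos.ne'
  push_cast at this ⊢
  simpa using this

theorem oddPoly_half_ne_zero {m : ℤ} (hm : m ≠ 0) (h : IsSquare m) : oddPoly m (1 / 2) ≠ 0 :=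
  Finset.prod_ne_zero_iff.2 fun _ hp => localPoly_half_ne_zero hm h
    (Nat.prime_of_mem_primeFactors (Finset.mem_of_mem_erase hp))

/-- For m' ≡ 1 mod 8, as for odd squares, both characters are 1, and the only negative term needs ℓ
odd; what remains is a sum of positive reals. -/
theorem twoFactor_half_ne_zero {l : ℕ} (hl : Even l) {m' : ℤ} (hm' : m' % 8 = 1) :
    twoFactor l m' (1 / 2) ≠ 0 := by
  have h4 : ZMod.χ₄ (m' : ZMod 4) = 1 := ZMod.χ₄_int_one_mod_four (by omega)
  have h8 : ZMod.χ₈' (m' : ZMod 8) = 1 := by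
    rw [(ZMod.intCast_eq_intCast_iff m' 1 8).2 hm']
    decide
  have hmod : m' ≡ 1 [ZMOD 4] := by unfold Int.ModEq; omega
  have hc : ∀ k : ℕ, ((2 : ℂ) ^ k) ^ (-(1 / 2) - 1 : ℂ) =
      ((((2 : ℝ) ^ k) ^ (-(3 / 2) : ℝ) : ℝ) : ℂ) := by
    intro k
    rw [Complex.ofReal_cpow (by positivity)]
    push_cast
    congr 1
    ring
  rw [twoFactor, if_neg (Nat.not_odd_iff_even.2 hl), if_pos hl, if_pos ⟨hl, hmod⟩, h4, h8,
    two_cpow_add_three_halves]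
  simp only [hc]
  have hpos : 0 < (∑ k ∈ Finset.range (l - 1) with Even k,
      (2 : ℝ) ^ k * ((2 : ℝ) ^ (k + 2)) ^ (-(3 / 2) : ℝ)) +
      2 ^ l * ((2 : ℝ) ^ (l + 2)) ^ (-(3 / 2) : ℝ) +
      2 ^ l * (2 * Real.sqrt 2) * ((2 : ℝ) ^ (l + 3)) ^ (-(3 / 2) : ℝ) := by
    have := Finset.sum_nonneg (s := (Finset.range (l - 1)).filter (Even ·))
      (f := fun k => (2 : ℝ) ^ k * ((2 : ℝ) ^ (k + 2)) ^ (-(3 / 2) : ℝ)) fun k _ => by positivity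
    positivity
  have := Complex.ofReal_ne_zero.2 hpos.ne'
  rw [Complex.ofReal_add, Complex.ofReal_add, Complex.ofReal_sum] at this
  push_cast at this ⊢
  simpa [mul_assoc] using this

theorem two_adic_of_isSquare {ε : ℤˣ} {n : ℤ} (hn : n ≠ 0) (h : IsSquare ((ε : ℤ) * n)) :
    Even (padicValInt 2 n) ∧ ((ε : ℤ) * (n / 2 ^ padicValInt 2 n)) % 8 = 1 := by
  obtain ⟨k, hk⟩ := h
  have hk0 : k ≠ 0 := by
    rintro rfl
    rcases mul_eq_zero.1 hk with h | h
    · exact ε.ne_zero h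
    · exact hn h
  have hv : padicValInt 2 n = padicValInt 2 k + padicValInt 2 k := by
    have h1 : (n.natAbs : ℤ) = (k * k).natAbs := by
      rw [← hk, Int.natAbs_mul, Int.units_natAbs, one_mul]
    rw [← padicValInt.mul hk0 hk0, padicValInt, padicValInt]
    congr 1
    exact_mod_cast h1
  obtain ⟨n', hn', hnn⟩ := exists_two_pow_mul hn
  obtain ⟨k', hk', hkk⟩ := exists_two_pow_mul hk0
  refine ⟨⟨_, hv⟩, ?_⟩
  rw [(int_two_pow_mul_ediv hnn le_rfl).2, Nat.sub_self, pow_zero, one_mul]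
  have hsq : (ε : ℤ) * n' = k' * k' := by
    have hpos : (2 : ℤ) ^ padicValInt 2 n ≠ 0 := by positivity
    apply mul_left_cancel₀ hpos
    calc (2 : ℤ) ^ padicValInt 2 n * ((ε : ℤ) * n') = (ε : ℤ) * (2 ^ padicValInt 2 n * n') := by
          ring
      _ = k * k := by rw [← hnn, hk]
      _ = (2 ^ padicValInt 2 k * k') * (2 ^ padicValInt 2 k * k') := by rw [← hkk]
      _ = 2 ^ padicValInt 2 n * (k' * k') := by rw [hv, pow_add]; ring
  rw [hsq]
  rw [Int.odd_iff] at hk'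
  have h8 : k' % 8 = 1 ∨ k' % 8 = 3 ∨ k' % 8 = 5 ∨ k' % 8 = 7 := by omega
  rcases h8 with h | h | h | h <;> simp [Int.mul_emod, h]

theorem cCoeff_half_ne_zero {ε : ℤˣ} {n : ℤ} (hn : n ≠ 0) (h : IsSquare ((ε : ℤ) * n)) :
    cCoeff ε n (1 / 2) ≠ 0 := by
  obtain ⟨h1, h2⟩ := two_adic_of_isSquare hn h
  rw [cCoeff_eq ε hn]
  refine mul_ne_zero ?_ (twoFactor_half_ne_zero h1 h2)
  intro h0
  have := congrArg Complex.re h0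
  rcases Int.units_eq_one_or ε with rfl | rfl <;> simp at this

/-! ### Analytic continuation -/

/-- The factor at `2` of the `L`-function of the Kronecker symbol, inverted. -/
def eulerTwo (t : ℤ) (w : ℂ) : ℂ := 1 - (kronecker t 2 : ℂ) * 2 ^ (-w)

/-- The meromorphic continuation of the `L`-function of the Kronecker symbol. -/
def kroneckerLFunction (t : ℤ) [NeZero t.natAbs] (w : ℂ) : ℂ :=
  (eulerTwo t w)⁻¹ * DirichletCharacter.LFunction (jacobiChar t) w

theorem eulerTwo_ne_zero (t : ℤ) {w : ℂ} (hw : 0 < w.re) : eulerTwo t w ≠ 0 := by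
  refine one_sub_ne_zero_of_norm_lt ?_
  have h1 : ‖(kronecker t 2 : ℂ)‖ ≤ 1 := abs_kronecker_le t two_ne_zero
  have h2 : ‖(2 : ℂ) ^ (-w)‖ < 1 := norm_prime_cpow_lt ⟨2, Nat.prime_two⟩ hw
  rw [norm_mul]
  nlinarith [norm_nonneg (kronecker t 2 : ℂ), norm_nonneg ((2 : ℂ) ^ (-w))]

theorem differentiable_eulerTwo (t : ℤ) : Differentiable ℂ (eulerTwo t) :=
  ((Differentiable.const_cpow differentiable_id.neg (Or.inl two_ne_zero)).const_mul _).const_sub 1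

theorem eventually_eulerTwo_ne_zero (t : ℤ) (w : ℂ) :
    ∀ᶠ z in nhdsWithin w {w}ᶜ, eulerTwo t z ≠ 0 := by
  have ha : AnalyticOnNhd ℂ (eulerTwo t) Set.univ :=
    (differentiable_eulerTwo t).differentiableOn.analyticOnNhd isOpen_univ
  refine ((ha w trivial).eventually_eq_zero_or_eventually_ne_zero).resolve_left fun h => ?_
  have := ha.eqOn_zero_of_preconnected_of_eventuallyEq_zero isPreconnected_univ trivial h
    (Set.mem_univ (2 : ℂ))
  exact eulerTwo_ne_zero t (by norm_num) this

theorem kroneckerLFunction_eq (t : ℤ) [NeZero t.natAbs] {w : ℂ} (hw : 1 < w.re) :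
    kroneckerLFunction t w = kroneckerL t w := by
  rw [kroneckerLFunction, DirichletCharacter.LFunction_eq_LSeries _ hw, ← (kroneckerL_mul t hw).2]
  exact inv_mul_cancel_left₀ (eulerTwo_ne_zero t (by linarith)) _

/-- Only the trivial character needs an argument, and there (z - 1) L(z) extends to an entire
function. -/
theorem meromorphicAt_LFunction {N : ℕ} [NeZero N] (χ : DirichletCharacter ℂ N) (w : ℂ) :
    MeromorphicAt (DirichletCharacter.LFunction χ) w := by
  by_cases hχ : χ = 1
  · subst hχ
    have h1 : MeromorphicAt (DirichletCharacter.LFunctionTrivChar₁ N) w :=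
      ((DirichletCharacter.differentiable_LFunctionTrivChar₁ N).analyticAt w).meromorphicAt
    have h2 : MeromorphicAt (fun z : ℂ => z - 1) w := by fun_prop
    refine (h2.inv.mul h1).congr ?_
    have hne : ∀ᶠ z in nhdsWithin w {w}ᶜ, z ≠ 1 := by
      by_cases hw : w = 1
      · rw [hw]; exact self_mem_nhdsWithin
      · exact (isOpen_ne.eventually_mem hw).filter_mono nhdsWithin_le_nhds
    filter_upwards [hne] with z hz
    simp only [Pi.mul_apply, Pi.inv_apply]
    rw [DirichletCharacter.LFunctionTrivChar₁, Function.update_of_ne hz,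
      inv_mul_cancel_left₀ (sub_ne_zero.2 hz)]
  · exact ((DirichletCharacter.differentiable_LFunction hχ).analyticAt w).meromorphicAt

theorem meromorphicAt_kroneckerLFunction (t : ℤ) [NeZero t.natAbs] (w : ℂ) :
    MeromorphicAt (kroneckerLFunction t) w :=
  ((differentiable_eulerTwo t).analyticAt w).meromorphicAt.inv.mul
    (meromorphicAt_LFunction (jacobiChar t) w)

/-- At a zero of the Euler factor the defining formula has the default inverse 0, so the identity is
not formal. Analyticity makes both sides continuous at w, and they agree nearby because the zeros
are isolated; the point w = 1 is not such a zero. -/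
theorem eulerTwo_mul_kroneckerLFunction (t : ℤ) [NeZero t.natAbs] {w : ℂ}
    (h : AnalyticAt ℂ (kroneckerLFunction t) w) :
    eulerTwo t w * kroneckerLFunction t w = DirichletCharacter.LFunction (jacobiChar t) w := by
  by_cases h0 : eulerTwo t w = 0
  · have hw1 : w ≠ 1 := by
      rintro rfl
      exact eulerTwo_ne_zero t (by norm_num) h0
    have c1 : ContinuousAt (fun z => eulerTwo t z * kroneckerLFunction t z) w :=
      (differentiable_eulerTwo t).continuous.continuousAt.mul h.continuousAt
    have c2 : ContinuousAt (DirichletCharacter.LFunction (jacobiChar t)) w :=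
      (DirichletCharacter.differentiableAt_LFunction _ w (Or.inl hw1)).continuousAt
    refine tendsto_nhds_unique (c1.tendsto.mono_left (nhdsWithin_le_nhds (s := {w}ᶜ)))
      ((c2.tendsto.mono_left nhdsWithin_le_nhds).congr' ?_)
    filter_upwards [eventually_eulerTwo_ne_zero t w] with z hz
    rw [kroneckerLFunction, mul_inv_cancel_left₀ hz]
  · rw [kroneckerLFunction, mul_inv_cancel_left₀ h0]

theorem dirichletPoly_mul {m : ℤ} (hm : m ≠ 0) (ν z : ℂ) :
    dirichletPoly m ν * z = oddPoly m ν * (eulerTwo (oddPart m) (ν + 1 / 2) * z) := by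
  rw [dirichletPoly_eq hm, eulerTwo, neg_add']
  ring

/-- The continuation of the Fourier coefficient. -/
def fourierCoeffCont (ε : ℤˣ) (n : ℤ) [NeZero (oddPart ((ε : ℤ) * n)).natAbs] (ν : ℂ) : ℂ :=
  cCoeff ε n ν * (oddPoly ((ε : ℤ) * n) ν *
    DirichletCharacter.LFunction (jacobiChar (oddPart ((ε : ℤ) * n))) (ν + 1 / 2))

theorem isFourierCoeff_fourierCoeffCont (ε : ℤˣ) {n : ℤ} (hn : n ≠ 0)
    [NeZero (oddPart ((ε : ℤ) * n)).natAbs] {ν : ℂ} (hν : 1 < ν.re) :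
    IsFourierCoeff (restrictN (eisenstein ε ν)) n (fourierCoeffCont ε n ν) := by
  have h := isFourierCoeff_eisenstein ε n hν
  have hw : 1 < (ν + 1 / 2).re := by
    rw [Complex.add_re]
    norm_num
    linarith
  rwa [zeta2_mul_tsum_eisDirichletTerm ε hn hν, ← DirichletCharacter.LFunction_eq_LSeries _ hw] at h

theorem fourierCoeffCont_eq (ε : ℤˣ) {n : ℤ} (hn : n ≠ 0)
    [NeZero (oddPart ((ε : ℤ) * n)).natAbs] {ν : ℂ}
    (h : AnalyticAt ℂ (kroneckerLFunction (oddPart ((ε : ℤ) * n))) (ν + 1 / 2)) :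
    fourierCoeffCont ε n ν = cCoeff ε n ν * (dirichletPoly ((ε : ℤ) * n) ν *
      kroneckerLFunction (oddPart ((ε : ℤ) * n)) (ν + 1 / 2)) := by
  rw [dirichletPoly_mul (mul_ne_zero ε.ne_zero hn), eulerTwo_mul_kroneckerLFunction _ h,
    fourierCoeffCont]

theorem fourierCoeffCont_eq_scriptL (ε : ℤˣ) {n : ℤ} (hn : n ≠ 0)
    [NeZero (oddPart ((ε : ℤ) * n)).natAbs] {ν : ℂ} (hν : 1 < ν.re) :
    fourierCoeffCont ε n ν = cCoeff ε n ν * scriptL ((ε : ℤ) * n) ν := by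
  have hw : 1 < (ν + 1 / 2).re := by
    rw [Complex.add_re]
    norm_num
    linarith
  rw [scriptL, dirichletPoly_mul (mul_ne_zero ε.ne_zero hn), eulerTwo, (kroneckerL_mul _ hw).2,
    fourierCoeffCont, DirichletCharacter.LFunction_eq_LSeries _ hw]

theorem differentiable_fourierCoeffCont (ε : ℤˣ) {n : ℤ} (hn : n ≠ 0)
    [NeZero (oddPart ((ε : ℤ) * n)).natAbs] (h : ¬ IsSquare ((ε : ℤ) * n)) :
    Differentiable ℂ (fourierCoeffCont ε n) := by
  obtain ⟨d, hd, hJ⟩ := exists_jacobiSym_oddPart (mul_ne_zero ε.ne_zero hn) h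
  have hL := DirichletCharacter.differentiable_LFunction (jacobiChar_ne_one hd hJ)
  exact (differentiable_cCoeff ε hn).mul ((differentiable_oddPoly _).mul
    (hL.comp (differentiable_id.add_const _)))

theorem differentiableOn_fourierCoeffCont (ε : ℤˣ) {n : ℤ} (hn : n ≠ 0)
    [NeZero (oddPart ((ε : ℤ) * n)).natAbs] :
    DifferentiableOn ℂ (fourierCoeffCont ε n) {1 / 2}ᶜ := by
  intro ν hν
  have hw : ν + 1 / 2 ≠ 1 := fun h => hν (by
    rw [Set.mem_singleton_iff]; linear_combination h)
  have hL : DifferentiableAt ℂ (fun ν : ℂ =>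
      DirichletCharacter.LFunction (jacobiChar (oddPart ((ε : ℤ) * n))) (ν + 1 / 2)) ν :=
    DifferentiableAt.comp (g := DirichletCharacter.LFunction (jacobiChar (oddPart ((ε : ℤ) * n))))
      ν (DirichletCharacter.differentiableAt_LFunction _ _ (Or.inl hw))
      (differentiableAt_id.add_const _)
  exact ((differentiable_cCoeff ε hn ν).mul
    ((differentiable_oddPoly _ ν).mul hL)).differentiableWithinAt

/-- The character is trivial, and with s = ν + 1/2 the function (s - 1) L(s) extends to an entire
function, nonzero at s = 1. The other factors do not vanish at ν = 1/2, so the pole is not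
cancelled. -/
theorem meromorphicOrderAt_fourierCoeffCont (ε : ℤˣ) {n : ℤ} (hn : n ≠ 0)
    [NeZero (oddPart ((ε : ℤ) * n)).natAbs] (h : IsSquare ((ε : ℤ) * n)) :
    meromorphicOrderAt (fourierCoeffCont ε n) (1 / 2) = ((-1 : ℤ) : WithTop ℤ) := by
  have hm : (ε : ℤ) * n ≠ 0 := mul_ne_zero ε.ne_zero hn
  have hχ := jacobiChar_eq_one (oddPart_of_isSquare hm h)
  set N := 4 * (oddPart ((ε : ℤ) * n)).natAbs with hN
  have hg : Differentiable ℂ fun ν : ℂ => cCoeff ε n ν * (oddPoly ((ε : ℤ) * n) ν *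
      DirichletCharacter.LFunctionTrivChar₁ N (ν + 1 / 2)) :=
    (differentiable_cCoeff ε hn).mul ((differentiable_oddPoly _).mul
      ((DirichletCharacter.differentiable_LFunctionTrivChar₁ N).comp
        (differentiable_id.add_const _)))
  have heq : ∀ᶠ z : ℂ in nhdsWithin (1 / 2) {1 / 2}ᶜ, fourierCoeffCont ε n z =
      (z - 1 / 2) ^ (-1 : ℤ) • (cCoeff ε n z * (oddPoly ((ε : ℤ) * n) z *
        DirichletCharacter.LFunctionTrivChar₁ N (z + 1 / 2))) := by
    filter_upwards [self_mem_nhdsWithin] with z hz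
    have hz' : z - 1 / 2 ≠ 0 := sub_ne_zero.2 hz
    have hz1 : z + 1 / 2 ≠ 1 := fun h => hz' (by linear_combination h)
    rw [DirichletCharacter.LFunctionTrivChar₁, Function.update_of_ne hz1, fourierCoeffCont, hχ,
      zpow_neg_one, smul_eq_mul, show z + 1 / 2 - 1 = z - 1 / 2 by ring,
      mul_left_comm (oddPoly _ _) (z - 1 / 2), mul_left_comm (cCoeff _ _ _) (z - 1 / 2),
      inv_mul_cancel_left₀ hz']
  have hmer : MeromorphicAt (fourierCoeffCont ε n) (1 / 2) := by
    have h2 : MeromorphicAt (fun z : ℂ => (z - 1 / 2) ^ (-1 : ℤ)) (1 / 2) := by fun_prop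
    refine (h2.smul (hg.analyticAt (1 / 2)).meromorphicAt).congr ?_
    filter_upwards [heq] with z hz using hz.symm
  refine (meromorphicOrderAt_eq_int_iff hmer).2 ⟨_, hg.analyticAt _, ?_, heq⟩
  refine mul_ne_zero (cCoeff_half_ne_zero hn h) (mul_ne_zero (oddPoly_half_ne_zero hm h) ?_)
  rw [show (1 / 2 + 1 / 2 : ℂ) = 1 by norm_num]
  exact DirichletCharacter.LFunctionTrivChar₁_apply_one_ne_zero N

end MetaEis

end

/-! ### The Fourier coefficients of the Eisenstein distribution -/

theorem mainTheorem3 (ε : ℤˣ) (n : ℤ) (hn : n ≠ 0) :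
    -- for `Re ν > 1` the Eisenstein series converges to an element of the principal series
    (∀ ν : ℂ, 1 < ν.re →
      (∀ f : MetaEis.Smooth (-ε) (-ν),
        HasSum (fun q : MetaEis.Cosets => MetaEis.zeta2 (2 * ν + 1) * MetaEis.eisTerm ε ν q f)
          (MetaEis.eisenstein ε ν f)) ∧
      MetaEis.eisenstein ε ν ∈ MetaEis.Dist ε ν) ∧
    ∃ (a : ℂ → ℂ) (L : ℂ → ℂ),
      -- `a ν` is the `n`-th Fourier coefficient for `Re ν > 1`
      (∀ ν : ℂ, 1 < ν.re →
        MetaEis.IsFourierCoeff (MetaEis.restrictN (MetaEis.eisenstein ε ν)) n (a ν)) ∧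
      -- holomorphic continuation, and the pole
      (¬ IsSquare ((ε : ℤ) * n) → Differentiable ℂ a) ∧
      (IsSquare ((ε : ℤ) * n) →
        DifferentiableOn ℂ a {1 / 2}ᶜ ∧ meromorphicOrderAt a (1 / 2) = ((-1 : ℤ) : WithTop ℤ)) ∧
      -- the explicit formula for `Re ν > 1`
      (∀ ν : ℂ, 1 < ν.re → a ν = MetaEis.cCoeff ε n ν * MetaEis.scriptL ((ε : ℤ) * n) ν) ∧
      -- and its continuation, through the meromorphic continuation `L` of the `L`-function
      (∀ w : ℂ, MeromorphicAt L w) ∧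
      (∀ w : ℂ, 1 < w.re → LSeriesSummable
        (fun d : ℕ => (MetaEis.kronecker (MetaEis.oddPart ((ε : ℤ) * n)) d : ℂ)) w ∧
        L w = MetaEis.kroneckerL (MetaEis.oddPart ((ε : ℤ) * n)) w) ∧
      (∀ ν : ℂ, AnalyticAt ℂ L (ν + 1 / 2) →
        a ν = MetaEis.cCoeff ε n ν *
          (MetaEis.dirichletPoly ((ε : ℤ) * n) ν * L (ν + 1 / 2))) := by
  have hm : (ε : ℤ) * n ≠ 0 := mul_ne_zero ε.ne_zero hn
  have : NeZero (MetaEis.oddPart ((ε : ℤ) * n)).natAbs :=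
    ⟨Int.natAbs_ne_zero.2 (MetaEis.oddPart_ne_zero hm)⟩
  refine ⟨fun ν hν => ⟨MetaEis.hasSum_eisenstein ε hν, MetaEis.eisenstein_mem_dist ε hν⟩,
    MetaEis.fourierCoeffCont ε n, MetaEis.kroneckerLFunction (MetaEis.oddPart ((ε : ℤ) * n)),
    fun ν hν => MetaEis.isFourierCoeff_fourierCoeffCont ε hn hν,
    MetaEis.differentiable_fourierCoeffCont ε hn,
    fun h => ⟨MetaEis.differentiableOn_fourierCoeffCont ε hn,
      MetaEis.meromorphicOrderAt_fourierCoeffCont ε hn h⟩,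
    fun ν hν => MetaEis.fourierCoeffCont_eq_scriptL ε hn hν,
    MetaEis.meromorphicAt_kroneckerLFunction _,
    fun w hw => ⟨(MetaEis.kroneckerL_mul _ hw).1, MetaEis.kroneckerLFunction_eq _ hw⟩,
    fun ν h => MetaEis.fourierCoeffCont_eq ε hn h⟩
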